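/- Let $2\le k\le n-1$, $c_1,c_2\in\mathbb R$, $\mathcal H\in\mathbb R$. For $c\neq0$ let $\mathbb Q_c^m=\{x:\langle x,x\rangle=1/c\}$ in Euclidean space $\mathbb R^{m+1}$ if $c>0$, and its upper sheet in Lorentzian space $\mathbb R^{m+1}_1$ if $c<0$; let $\mathbb Q_0^m=\mathbb R^m$. All manifolds and maps are smooth, hypersurfaces are immersed, the shape operator with respect to a unit normal $N$ is $A=-(\tilde\nabla N)^{\top}$, and the mean curvature is the trace of $A$ divided by the dimension. A hypersurface of a space form with a unit normal field is isoparametric if its principal curvatures, with multiplicities, are constant. For a hypersurface $f\colon M^n\to\mathbb Q_{c_1}^k\times\mathbb Q_{c_2}^{n-k+1}$ with local unit normal $N$, let $R$ be the endomorphism field of $TM$ for which $f_*RX$ is the component tangent to $f$ of $\pi_2f_*X$, where $\pi_2$ is the projection onto the tangent space of the second factor; $f$ is in class $\mathcal A$ if $AR=RA$. We say that $f$ splits on an open set $W\subset M$ if, up to a diffeomorphism, $f|_W$ is a product $f_1\times i_2$ or $i_1\times f_2$, where $f_1$ (resp. $f_2$) is a hypersurface of the first (resp. second) factor and $i_2$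 (resp. $i_1$) is the inclusion of an open subset of the other factor. For a hypersurface $h$ of $\mathbb Q_c^m$ with unit normal field $N^h$ put $h_s=C_c(s)\,h+S_c(s)\,N^h$, where $(C_c(s),S_c(s))$ is $(\cos\sqrt c\,s,\ \sin(\sqrt c\,s)/\sqrt c)$ if $c>0$, $(1,s)$ if $c=0$, and $(\cosh\sqrt{-c}\,s,\ \sinh(\sqrt{-c}\,s)/\sqrt{-c})$ if $c<0$; where $h_s$ is an immersion it is oriented by the unit normal $N^h_s=\frac{d}{ds}h_s$. **Direct statement.** Let $h\colon M_1^{k-1}\to\mathbb Q_{c_1}^k$ and $g\colon M_2^{n-k}\to\mathbb Q_{c_2}^{n-k+1}$ be isoparametric hypersurfaces, and let $I=(-\delta,\delta)$, $\delta>0$, be such that $h_s$ and $g_s$ are immersions for all $s\in I$. Then, for each $s\in I$, $h_s$ and $g_s$ have constant mean curvatures $H^h(s)$ and $H^g(s)$. Let $\theta\colon I\to\mathbb R$ be a smooth function such that $\theta^{-1}(\{j\pi/2: j\in\mathbb Z\})$ has empty interior and $$\theta'(s)-(k-1)\sin\theta(s)\,H^h(a(s))+(n-k)\cos\theta(s)\,H^g(b(s))=n\mathcal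 H\qquad\text{for all }s\in I,$$ where $a(s)=\int_0^s\cos\theta(u)\,du$ and $b(s)=\int_0^s\sin\theta(u)\,du$. Then the map $f\colon I\times M_1\times M_2\to\mathbb Q_{c_1}^k\times\mathbb Q_{c_2}^{n-k+1}$ given by $$f(s,x_1,x_2)=h_{a(s)}(x_1)+g_{b(s)}(x_2)=\bigl(h_{a(s)}(x_1),\,g_{b(s)}(x_2)\bigr)$$ is a hypersurface in class $\mathcal A$ with constant mean curvature $\mathcal H$ that does not split on any nonempty open subset. **Converse.** Let $f\colon M^n\to\mathbb Q_{c_1}^k\times\mathbb Q_{c_2}^{n-k+1}$ be a hypersurface in class $\mathcal A$ with constant mean curvature $\mathcal H$ (with respect to suitable local unit normals) that does not split on any nonempty open subset. Then there is an open and dense subset $U\subset M$ such that every point of $U$ has an open neighbourhood $W\subset M$ on which $f$ is, up to a diffeomorphism $I\times M_1\times M_2\to W$, given as in the direct statement, for some $\delta,h,g,\theta$ as there. -/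

import Mathlib

open scoped Manifold ContDiff
open TopologicalSpace (Opens)

noncomputable section

/-! ### Space forms as quadrics of flat spaces -/

/-- Dimension of the flat space containing `ℚ_c^m`: `m` if `c = 0`, otherwise `m + 1`. -/
def ambientDim (c : ℝ) (m : ℕ) : ℕ := if c = 0 then m else m + 1

/-- The flat space `ℝ^N_{σ(c)}` containing `ℚ_c^m`.  Only its linear and smooth structure come
from this type; its (possibly Lorentzian) scalar product is `flatForm`. -/
abbrev Ambient (c : ℝ) (m : ℕ) : Type := Fin (ambientDim c m) → ℝ

/-- The flat scalar product: Euclidean if `0 ≤ c`, Lorentzian (coordinate `0` negative)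
if `c < 0`. -/
def flatForm (c : ℝ) {m : ℕ} (x y : Ambient c m) : ℝ :=
  ∑ i : Fin (ambientDim c m), (if c < 0 ∧ (i : ℕ) = 0 then (-1 : ℝ) else 1) * (x i * y i)

/-- The space form `ℚ_c^m`: all of `ℝ^m` if `c = 0`, the sphere `⟨x, x⟩ = 1 / c` if `0 < c`, the
upper sheet of the hyperboloid `⟨x, x⟩ = 1 / c` if `c < 0`. -/
def spaceForm (c : ℝ) (m : ℕ) : Set (Ambient c m) :=
  {x | (c ≠ 0 → flatForm c x x = 1 / c) ∧
    ∀ i : Fin (ambientDim c m), c < 0 → (i : ℕ) = 0 → 0 < x i}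

/-- The tangent space of `ℚ_c^m` at `p`, inside the flat space. -/
def spaceFormTangent (c : ℝ) {m : ℕ} (p : Ambient c m) : Set (Ambient c m) :=
  {v | c ≠ 0 → flatForm c p v = 0}

/-- The scalar product of the flat space containing `ℚ_{c₁}^{m₁} × ℚ_{c₂}^{m₂}`. -/
def prodForm (c₁ c₂ : ℝ) {m₁ m₂ : ℕ} (p q : Ambient c₁ m₁ × Ambient c₂ m₂) : ℝ :=
  flatForm c₁ p.1 q.1 + flatForm c₂ p.2 q.2

/-- The tangent space of `ℚ_{c₁}^{m₁} × ℚ_{c₂}^{m₂}` at `p`. -/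
def prodTangent (c₁ c₂ : ℝ) {m₁ m₂ : ℕ} (p : Ambient c₁ m₁ × Ambient c₂ m₂) :
    Set (Ambient c₁ m₁ × Ambient c₂ m₂) :=
  spaceFormTangent c₁ p.1 ×ˢ spaceFormTangent c₂ p.2

/-- `cos (s / r)`, `1`, `cosh (s / r)` for `c = 1 / r²`, `c = 0`, `c = - 1 / r²`. -/
def cosC (c s : ℝ) : ℝ :=
  if 0 < c then Real.cos (√c * s) else if c < 0 then Real.cosh (√(-c) * s) else 1

/-- `r sin (s / r)`, `s`, `r sinh (s / r)` for `c = 1 / r²`, `c = 0`, `c = - 1 / r²`. -/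
def sinC (c s : ℝ) : ℝ :=
  if 0 < c then Real.sin (√c * s) / √c else if c < 0 then Real.sinh (√(-c) * s) / √(-c) else s

/-! ### Immersions, unit normals, shape operators, mean curvature -/

section Immersions

variable {E : Type*} [NormedAddCommGroup E] [NormedSpace ℝ E]
  {H : Type*} [TopologicalSpace H] (J : ModelWithCorners ℝ E H)
  {M : Type*} [TopologicalSpace M] [ChartedSpace H M]
  {V : Type*} [NormedAddCommGroup V] [NormedSpace ℝ V]

/-- The differential of a map into a vector space. -/
def diffMap (f : M → V) (x : M) : TangentSpace J x →L[ℝ] V := mfderiv J 𝓘(ℝ, V) f x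

/-- `f` is a smooth immersion with values in `S`. -/
structure IsImmersionInto (S : Set V) (f : M → V) : Prop where
  smooth : ContMDiff J 𝓘(ℝ, V) ∞ f
  mem : ∀ x, f x ∈ S
  injective_diff : ∀ x, Function.Injective (diffMap J f x)

/-- `N` is, on `U`, a smooth unit normal field of `f`, where `B` is the scalar product of the flat
space `V` and `T p` the tangent space at `p` of the submanifold of `V` containing the image
of `f`. -/
structure IsUnitNormalOn (B : V → V → ℝ) (T : V → Set V) (f N : M → V) (U : Set M) : Prop where
  smooth : ContMDiffOn J 𝓘(ℝ, V) ∞ N U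
  tangent : ∀ x ∈ U, N x ∈ T (f x)
  unit : ∀ x ∈ U, B (N x) (N x) = 1
  normal : ∀ x ∈ U, ∀ X : TangentSpace J x, B (N x) (diffMap J f x X) = 0

/-- `A` is the shape operator at `x` of `f` with respect to the unit normal `N`: the tangential
part of the derivative of `N` in the direction `X` is `- f_* (A X)`. -/
def IsShapeOperator (B : V → V → ℝ) (f N : M → V) (x : M)
    (A : TangentSpace J x →ₗ[ℝ] TangentSpace J x) : Prop :=
  ∀ X Y : TangentSpace J x,
    B (diffMap J f x (A X)) (diffMap J f x Y) = - B (diffMap J N x X) (diffMap J f x Y)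

open Classical in
/-- The shape operator.  It exists and is unique when `f` is an immersion with positive definite
induced metric. -/
def shapeOperator (B : V → V → ℝ) (f N : M → V) (x : M) :
    TangentSpace J x →ₗ[ℝ] TangentSpace J x :=
  if h : ∃ A, IsShapeOperator J B f N x A then h.choose else 0

/-- The mean curvature of `f` at `x` with respect to `N`: the trace of the shape operator divided
by the dimension. -/
def meanCurvature (B : V → V → ℝ) (f N : M → V) (x : M) : ℝ :=
  LinearMap.trace ℝ (TangentSpace J x) (shapeOperator J B f N x) / Module.finrank ℝ E

end Immersions

/-! ### Diffeomorphisms onto open subsets -/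

/-- `Φ` is a diffeomorphism onto an open subset of `M`. -/
structure IsDiffeoOntoOpen {E : Type*} [NormedAddCommGroup E] [NormedSpace ℝ E]
    {H : Type*} [TopologicalSpace H] (J : ModelWithCorners ℝ E H)
    {E' : Type*} [NormedAddCommGroup E'] [NormedSpace ℝ E']
    {H' : Type*} [TopologicalSpace H'] (J' : ModelWithCorners ℝ E' H')
    {P : Type*} [TopologicalSpace P] [ChartedSpace H P]
    {M : Type*} [TopologicalSpace M] [ChartedSpace H' M] (Φ : P → M) : Prop where
  smooth : ContMDiff J J' ∞ Φ
  openEmbedding : Topology.IsOpenEmbedding Φ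
  bijective_diff : ∀ x, Function.Bijective (mfderiv J J' Φ x)

/-! ### Hypersurfaces of a space form, parallel families, isoparametric hypersurfaces -/

section Parallel

variable {E : Type*} [NormedAddCommGroup E] [NormedSpace ℝ E]
  {H : Type*} [TopologicalSpace H] (J : ModelWithCorners ℝ E H)
  {M : Type*} [TopologicalSpace M] [ChartedSpace H M]
  (c : ℝ) {m : ℕ}

/-- The parallel map `h_s` at distance `s` of a hypersurface `h` with unit normal `N`. -/
def parallelMap (h N : M → Ambient c m) (s : ℝ) (x : M) : Ambient c m :=
  cosC c s • h x + sinC c s • N x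

/-- The unit normal `N_s = d h_s / ds` of the parallel map `h_s`. -/
def parallelNormal (h N : M → Ambient c m) (s : ℝ) (x : M) : Ambient c m :=
  (-(c * sinC c s)) • h x + cosC c s • N x

instance [FiniteDimensional ℝ E] (x : M) : Module.Finite ℝ (TangentSpace J x) :=
  inferInstanceAs (Module.Finite ℝ E)

/-- `h` is a hypersurface of `ℚ_c^m` with unit normal field `N` that is isoparametric, that is, its
principal curvatures (the roots, with multiplicities, of the characteristic polynomial of the shape
operator) are constant. -/
structure IsIsoparametric [FiniteDimensional ℝ E] (h N : M → Ambient c m) : Prop where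
  immersion : IsImmersionInto J (spaceForm c m) h
  unitNormal : IsUnitNormalOn J (flatForm c) (spaceFormTangent c) h N Set.univ
  const : ∀ x y, (shapeOperator J (flatForm c) h N x).charpoly =
    (shapeOperator J (flatForm c) h N y).charpoly

/-- The parallel maps `h_s`, `s ∈ (-δ, δ)`, are immersions. -/
def ParallelImmersions (h N : M → Ambient c m) (δ : ℝ) : Prop :=
  ∀ s ∈ Set.Ioo (-δ) δ, ∀ x, Function.Injective (diffMap J (parallelMap c h N s) x)

/-- For each `s ∈ (-δ, δ)`, the mean curvature of `h_s` is constant, with value `Hh s`. -/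
def ParallelMeanCurvature (h N : M → Ambient c m) (δ : ℝ) (Hh : ℝ → ℝ) : Prop :=
  ∀ s ∈ Set.Ioo (-δ) δ, ∀ x,
    meanCurvature J (flatForm c) (parallelMap c h N s) (parallelNormal c h N s) x = Hh s

end Parallel

/-! ### Hypersurfaces of a product of two space forms -/

section Product

variable {E : Type*} [NormedAddCommGroup E] [NormedSpace ℝ E]
  {H : Type*} [TopologicalSpace H] (J : ModelWithCorners ℝ E H)
  {M : Type*} [TopologicalSpace M] [ChartedSpace H M]
  (c₁ c₂ : ℝ) {m₁ m₂ : ℕ}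

/-- `f` is an immersion into `ℚ_{c₁}^{m₁} × ℚ_{c₂}^{m₂}`. -/
def IsProductImmersion (f : M → Ambient c₁ m₁ × Ambient c₂ m₂) : Prop :=
  IsImmersionInto J (spaceForm c₁ m₁ ×ˢ spaceForm c₂ m₂) f

/-- `R` is the tensor at `x` given by `π₂ f_* X = f_* (R X) + ⟨π₂ f_* X, N⟩ N`. -/
def IsProductTensor (f N : M → Ambient c₁ m₁ × Ambient c₂ m₂) (x : M)
    (R : TangentSpace J x →ₗ[ℝ] TangentSpace J x) : Prop :=
  ∀ X : TangentSpace J x,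
    ((0, (diffMap J f x X).2) : Ambient c₁ m₁ × Ambient c₂ m₂) =
      diffMap J f x (R X) + prodForm c₁ c₂ (0, (diffMap J f x X).2) (N x) • N x

/-- Class `𝒜`: the shape operator commutes with the tensor `R`.  Neither the condition nor `R`
depends on the choice of the local unit normal. -/
def InClassA (f : M → Ambient c₁ m₁ × Ambient c₂ m₂) : Prop :=
  ∀ x₀, ∃ U : Set M, IsOpen U ∧ x₀ ∈ U ∧ ∃ N : M → Ambient c₁ m₁ × Ambient c₂ m₂,
    IsUnitNormalOn J (prodForm c₁ c₂) (prodTangent c₁ c₂) f N U ∧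
    ∀ x ∈ U, ∃ R : TangentSpace J x →ₗ[ℝ] TangentSpace J x,
      IsProductTensor J c₁ c₂ f N x R ∧
      Commute (shapeOperator J (prodForm c₁ c₂) f N x) R

/-- `f` has constant mean curvature `𝓗` with respect to suitable local unit normals.  (For
`𝓗 ≠ 0` these fit together to a global one; for `𝓗 = 0` the choice is immaterial.) -/
def HasConstantMeanCurvature (f : M → Ambient c₁ m₁ × Ambient c₂ m₂) (𝓗 : ℝ) : Prop :=
  ∀ x₀, ∃ U : Set M, IsOpen U ∧ x₀ ∈ U ∧ ∃ N : M → Ambient c₁ m₁ × Ambient c₂ m₂,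
    IsUnitNormalOn J (prodForm c₁ c₂) (prodTangent c₁ c₂) f N U ∧
    ∀ x ∈ U, meanCurvature J (prodForm c₁ c₂) f N x = 𝓗

/-- `f` splits on the subset `W`: up to a diffeomorphism `Φ`, the restriction of `f` to `W` is
either `f₁ × i₂`, where `f₁` is a hypersurface of `ℚ_{c₁}^{m₁}` and `i₂` the inclusion of an open
subset of `ℚ_{c₂}^{m₂}`, or `i₁ × f₂`, likewise.  The inclusion of an open subset of a space form is
written in a local parametrization, that is, as an injective immersion from an open subset of a
Euclidean space of the same dimension; the domain of the hypersurface of the factor may be taken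
to be an open subset of a Euclidean space as well, since `W` may be shrunk. -/
def SplitsOn (f : M → Ambient c₁ m₁ × Ambient c₂ m₂) (W : Set M) : Prop :=
  (∃ (U₁ : Opens (EuclideanSpace ℝ (Fin (m₁ - 1)))) (U₂ : Opens (EuclideanSpace ℝ (Fin m₂)))
      (Φ : U₁ × U₂ → M) (f₁ : U₁ → Ambient c₁ m₁) (i₂ : U₂ → Ambient c₂ m₂),
      IsDiffeoOntoOpen ((𝓡 (m₁ - 1)).prod (𝓡 m₂)) J Φ ∧ Set.range Φ = W ∧
      IsImmersionInto (𝓡 (m₁ - 1)) (spaceForm c₁ m₁) f₁ ∧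
      IsImmersionInto (𝓡 m₂) (spaceForm c₂ m₂) i₂ ∧ Function.Injective i₂ ∧
      ∀ u, f (Φ u) = (f₁ u.1, i₂ u.2)) ∨
  (∃ (U₁ : Opens (EuclideanSpace ℝ (Fin m₁))) (U₂ : Opens (EuclideanSpace ℝ (Fin (m₂ - 1))))
      (Φ : U₁ × U₂ → M) (i₁ : U₁ → Ambient c₁ m₁) (f₂ : U₂ → Ambient c₂ m₂),
      IsDiffeoOntoOpen ((𝓡 m₁).prod (𝓡 (m₂ - 1))) J Φ ∧ Set.range Φ = W ∧
      IsImmersionInto (𝓡 m₁) (spaceForm c₁ m₁) i₁ ∧ Function.Injective i₁ ∧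
      IsImmersionInto (𝓡 (m₂ - 1)) (spaceForm c₂ m₂) f₂ ∧
      ∀ u, f (Φ u) = (i₁ u.1, f₂ u.2))

/-- `f` does not split on any (nonempty) open subset. -/
def NowhereSplits (f : M → Ambient c₁ m₁ × Ambient c₂ m₂) : Prop :=
  ∀ W : Set M, IsOpen W → W.Nonempty → ¬ SplitsOn J c₁ c₂ f W

end Product

/-! ### The construction -/

/-- The interval `(-δ, δ)` as a manifold. -/
def symmInterval (δ : ℝ) : Opens ℝ := ⟨Set.Ioo (-δ) δ, isOpen_Ioo⟩

/-- `a(s) = ∫₀ˢ cos θ(u) du`. -/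
def intCos (θ : ℝ → ℝ) (s : ℝ) : ℝ := ∫ u in (0 : ℝ)..s, Real.cos (θ u)

/-- `b(s) = ∫₀ˢ sin θ(u) du`. -/
def intSin (θ : ℝ → ℝ) (s : ℝ) : ℝ := ∫ u in (0 : ℝ)..s, Real.sin (θ u)

/-- `θ` is smooth on `(-δ, δ)`, is an integer multiple of `π / 2` only on a set with empty interior,
and satisfies there
`θ' - (k - 1) sin θ Hʰ(a(s)) + (n - k) cos θ Hᵍ(b(s)) = n 𝓗`. -/
structure IsAngleSolution (n k : ℕ) (𝓗 δ : ℝ) (Hh Hg θ : ℝ → ℝ) : Prop where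
  smooth : ContDiffOn ℝ ∞ θ (Set.Ioo (-δ) δ)
  interior_empty :
    interior {s | s ∈ Set.Ioo (-δ) δ ∧ ∃ j : ℤ, θ s = j * (Real.pi / 2)} = ∅
  ode : ∀ s ∈ Set.Ioo (-δ) δ,
    deriv θ s - ((k : ℝ) - 1) * Real.sin (θ s) * Hh (intCos θ s)
      + ((n : ℝ) - k) * Real.cos (θ s) * Hg (intSin θ s) = n * 𝓗

/-- The map `f(s, x₁, x₂) = h_{a(s)}(x₁) + g_{b(s)}(x₂)`, the sum being that of the orthogonal
direct sum of the two flat spaces. -/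
def angleMap {M₁ M₂ : Type*} (c₁ c₂ : ℝ) {m₁ m₂ : ℕ} (h Nh : M₁ → Ambient c₁ m₁)
    (g Ng : M₂ → Ambient c₂ m₂) (δ : ℝ) (θ : ℝ → ℝ) :
    symmInterval δ × M₁ × M₂ → Ambient c₁ m₁ × Ambient c₂ m₂ :=
  fun p => (parallelMap c₁ h Nh (intCos θ p.1) p.2.1, parallelMap c₂ g Ng (intSin θ p.1) p.2.2)

end

/-! Parallel families. If `A` is the shape operator of `h`, then `dh_s = dh ∘ (C - S A)` with `C =
C_c(s)`, `S = S_c(s)`, and the shape operator `T` of `h_s` satisfies `(C - S A) T = c S + C A`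
(`parallel_shape`). By the addition formulas the function `D_A(s) = det (C - S A)` obeys `D_A(s + t)
= D_A(s) D_T(t)`, so its logarithmic derivative at `s` is `-tr T` (`hasDerivAt_parallelDet`).
Moreover `D_A` and the characteristic polynomial of `A` determine each other. This gives Cartan's
criterion in both directions. Constant principal curvatures make `D_A`, hence the mean curvature of
each `h_s`, independent of the point (`exists_parallelMeanCurvature`). If conversely all nearby
`h_s` have constant mean curvature, the quotient of the functions `D_A` at two points has zero
derivative and value `1` at `s = 0` (`isIsoparametric_of_meanCurvature`).

Direct statement. Since `∂_s f = (cos θ Nʰ_a, sin θ Nᵍ_b)`, the unit normal is `(-sin θ Nʰ_a, cos θ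
Nᵍ_b)`. With respect to `ℝ ⊕ TM₁ ⊕ TM₂` the shape operator is block diagonal with blocks `θ'`, `-sin
θ Aʰ_a`, `cos θ Aᵍ_b`, and `R` has the scalar blocks `sin² θ`, `0`, `1`
(`AngleData.shapeOperator_eq`, `AngleData.inClassA`). They commute, and the trace of the first is
the left side of the differential equation. Where `f` splits, the normal is tangent to one factor,
so `sin θ` or `cos θ` vanishes on an open set of parameters.

Converse. Consider points where both components of the unit normal are nonzero, and write it as `(-p
η₁, q η₂)` with unit vectors `η₁`, `η₂` and `p, q > 0`. The kernels of `df₂` and `df₁` are the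
eigenspaces of `R` for `0` and `1`. Hence the shape operator preserves them, and this forces each
component of the normal to be constant along the kernel of the corresponding component of `df`
(`InClassA.normal_diff_eq_zero`). Combined with the symmetry of the second fundamental form, this
yields the facts about a `Frame`: the vector `Z` with `df Z = (q η₁, p η₂)` complements the two
kernels, `dη₁ Z = -c₁ q f₁` and likewise for `η₂` (geodesics), `p` and `q` vary only along `Z`, and
the one-forms `α = ⟨η₁, df₁⟩`, `β = ⟨η₂, df₂⟩` and `ω = q α + p β` are closed.

Let `a`, `b`, `σ` be primitives of `α`, `β`, `ω`. Going back from `f₁` along the geodesic with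
direction `η₁` for time `a` leads to a foot point that is constant along `Z` and along `ker df₁`;
the same holds in the second factor. The foot points and `σ` give coordinates `(s, u₁, u₂)` in which
`f` is the angle map with `cos θ = q` and `sin θ = p`
(`AdaptedHypersurface.exists_adaptedCoordinates`, `AdaptedCoordinates.fst_eq`). In the formula for
the mean curvature only one term depends on `u₁` and only one on `u₂`, with coefficients that do not
vanish. So constancy of the mean curvature makes every nearby parallel hypersurface of the two
profiles of constant mean curvature, and Cartan's criterion applies (`AngleData.isIsoparametric`).

Density. If an open set contains no such point, then locally a component of the normal vanishes at
every point. The kernels of `df₁` and `df₂` then span the tangent space, and `f` is locally a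
product (`IsUnitNormalOn.exists_product`), contrary to the assumption that `f` nowhere splits
(`dense_genericSet`). -/

/-! ### The flat scalar product -/

section FlatForm

variable (c : ℝ) {m : ℕ}

/-- The flat scalar product as a continuous bilinear map. -/
noncomputable def flatFormL (c : ℝ) (m : ℕ) : Ambient c m →L[ℝ] Ambient c m →L[ℝ] ℝ :=
  (LinearMap.mk₂ ℝ (fun x y : Ambient c m => flatForm c x y)
    (fun x y z => by
      simp only [flatForm, Pi.add_apply, ← Finset.sum_add_distrib]
      exact Finset.sum_congr rfl fun i _ => by ring)
    (fun r x y => by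
      simp only [flatForm, Pi.smul_apply, smul_eq_mul, Finset.mul_sum]
      exact Finset.sum_congr rfl fun i _ => by ring)
    (fun x y z => by
      simp only [flatForm, Pi.add_apply, ← Finset.sum_add_distrib]
      exact Finset.sum_congr rfl fun i _ => by ring)
    (fun r x y => by
      simp only [flatForm, Pi.smul_apply, smul_eq_mul, Finset.mul_sum]
      exact Finset.sum_congr rfl fun i _ => by ring)).toContinuousBilinearMap

theorem flatFormL_apply (x y : Ambient c m) : flatFormL c m x y = flatForm c x y := rfl

theorem flatForm_comm (x y : Ambient c m) : flatForm c x y = flatForm c y x :=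
  Finset.sum_congr rfl fun i _ => by ring

theorem flatForm_add_left (x y z : Ambient c m) :
    flatForm c (x + y) z = flatForm c x z + flatForm c y z := by
  simp only [← flatFormL_apply, map_add, add_apply]

theorem flatForm_add_right (x y z : Ambient c m) :
    flatForm c x (y + z) = flatForm c x y + flatForm c x z := by
  simp only [← flatFormL_apply, map_add]

theorem flatForm_sub_left (x y z : Ambient c m) :
    flatForm c (x - y) z = flatForm c x z - flatForm c y z := by
  simp only [← flatFormL_apply, map_sub, sub_apply]

theorem flatForm_sub_right (x y z : Ambient c m) :
    flatForm c x (y - z) = flatForm c x y - flatForm c x z := by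
  simp only [← flatFormL_apply, map_sub]

theorem flatForm_neg_left (x y : Ambient c m) : flatForm c (-x) y = -flatForm c x y := by
  simp only [← flatFormL_apply, map_neg, neg_apply]

theorem flatForm_neg_right (x y : Ambient c m) : flatForm c x (-y) = -flatForm c x y := by
  simp only [← flatFormL_apply, map_neg]

theorem flatForm_smul_left (r : ℝ) (x y : Ambient c m) :
    flatForm c (r • x) y = r * flatForm c x y := by
  simp only [← flatFormL_apply, map_smul, smul_apply, smul_eq_mul]

theorem flatForm_smul_right (r : ℝ) (x y : Ambient c m) :
    flatForm c x (r • y) = r * flatForm c x y := by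
  simp only [← flatFormL_apply, map_smul, smul_eq_mul]

@[simp] theorem flatForm_zero_left (y : Ambient c m) : flatForm c 0 y = 0 := by
  simp [flatForm]

@[simp] theorem flatForm_zero_right (y : Ambient c m) : flatForm c y 0 = 0 := by
  simp [flatForm]

theorem ambientDim_of_ne {c : ℝ} (hc : c ≠ 0) (m : ℕ) : ambientDim c m = m + 1 := if_neg hc

theorem flatForm_of_nonneg {c : ℝ} (hc : 0 ≤ c) (x y : Ambient c m) :
    flatForm c x y = ∑ i, x i * y i := by
  simp [flatForm, not_lt.2 hc]

/-- The time coordinate of the Lorentzian space. -/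
def timeIndex {c : ℝ} (hc : c < 0) (m : ℕ) : Fin (ambientDim c m) :=
  ⟨0, by rw [ambientDim_of_ne hc.ne]; exact m.succ_pos⟩

theorem flatForm_of_neg {c : ℝ} (hc : c < 0) (x y : Ambient c m) :
    flatForm c x y = ∑ i ∈ Finset.univ.erase (timeIndex hc m), x i * y i
      - x (timeIndex hc m) * y (timeIndex hc m) := by
  have : ∑ i ∈ Finset.univ.erase (timeIndex hc m), x i * y i =
      ∑ i ∈ Finset.univ.erase (timeIndex hc m),
        (if c < 0 ∧ (i : ℕ) = 0 then (-1 : ℝ) else 1) * (x i * y i) := by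
    refine Finset.sum_congr rfl fun i hi => ?_
    have : (i : ℕ) ≠ 0 := fun h => (Finset.mem_erase.1 hi).1 (Fin.ext h)
    simp [this]
  rw [this, flatForm, ← Finset.sum_erase_add _ _ (Finset.mem_univ (timeIndex hc m))]
  simp [timeIndex, hc, sub_eq_add_neg]

/-- In the hyperbolic case, the reversed Cauchy-Schwarz inequality. -/
theorem time_sq_le {c : ℝ} (hc : c < 0) {p v : Ambient c m} (hp : p ∈ spaceForm c m)
    (hv : v ∈ spaceFormTangent c p) :
    v (timeIndex hc m) ^ 2 ≤ -c * p (timeIndex hc m) ^ 2 * flatForm c v v := by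
  have h1 := hp.1 hc.ne
  have h2 := hv hc.ne
  rw [flatForm_of_neg hc] at h1 h2 ⊢
  set i := timeIndex hc m
  -- Cauchy-Schwarz for the spatial coordinates. The equations of the hyperboloid and of its tangent
  -- space express the spatial sums `P` and `∑ p j * v j` through the time coordinates.
  have h3 := Finset.sum_mul_sq_le_sq_mul_sq (Finset.univ.erase i) p v
  simp only [← sq] at h1 ⊢
  set P := ∑ j ∈ Finset.univ.erase i, p j ^ 2
  set V := ∑ j ∈ Finset.univ.erase i, v j ^ 2
  have hP : P = p i ^ 2 + 1 / c := by linarith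
  have hS : ∑ j ∈ Finset.univ.erase i, p j * v j = p i * v i := by linarith
  rw [hS, hP] at h3
  have h4 : (p i * v i) ^ 2 ≤ p i ^ 2 * V + 1 / c * V := by linarith
  have h5 := mul_le_mul_of_nonneg_left h4 (neg_nonneg.2 hc.le)
  have h6 : -c * (p i ^ 2 * V + 1 / c * V) = -c * p i ^ 2 * V - V := by
    have := hc.ne
    linear_combination (-V) * mul_one_div_cancel this
  have hp0 : 0 < p i := hp.2 i hc rfl
  by_cases hV : v i ^ 2 ≤ V
  · nlinarith
  · push Not at hV
    exfalso
    have h7 : 0 ≤ V := Finset.sum_nonneg fun j _ => sq_nonneg _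
    have h8 : 1 / c * V ≤ 0 := mul_nonpos_of_nonpos_of_nonneg (one_div_nonpos.2 hc.le) h7
    have : p i ^ 2 * V < p i ^ 2 * v i ^ 2 := mul_lt_mul_of_pos_left hV (by positivity)
    nlinarith

/-- Tangent vectors of the hyperboloid are spacelike: `time_sq_le` settles the case of a nonzero
time coordinate, and otherwise the form is a Euclidean sum of squares. -/
theorem flatForm_pos {p v : Ambient c m} (hp : p ∈ spaceForm c m)
    (hv : v ∈ spaceFormTangent c p) (hv0 : v ≠ 0) : 0 < flatForm c v v := by
  have hex : ∃ i, v i ≠ 0 := by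
    by_contra! h
    exact hv0 (funext h)
  obtain ⟨j, hj⟩ := hex
  rcases lt_or_ge c 0 with hc | hc
  · have h := time_sq_le hc hp hv
    have hp0 : 0 < p (timeIndex hc m) := hp.2 _ hc rfl
    have hcp : 0 < -c * p (timeIndex hc m) ^ 2 := mul_pos (by linarith) (by positivity)
    by_cases ht : v (timeIndex hc m) = 0
    · rw [flatForm_of_neg hc, ht]
      have hjt : j ≠ timeIndex hc m := fun h => hj (h ▸ ht)
      have : 0 < ∑ i ∈ Finset.univ.erase (timeIndex hc m), v i * v i :=
        Finset.sum_pos' (fun i _ => mul_self_nonneg _)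
          ⟨j, Finset.mem_erase.2 ⟨hjt, Finset.mem_univ _⟩, mul_self_pos.2 hj⟩
      linarith
    · exact pos_of_mul_pos_right ((by positivity : 0 < v (timeIndex hc m) ^ 2).trans_le h) hcp.le
  · rw [flatForm_of_nonneg hc]
    exact Finset.sum_pos' (fun i _ => mul_self_nonneg _) ⟨j, Finset.mem_univ _, mul_self_pos.2 hj⟩

/-- The tangent space of a space form as a subspace. -/
noncomputable def tangentSub (c : ℝ) {m : ℕ} (p : Ambient c m) : Submodule ℝ (Ambient c m) where
  carrier := spaceFormTangent c p
  add_mem' {v w} hv hw hc := by rw [flatForm_add_right, hv hc, hw hc, add_zero]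
  zero_mem' _ := flatForm_zero_right c p
  smul_mem' r v hv hc := by rw [flatForm_smul_right, hv hc, mul_zero]

theorem mem_tangentSub {p v : Ambient c m} : v ∈ tangentSub c p ↔ v ∈ spaceFormTangent c p :=
  Iff.rfl

/-- For `c ≠ 0` the tangent space is the kernel of `⟨p, ·⟩` on a space of dimension `m + 1`, and
this functional is nonzero because `⟨p, p⟩ = 1 / c`. -/
theorem finrank_tangentSub {p : Ambient c m} (hp : p ∈ spaceForm c m) :
    Module.finrank ℝ (tangentSub c p) = m := by
  by_cases hc : c = 0
  · have : tangentSub c p = ⊤ := by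
      ext v
      simp [mem_tangentSub, spaceFormTangent, hc]
    rw [this, finrank_top, Module.finrank_fin_fun]
    exact if_pos hc
  · have hker : tangentSub c p = LinearMap.ker (flatFormL c m p : Ambient c m →ₗ[ℝ] ℝ) := by
      ext v
      simp [mem_tangentSub, spaceFormTangent, hc, flatFormL_apply]
    have hsurj : LinearMap.range (flatFormL c m p : Ambient c m →ₗ[ℝ] ℝ) = ⊤ := by
      refine LinearMap.range_eq_top.2 (LinearMap.surjective fun h => ?_)
      have h0 : flatForm c p p = 0 := by
        simpa [flatFormL_apply] using LinearMap.congr_fun h p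
      rw [hp.1 hc] at h0
      exact one_div_ne_zero hc h0
    have h := LinearMap.finrank_range_add_finrank_ker (flatFormL c m p : Ambient c m →ₗ[ℝ] ℝ)
    rw [hsurj, finrank_top, Module.finrank_self, Module.finrank_fin_fun] at h
    have h' := ambientDim_of_ne hc m
    rw [hker]
    omega

end FlatForm

/-! ### The generalized trigonometric functions -/

section Trig

variable (c s t : ℝ)

theorem hasDerivAt_cosC : HasDerivAt (cosC c) (-(c * sinC c s)) s := by
  unfold cosC sinC
  split_ifs with h1 h2
  · have h := ((hasDerivAt_id s).const_mul √c).cos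
    refine h.congr_deriv ?_
    have := Real.sqrt_pos.2 h1
    simp only [id]
    field_simp
    rw [Real.sq_sqrt h1.le]
    ring
  · have h := ((hasDerivAt_id s).const_mul √(-c)).cosh
    refine h.congr_deriv ?_
    have := Real.sqrt_pos.2 (neg_pos.2 h2)
    simp only [id]
    field_simp
    rw [Real.sq_sqrt (neg_pos.2 h2).le]
    ring
  · have : c = 0 := le_antisymm (not_lt.1 h1) (not_lt.1 h2)
    simpa [this] using hasDerivAt_const s (1 : ℝ)

theorem hasDerivAt_sinC : HasDerivAt (sinC c) (cosC c s) s := by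
  unfold cosC sinC
  split_ifs with h1 h2
  · have h := (((hasDerivAt_id s).const_mul √c).sin).div_const √c
    refine h.congr_deriv ?_
    have := Real.sqrt_pos.2 h1
    simp only [id]
    field_simp
  · have h := (((hasDerivAt_id s).const_mul √(-c)).sinh).div_const √(-c)
    refine h.congr_deriv ?_
    have := Real.sqrt_pos.2 (neg_pos.2 h2)
    simp only [id]
    field_simp
  · exact hasDerivAt_id s

@[simp] theorem cosC_zero : cosC c 0 = 1 := by simp [cosC]

@[simp] theorem sinC_zero : sinC c 0 = 0 := by simp [sinC]

theorem cosC_sq_add : cosC c s ^ 2 + c * sinC c s ^ 2 = 1 := by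
  unfold cosC sinC
  split_ifs with h1 h2
  · have := Real.sqrt_pos.2 h1
    rw [div_pow, Real.sq_sqrt h1.le, mul_div_cancel₀ _ h1.ne', Real.cos_sq_add_sin_sq]
  · rw [div_pow, Real.sq_sqrt (neg_pos.2 h2).le]
    have : c * (Real.sinh (√(-c) * s) ^ 2 / -c) = -Real.sinh (√(-c) * s) ^ 2 := by
      have := h2.ne
      field_simp
    rw [this]
    linarith [Real.cosh_sq (√(-c) * s)]
  · have : c = 0 := le_antisymm (not_lt.1 h1) (not_lt.1 h2)
    simp [this]

theorem cosC_add : cosC c (s + t) = cosC c s * cosC c t - c * (sinC c s * sinC c t) := by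
  unfold cosC sinC
  split_ifs with h1 h2
  · have h := Real.sqrt_pos.2 h1
    rw [mul_add, Real.cos_add, div_mul_div_comm, Real.mul_self_sqrt h1.le,
      mul_div_cancel₀ _ h1.ne']
  · have h := Real.sqrt_pos.2 (neg_pos.2 h2)
    rw [mul_add, Real.cosh_add, div_mul_div_comm, Real.mul_self_sqrt (neg_pos.2 h2).le]
    have := h2.ne
    field_simp
    ring
  · have : c = 0 := le_antisymm (not_lt.1 h1) (not_lt.1 h2)
    simp [this]

theorem sinC_add : sinC c (s + t) = sinC c s * cosC c t + cosC c s * sinC c t := by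
  unfold cosC sinC
  split_ifs with h1 h2
  · rw [mul_add, Real.sin_add]
    ring
  · rw [mul_add, Real.sinh_add]
    ring
  · ring

theorem contDiff_cosC : ContDiff ℝ ∞ (cosC c) := by
  unfold cosC
  split_ifs
  · exact Real.contDiff_cos.comp (contDiff_const.mul contDiff_id)
  · exact Real.contDiff_cosh.comp (contDiff_const.mul contDiff_id)
  · exact contDiff_const

theorem contDiff_sinC : ContDiff ℝ ∞ (sinC c) := by
  unfold sinC
  split_ifs
  · exact (Real.contDiff_sin.comp (contDiff_const.mul contDiff_id)).div_const _
  · exact (Real.contDiff_sinh.comp (contDiff_const.mul contDiff_id)).div_const _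
  · exact contDiff_id

end Trig

/-! ### Rotations in the plane spanned by a point and a unit normal -/

section Rotation

variable {c : ℝ} {m : ℕ} {p v : Ambient c m}

/-- The quadric equation is `cosC_sq_add`. For `c < 0` the upper sheet is not left because `|sinh| <
cosh` and the time coordinate of a unit tangent vector is at most `√(-c)` times that of the point.
-/
theorem rotate_mem_spaceForm (hp : p ∈ spaceForm c m) (hv : v ∈ spaceFormTangent c p)
    (hv1 : flatForm c v v = 1) (s : ℝ) : cosC c s • p + sinC c s • v ∈ spaceForm c m := by
  refine ⟨fun hc => ?_, fun i hc hi => ?_⟩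
  · simp only [flatForm_add_left, flatForm_add_right, flatForm_smul_left, flatForm_smul_right,
      flatForm_comm c v p, hv hc, hv1, hp.1 hc]
    have := cosC_sq_add c s
    field_simp
    linear_combination this
  · have hi' : i = timeIndex hc m := Fin.ext hi
    subst hi'
    have h := time_sq_le hc hp hv
    rw [hv1, mul_one] at h
    set x := p (timeIndex hc m)
    set y := v (timeIndex hc m)
    have hx : 0 < x := hp.2 _ hc rfl
    have hr := Real.sqrt_pos.2 (neg_pos.2 hc)
    have hy : |y| ≤ √(-c) * x := by
      refine abs_le_of_sq_le_sq ?_ (by positivity)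
      rw [mul_pow, Real.sq_sqrt (neg_pos.2 hc).le]
      exact h
    change 0 < cosC c s * x + sinC c s * y
    rw [cosC, sinC, if_neg (not_lt.2 hc.le), if_pos hc, if_neg (not_lt.2 hc.le), if_pos hc]
    set u := √(-c) * s
    have h1 : |Real.sinh u| < Real.cosh u := by
      rw [Real.abs_sinh, ← Real.cosh_abs]
      exact Real.sinh_lt_cosh _
    have h2 : |Real.sinh u / √(-c) * y| ≤ |Real.sinh u| * x := by
      rw [abs_mul, abs_div, abs_of_pos hr, div_mul_eq_mul_div, div_le_iff₀ hr]
      nlinarith [abs_nonneg (Real.sinh u)]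
    have h3 : |Real.sinh u| * x < Real.cosh u * x := mul_lt_mul_of_pos_right h1 hx
    linarith [neg_abs_le (Real.sinh u / √(-c) * y)]

theorem rotate_mem_tangent (hp : p ∈ spaceForm c m) (hv : v ∈ spaceFormTangent c p)
    (hv1 : flatForm c v v = 1) (s : ℝ) :
    (-(c * sinC c s)) • p + cosC c s • v ∈
      spaceFormTangent c (cosC c s • p + sinC c s • v) := by
  intro hc
  simp only [flatForm_add_left, flatForm_add_right, flatForm_smul_left, flatForm_smul_right,
    flatForm_comm c v p, hv hc, hv1, hp.1 hc]
  field_simp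
  ring

theorem rotate_unit (hp : p ∈ spaceForm c m) (hv : v ∈ spaceFormTangent c p)
    (hv1 : flatForm c v v = 1) (s : ℝ) :
    flatForm c ((-(c * sinC c s)) • p + cosC c s • v) ((-(c * sinC c s)) • p + cosC c s • v)
      = 1 := by
  -- The factor `c` makes these relations valid for `c = 0` too, where the point itself satisfies no
  -- equation.
  have h1 : c * flatForm c p v = 0 := by
    by_cases hc : c = 0
    · simp [hc]
    · simp [hv hc]
  have h2 : c * (c * flatForm c p p) = c := by
    by_cases hc : c = 0
    · simp [hc]
    · rw [hp.1 hc]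
      field_simp
  simp only [flatForm_add_left, flatForm_add_right, flatForm_smul_left, flatForm_smul_right,
    flatForm_comm c v p, hv1]
  linear_combination sinC c s ^ 2 * h2 - 2 * sinC c s * cosC c s * h1 + cosC_sq_add c s

end Rotation


/-! ### Linear algebra of hypersurfaces -/

section LinearAlgebra

variable {E V : Type*} [AddCommGroup E] [Module ℝ E] [AddCommGroup V] [Module ℝ V]

/-- If the form induced on `E` by `L` is positive definite, `K` has a tangential part. -/
theorem exists_shape [FiniteDimensional ℝ E] (β : V →ₗ[ℝ] V →ₗ[ℝ] ℝ) (L K : E →ₗ[ℝ] V)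
    (hpos : ∀ X, X ≠ 0 → 0 < β (L X) (L X)) :
    ∃ A : E →ₗ[ℝ] E, ∀ X Y, β (L (A X)) (L Y) = -β (K X) (L Y) := by
  let G : E →ₗ[ℝ] Module.Dual ℝ E := β.compl₁₂ L L
  have hG : Function.Injective G := by
    refine (injective_iff_map_eq_zero G).2 fun X hX => ?_
    by_contra h
    exact (hpos X h).ne' (LinearMap.congr_fun hX X)
  let e := LinearEquiv.ofInjectiveOfFinrankEq G hG Subspace.dual_finrank_eq.symm
  refine ⟨-(e.symm : Module.Dual ℝ E →ₗ[ℝ] E) ∘ₗ β.compl₁₂ K L, fun X Y => ?_⟩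
  have h : G (e.symm (β.compl₁₂ K L X)) = β.compl₁₂ K L X := e.apply_symm_apply _
  have h' := LinearMap.congr_fun h Y
  simp only [G, LinearMap.compl₁₂_apply] at h'
  simp only [LinearMap.comp_apply, LinearMap.neg_apply, map_neg, LinearEquiv.coe_coe, h']

theorem shape_unique (β : V →ₗ[ℝ] V →ₗ[ℝ] ℝ) (L K : E →ₗ[ℝ] V)
    (hpos : ∀ X, X ≠ 0 → 0 < β (L X) (L X)) {A A' : E →ₗ[ℝ] E}
    (hA : ∀ X Y, β (L (A X)) (L Y) = -β (K X) (L Y))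
    (hA' : ∀ X Y, β (L (A' X)) (L Y) = -β (K X) (L Y)) : A = A' := by
  ext X
  by_contra h
  refine (hpos (A X - A' X) (sub_ne_zero.2 h)).ne' ?_
  have e : β (L (A X - A' X)) = β (L (A X)) - β (L (A' X)) := by simp
  rw [e, LinearMap.sub_apply, hA, hA', sub_self]

/-- A subspace `T` is spanned by a hyperplane and its unit normal. -/
theorem exists_tangent_add_normal [FiniteDimensional ℝ E] (β : V →ₗ[ℝ] V →ₗ[ℝ] ℝ)
    (T : Submodule ℝ V) (L : E →ₗ[ℝ] V) (hL : Function.Injective L) (hLT : ∀ X, L X ∈ T)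
    (hdim : Module.finrank ℝ T = Module.finrank ℝ E + 1) {N : V} (hN : N ∈ T)
    (hN1 : β N N = 1) (hNL : ∀ X, β N (L X) = 0) {w : V} (hw : w ∈ T) :
    ∃ X, w = L X + β N w • N := by
  let G : E × ℝ →ₗ[ℝ] T := LinearMap.coprod (L.codRestrict T hLT)
    (LinearMap.toSpanSingleton ℝ T ⟨N, hN⟩)
  have hGv : ∀ y, (G y : V) = L y.1 + y.2 • N := fun y => by simp [G]
  have hG : Function.Injective G := by
    refine (injective_iff_map_eq_zero G).2 fun y hy => ?_
    have h1 : L y.1 + y.2 • N = 0 := by rw [← hGv, hy]; rfl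
    have h2 : y.2 = 0 := by
      have := congrArg (β N) h1
      simpa [hNL, hN1] using this
    have h3 : y.1 = 0 := by
      rw [h2, zero_smul, add_zero] at h1
      exact hL (h1.trans (map_zero L).symm)
    exact Prod.ext h3 h2
  have : FiniteDimensional ℝ T := Module.finite_of_finrank_pos (by omega)
  have hs : Function.Surjective G :=
    (LinearMap.injective_iff_surjective_of_finrank_eq_finrank (by
      rw [Module.finrank_prod, Module.finrank_self, hdim])).1 hG
  obtain ⟨y, hy⟩ := hs ⟨w, hw⟩
  have hw' : w = L y.1 + y.2 • N := by rw [← hGv, hy]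
  have : β N w = y.2 := by simp [hw', hNL, hN1]
  exact ⟨y.1, by rw [this]; exact hw'⟩

end LinearAlgebra

/-! ### Determinants of the parallel family -/

section ParallelDet

variable {E : Type*} [AddCommGroup E] [Module ℝ E]

/-- The determinant of `C_c(s) - S_c(s) A`. -/
noncomputable def parallelDet (c : ℝ) (A : E →ₗ[ℝ] E) (s : ℝ) : ℝ :=
  LinearMap.det (cosC c s • (1 : E →ₗ[ℝ] E) - sinC c s • A)

theorem parallelDet_zero (c : ℝ) (A : E →ₗ[ℝ] E) : parallelDet c A 0 = 1 := by
  simp [parallelDet]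

/-- By the addition formulas the operator at time `s + t` is the product of the one at time `s` and
`C_c(t) - S_c(t) T`. The hypothesis on `T` is the relation satisfied by the shape operator of `h_s`.
-/
theorem parallelDet_add (c : ℝ) {A T : E →ₗ[ℝ] E} {s : ℝ}
    (hT : (cosC c s • (1 : E →ₗ[ℝ] E) - sinC c s • A) * T
      = (c * sinC c s) • (1 : E →ₗ[ℝ] E) + cosC c s • A) (t : ℝ) :
    parallelDet c A (s + t) = parallelDet c A s * parallelDet c T t := by
  rw [parallelDet, parallelDet, parallelDet, ← map_mul]
  congr 1
  rw [mul_sub, mul_smul_comm, mul_smul_comm, hT, mul_one, cosC_add, sinC_add]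
  module

variable [FiniteDimensional ℝ E]

theorem LinearMap.det_one_add_smul_expand (M : E →ₗ[ℝ] E) : ∃ P : Polynomial ℝ, ∀ r : ℝ,
    LinearMap.det (1 + r • M) = 1 + LinearMap.trace ℝ E M * r + P.eval r * r ^ 2 := by
  let b := Module.finBasis ℝ E
  refine ⟨((1 + (Polynomial.X : Polynomial ℝ) • (LinearMap.toMatrix b b M).map Polynomial.C).det
    ).divX.divX, fun r => ?_⟩
  rw [← LinearMap.det_toMatrix b, map_add, map_smul, LinearMap.toMatrix_one,
    Matrix.det_one_add_smul, LinearMap.trace_eq_matrix_trace ℝ b]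

/-- Near `0` the determinant is `C ^ n * det (1 + r A)` with `r = -S / C`; here `C` has value `1`
and derivative `0`, while `r` has value `0` and derivative `-1`, so only the trace term contributes.
-/
theorem hasDerivAt_parallelDet_zero (c : ℝ) (A : E →ₗ[ℝ] E) :
    HasDerivAt (parallelDet c A) (-LinearMap.trace ℝ E A) 0 := by
  obtain ⟨P, hP⟩ := LinearMap.det_one_add_smul_expand A
  set n := Module.finrank ℝ E
  set τ := LinearMap.trace ℝ E A
  have hC : ∀ᶠ s in nhds (0 : ℝ), cosC c s ≠ 0 :=
    (contDiff_cosC c).continuous.continuousAt.eventually_ne (by simp)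
  let r : ℝ → ℝ := fun s => -(sinC c s / cosC c s)
  have hr : HasDerivAt r (-1) 0 := by
    have := ((hasDerivAt_sinC c 0).div (hasDerivAt_cosC c 0) (by simp)).neg
    refine this.congr_deriv (by simp)
  have hr0 : r 0 = 0 := by simp [r]
  have heq : parallelDet c A =ᶠ[nhds 0] fun s =>
      cosC c s ^ n * (1 + τ * r s + P.eval (r s) * r s ^ 2) := by
    filter_upwards [hC] with s hs
    rw [← hP, parallelDet, ← LinearMap.det_smul]
    congr 1
    ext X
    simp only [r, LinearMap.smul_apply, LinearMap.add_apply, smul_add,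
      smul_smul, sub_eq_add_neg, ← neg_smul]
    congr 2
    field_simp
  have h1 : HasDerivAt (fun s => 1 + τ * r s + P.eval (r s) * r s ^ 2) (-τ) 0 := by
    have hp : HasDerivAt (fun s => P.eval (r s)) _ 0 := (P.hasDerivAt (r 0)).comp 0 hr
    have h := ((hr.const_mul τ).const_add 1).add (hp.mul (hr.pow 2))
    refine h.congr_deriv ?_
    simp [hr0]
  have h2 := (((hasDerivAt_cosC c 0).pow n).mul h1).congr_of_eventuallyEq heq
  refine h2.congr_deriv ?_
  simp

/-- Multiplicativity reduces the derivative at `s` to the derivative at `0` for `T`, so no inverse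
of `C - S A` has to be differentiated. -/
theorem hasDerivAt_parallelDet (c : ℝ) {A T : E →ₗ[ℝ] E} {s : ℝ}
    (hT : (cosC c s • (1 : E →ₗ[ℝ] E) - sinC c s • A) * T
      = (c * sinC c s) • (1 : E →ₗ[ℝ] E) + cosC c s • A) :
    HasDerivAt (parallelDet c A) (-(parallelDet c A s * LinearMap.trace ℝ E T)) s := by
  have h := (hasDerivAt_parallelDet_zero c T).const_mul (parallelDet c A s)
  have h' : HasDerivAt (fun t => parallelDet c A (s + t))
      (parallelDet c A s * -LinearMap.trace ℝ E T) 0 :=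
    h.congr_of_eventuallyEq (Filter.Eventually.of_forall fun t => parallelDet_add c hT t)
  have h2 : HasDerivAt (fun t => parallelDet c A (s + (t - s)))
      (parallelDet c A s * -LinearMap.trace ℝ E T) s := by
    have h3 : HasDerivAt (fun t => parallelDet c A (s + t))
      (parallelDet c A s * -LinearMap.trace ℝ E T) (s - s) := by rwa [sub_self]
    exact HasDerivAt.comp_sub_const (f := fun t => parallelDet c A (s + t)) s s h3
  simp only [add_sub_cancel] at h2
  exact h2.congr_deriv (by ring)

theorem det_smul_one_sub (A : E →ₗ[ℝ] E) (r : ℝ) :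
    LinearMap.det (r • (1 : E →ₗ[ℝ] E) - A) = A.charpoly.eval r := by
  rw [LinearMap.eval_charpoly]
  congr 1

theorem parallelDet_of_sinC_ne {c s : ℝ} (A : E →ₗ[ℝ] E) (hs : sinC c s ≠ 0) :
    parallelDet c A s = sinC c s ^ Module.finrank ℝ E * A.charpoly.eval (cosC c s / sinC c s) := by
  rw [← det_smul_one_sub, ← LinearMap.det_smul, parallelDet]
  congr 1
  rw [smul_sub, smul_smul, mul_div_cancel₀ _ hs]

/-- Where `S ≠ 0` the determinant is a value of the characteristic polynomial up to a power of `S`;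
where `S = 0` it does not involve the operator. -/
theorem parallelDet_congr {E' : Type*} [AddCommGroup E'] [Module ℝ E'] [FiniteDimensional ℝ E']
    (hE : Module.finrank ℝ E = Module.finrank ℝ E')
    {A : E →ₗ[ℝ] E} {A' : E' →ₗ[ℝ] E'} (h : A.charpoly = A'.charpoly) (c s : ℝ) :
    parallelDet c A s = parallelDet c A' s := by
  by_cases hs : sinC c s = 0
  · simp [parallelDet, hs, hE]
  · rw [parallelDet_of_sinC_ne A hs, parallelDet_of_sinC_ne A' hs, h, hE]

/-- The quotient `C / S` is injective on a short interval to the right of `0`, so the two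
characteristic polynomials agree at infinitely many points. -/
theorem charpoly_eq_of_parallelDet_eq {E' : Type*} [AddCommGroup E'] [Module ℝ E']
    [FiniteDimensional ℝ E'] (hE : Module.finrank ℝ E = Module.finrank ℝ E')
    {A : E →ₗ[ℝ] E} {A' : E' →ₗ[ℝ] E'} {c ε : ℝ} (hε : 0 < ε)
    (h : ∀ s ∈ Set.Ioo (-ε) ε, parallelDet c A s = parallelDet c A' s) :
    A.charpoly = A'.charpoly := by
  have hne : ∀ᶠ s in nhdsWithin (0 : ℝ) {0}ᶜ, sinC c s ≠ 0 := by
    have := (hasDerivAt_sinC c 0).eventually_ne (c := 0) (by simp)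
    simpa using this
  obtain ⟨r, hr, hr'⟩ := Metric.mem_nhdsWithin_iff.1 hne
  have hne' : ∀ s : ℝ, |s| < r → s ≠ 0 → sinC c s ≠ 0 := fun s h1 h2 =>
    hr' ⟨by simpa using h1, h2⟩
  set ρ := min r ε
  have hρ : 0 < ρ := lt_min hr hε
  refine Polynomial.eq_of_infinite_eval_eq _ _
    (Set.Infinite.mono (s := (fun s => cosC c s / sinC c s) '' Set.Ioo 0 ρ) ?_
      ((Set.Ioo_infinite hρ).image ?_))
  · rintro _ ⟨s, hs, rfl⟩
    have hsr : s < r := hs.2.trans_le (min_le_left _ _)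
    have hsε : s < ε := hs.2.trans_le (min_le_right _ _)
    have h0 := hne' s (by rw [abs_of_pos hs.1]; exact hsr) hs.1.ne'
    have h1 := h s ⟨by linarith [hs.1], hsε⟩
    rw [parallelDet_of_sinC_ne A h0, parallelDet_of_sinC_ne A' h0, hE] at h1
    exact mul_left_cancel₀ (pow_ne_zero _ h0) h1
  · intro s hs t ht hst
    have hsr : s < r := hs.2.trans_le (min_le_left _ _)
    have htr : t < r := ht.2.trans_le (min_le_left _ _)
    have hs0 := hne' s (by rw [abs_of_pos hs.1]; exact hsr) hs.1.ne'
    have ht0 := hne' t (by rw [abs_of_pos ht.1]; exact htr) ht.1.ne'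
    simp only at hst
    rw [div_eq_div_iff hs0 ht0] at hst
    by_contra hne
    -- Equal quotients `C / S` at `s` and `t` make `S_c(s - t)` vanish, which is impossible for
    -- small `s - t ≠ 0`.
    refine hne' (s - t) (abs_sub_lt_iff.2 ⟨by linarith [ht.1], by linarith [hs.1]⟩)
      (sub_ne_zero.2 hne) ?_
    have e1 := sinC_add c (s - t) t
    have e2 := cosC_add c (s - t) t
    rw [sub_add_cancel] at e1 e2
    have e3 := cosC_sq_add c t
    rw [e1, e2] at hst
    linear_combination (-1 : ℝ) * hst - sinC c (s - t) * e3

end ParallelDet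


/-! ### Differentials of vector valued maps on a manifold -/

section Diff

variable {E : Type*} [NormedAddCommGroup E] [NormedSpace ℝ E]
  {H : Type*} [TopologicalSpace H] {J : ModelWithCorners ℝ E H}
  {M : Type*} [TopologicalSpace M] [ChartedSpace H M]
  {V V' W : Type*} [NormedAddCommGroup V] [NormedSpace ℝ V]
  [NormedAddCommGroup V'] [NormedSpace ℝ V'] [NormedAddCommGroup W] [NormedSpace ℝ W]

/-- The vector valued map `f` has differential `f'` at `x`. -/
abbrev HasDiff (J : ModelWithCorners ℝ E H) (f : M → V) (x : M)
    (f' : TangentSpace J x →L[ℝ] V) : Prop :=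
  HasMFDerivAt J 𝓘(ℝ, V) f x f'

theorem HasDiff.diffMap_eq {f : M → V} {x : M} {f' : TangentSpace J x →L[ℝ] V}
    (h : HasDiff J f x f') :
    diffMap J f x = f' :=
  HasMFDerivAt.mfderiv h

theorem HasDiff.diffMap_apply {f : M → V} {x : M} {f' : TangentSpace J x →L[ℝ] V}
    (h : HasDiff J f x f')
    (X : TangentSpace J x) : diffMap J f x X = f' X :=
  DFunLike.congr_fun h.diffMap_eq X

theorem MDifferentiableAt.hasDiff {f : M → V} {x : M} (h : MDifferentiableAt J 𝓘(ℝ, V) f x) :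
    HasDiff J f x (diffMap J f x) :=
  h.hasMFDerivAt

theorem HasDiff.congr {f g : M → V} {x : M} {f' : TangentSpace J x →L[ℝ] V} (h : HasDiff J f x f')
    (hfg : g =ᶠ[nhds x] f) : HasDiff J g x f' :=
  HasMFDerivAt.congr_of_eventuallyEq h hfg

theorem HasDiff.unique {f : M → V} {x : M} {f' f'' : TangentSpace J x →L[ℝ] V}
    (h : HasDiff J f x f')
    (h' : HasDiff J f x f'') : f' = f'' :=
  hasMFDerivAt_unique h h'

theorem HasFDerivAt.comp_hasDiff {f : M → V} {x : M} {f' : TangentSpace J x →L[ℝ] V} {G : V → W}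
    {G' : V →L[ℝ] W} (hG : HasFDerivAt G G' (f x)) (h : HasDiff J f x f') :
    HasDiff J (fun y => G (f y)) x (G'.comp f') :=
  HasMFDerivAt.comp x (hasMFDerivAt_iff_hasFDerivAt.2 hG) h

theorem HasDiff.prodMk {f : M → V} {g : M → V'} {x : M} {f' : TangentSpace J x →L[ℝ] V}
    {g' : TangentSpace J x →L[ℝ] V'}
    (hf : HasDiff J f x f') (hg : HasDiff J g x g') :
    HasDiff J (fun y => (f y, g y)) x (f'.prod g') :=
  ⟨hf.1.prodMk hg.1, HasFDerivWithinAt.prodMk hf.2 hg.2⟩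

theorem hasDiff_const (v : V) (x : M) : HasDiff J (fun _ : M => v) x 0 :=
  hasMFDerivAt_const v x

theorem HasDiff.clm (L : V →L[ℝ] W) {f : M → V} {x : M} {f' : TangentSpace J x →L[ℝ] V}
    (hf : HasDiff J f x f') : HasDiff J (fun y => L (f y)) x (L.comp f') :=
  L.hasFDerivAt.comp_hasDiff hf

theorem HasDiff.fst {f : M → V × V'} {x : M} {f' : TangentSpace J x →L[ℝ] V × V'}
    (hf : HasDiff J f x f') :
    HasDiff J (fun y => (f y).1) x ((ContinuousLinearMap.fst ℝ V V').comp f') :=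
  hf.clm (ContinuousLinearMap.fst ℝ V V')

theorem HasDiff.snd {f : M → V × V'} {x : M} {f' : TangentSpace J x →L[ℝ] V × V'}
    (hf : HasDiff J f x f') :
    HasDiff J (fun y => (f y).2) x ((ContinuousLinearMap.snd ℝ V V').comp f') :=
  hf.clm (ContinuousLinearMap.snd ℝ V V')

theorem HasDiff.bilin (β : V →L[ℝ] V' →L[ℝ] W) {f : M → V} {g : M → V'} {x : M}
    {f' : TangentSpace J x →L[ℝ] V} {g' : TangentSpace J x →L[ℝ] V'} (hf : HasDiff J f x f')
    (hg : HasDiff J g x g') :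
    HasDiff J (fun y => β (f y) (g y)) x ((β (f x)).comp g' + (β.flip (g x)).comp f') := by
  have h := (β.isBoundedBilinearMap.hasFDerivAt (f x, g x)).comp_hasDiff
    (f := fun y => (f y, g y)) (hf.prodMk hg)
  exact h

theorem HasDiff.smul {u : M → ℝ} {f : M → V} {x : M} {u' : TangentSpace J x →L[ℝ] ℝ}
    {f' : TangentSpace J x →L[ℝ] V}
    (hu : HasDiff J u x u') (hf : HasDiff J f x f') :
    HasDiff J (fun y => u y • f y) x (u x • f' + u'.smulRight (f x)) := by
  have h := HasDiff.bilin (ContinuousLinearMap.lsmul ℝ ℝ) hu hf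
  exact h

theorem HasDiff.add {f g : M → V} {x : M} {f' g' : TangentSpace J x →L[ℝ] V} (hf : HasDiff J f x f')
    (hg : HasDiff J g x g') : HasDiff J (fun y => f y + g y) x (f' + g') :=
  HasMFDerivAt.add hf hg

theorem HasDiff.comp_mfderiv {E' : Type*} [NormedAddCommGroup E'] [NormedSpace ℝ E']
    {H' : Type*} [TopologicalSpace H'] {J' : ModelWithCorners ℝ E' H'}
    {P : Type*} [TopologicalSpace P] [ChartedSpace H' P] {Φ : P → M} {y : P}
    {Φ' : TangentSpace J' y →L[ℝ] TangentSpace J (Φ y)}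
    {f : M → V} {f' : TangentSpace J (Φ y) →L[ℝ] V} (hf : HasDiff J f (Φ y) f')
    (hΦ : HasMFDerivAt J' J Φ y Φ') :
    HasDiff J' (fun z => f (Φ z)) y (f'.comp Φ') :=
  HasMFDerivAt.comp y hf hΦ

/-- Product rule for a locally constant scalar product; the orthogonality relations among a map, its
normal and their differentials come from it. -/
theorem HasDiff.bilin_eq_zero (β : V →L[ℝ] V →L[ℝ] ℝ) {f g : M → V} {x : M}
    {f' g' : TangentSpace J x →L[ℝ] V} (hf : HasDiff J f x f') (hg : HasDiff J g x g') {r : ℝ}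
    (h : ∀ᶠ y in nhds x, β (f y) (g y) = r) (X : TangentSpace J x) :
    β (f x) (g' X) + β (f' X) (g x) = 0 := by
  have h1 := (HasDiff.bilin β hf hg).unique ((hasDiff_const r x).congr h)
  exact DFunLike.congr_fun h1 X

end Diff

/-! ### The product form -/

section ProdForm

variable (c₁ c₂ : ℝ) (m₁ m₂ : ℕ)

/-- The scalar product of the product of the two flat spaces as a continuous bilinear map. -/
noncomputable def prodFormL : Ambient c₁ m₁ × Ambient c₂ m₂ →L[ℝ]
    Ambient c₁ m₁ × Ambient c₂ m₂ →L[ℝ] ℝ :=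
  (flatFormL c₁ m₁).bilinearComp (ContinuousLinearMap.fst ℝ _ _) (ContinuousLinearMap.fst ℝ _ _) +
  (flatFormL c₂ m₂).bilinearComp (ContinuousLinearMap.snd ℝ _ _) (ContinuousLinearMap.snd ℝ _ _)

variable {m₁ m₂}

theorem prodFormL_apply (p q : Ambient c₁ m₁ × Ambient c₂ m₂) :
    prodFormL c₁ c₂ m₁ m₂ p q = prodForm c₁ c₂ p q := rfl

theorem prodForm_pos {p v : Ambient c₁ m₁ × Ambient c₂ m₂}
    (hp : p ∈ spaceForm c₁ m₁ ×ˢ spaceForm c₂ m₂) (hv : v ∈ prodTangent c₁ c₂ p) (hv0 : v ≠ 0) :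
    0 < prodForm c₁ c₂ v v := by
  by_cases h1 : v.1 = 0
  · have h2 : v.2 ≠ 0 := fun h2 => hv0 (Prod.ext h1 h2)
    simpa [prodForm, h1] using flatForm_pos c₂ hp.2 hv.2 h2
  · have h := flatForm_pos c₁ hp.1 hv.1 h1
    by_cases h2 : v.2 = 0
    · simpa [prodForm, h2] using h
    · exact add_pos h (flatForm_pos c₂ hp.2 hv.2 h2)

theorem prodForm_comm (p q : Ambient c₁ m₁ × Ambient c₂ m₂) :
    prodForm c₁ c₂ p q = prodForm c₁ c₂ q p := by
  rw [prodForm, prodForm, flatForm_comm, flatForm_comm c₂]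

end ProdForm

/-! ### Shape operators -/

section Shape

variable {E : Type*} [NormedAddCommGroup E] [NormedSpace ℝ E]
  {H : Type*} [TopologicalSpace H] {J : ModelWithCorners ℝ E H}
  {M : Type*} [TopologicalSpace M] [ChartedSpace H M]
  {V : Type*} [NormedAddCommGroup V] [NormedSpace ℝ V]

theorem isShapeOperator_shapeOperator [FiniteDimensional ℝ E] (β : V →L[ℝ] V →L[ℝ] ℝ)
    {B : V → V → ℝ}
    (hB : ∀ v w, B v w = β v w) {f N : M → V} {x : M}
    (hpos : ∀ X : TangentSpace J x, X ≠ 0 → 0 < B (diffMap J f x X) (diffMap J f x X)) :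
    IsShapeOperator J B f N x (shapeOperator J B f N x) := by
  have h : ∃ A, IsShapeOperator J B f N x A := by
    obtain ⟨A, hA⟩ := exists_shape (β.toLinearMap₁₂) (diffMap J f x).toLinearMap
      (diffMap J N x).toLinearMap (fun X hX => by
        have := hpos X hX
        rwa [hB] at this)
    refine ⟨A, fun X Y => ?_⟩
    rw [hB, hB]
    exact hA X Y
  rw [shapeOperator, dif_pos h]
  exact h.choose_spec

theorem IsShapeOperator.eq (β : V →L[ℝ] V →L[ℝ] ℝ) {B : V → V → ℝ}
    (hB : ∀ v w, B v w = β v w) {f N : M → V} {x : M}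
    (hpos : ∀ X : TangentSpace J x, X ≠ 0 → 0 < B (diffMap J f x X) (diffMap J f x X))
    {A : TangentSpace J x →ₗ[ℝ] TangentSpace J x} (hA : IsShapeOperator J B f N x A) :
    shapeOperator J B f N x = A := by
  have h : ∃ A, IsShapeOperator J B f N x A := ⟨A, hA⟩
  rw [shapeOperator, dif_pos h]
  refine shape_unique (β.toLinearMap₁₂) (diffMap J f x).toLinearMap
      (diffMap J N x).toLinearMap (fun X hX => by
        have := hpos X hX
        rwa [hB] at this) (fun X Y => ?_) (fun X Y => ?_)
  · have := h.choose_spec X Y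
    rwa [hB, hB] at this
  · have := hA X Y
    rwa [hB, hB] at this

end Shape

/-! ### Weingarten formula, parallel families and isoparametric hypersurfaces of a space form. -/

section SpaceFormHypersurface

variable {E : Type*} [NormedAddCommGroup E] [NormedSpace ℝ E]
  {H : Type*} [TopologicalSpace H] {J : ModelWithCorners ℝ E H}
  {M : Type*} [TopologicalSpace M] [ChartedSpace H M]
  {c : ℝ} {m : ℕ} {h N : M → Ambient c m}

theorem HasDiff.mem_spaceFormTangent {x : M} {h' : TangentSpace J x →L[ℝ] Ambient c m}
    (hh : HasDiff J h x h')
    (hmem : ∀ᶠ y in nhds x, h y ∈ spaceForm c m)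
    (X : TangentSpace J x) : h' X ∈ spaceFormTangent c (h x) := by
  intro hc
  have := HasDiff.bilin_eq_zero (flatFormL c m) hh hh (r := 1 / c)
    (hmem.mono fun y hy => hy.1 hc) X
  simp only [flatFormL_apply, flatForm_comm c (h' X)] at this
  linarith

theorem IsImmersionInto.hasDiff {V : Type*} [NormedAddCommGroup V] [NormedSpace ℝ V] {S : Set V}
    {f : M → V} (hf : IsImmersionInto J S f) (x : M) : HasDiff J f x (diffMap J f x) :=
  (hf.smooth.mdifferentiableAt (by simp)).hasDiff

theorem IsUnitNormalOn.hasDiff {V : Type*} [NormedAddCommGroup V] [NormedSpace ℝ V]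
    {B : V → V → ℝ} {T : V → Set V} {f N : M → V} {U : Set M}
    (hN : IsUnitNormalOn J B T f N U) {x : M} (hU : U ∈ nhds x) :
    HasDiff J N x (diffMap J N x) :=
  ((hN.smooth.contMDiffAt hU).mdifferentiableAt (by simp)).hasDiff

theorem IsImmersionInto.diffMap_mem (hh : IsImmersionInto J (spaceForm c m) h) (x : M)
    (X : TangentSpace J x) : diffMap J h x X ∈ spaceFormTangent c (h x) :=
  (hh.hasDiff x).mem_spaceFormTangent (Filter.Eventually.of_forall hh.mem) X

theorem IsImmersionInto.flatForm_pos (hh : IsImmersionInto J (spaceForm c m) h) (x : M)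
    (X : TangentSpace J x) (hX : X ≠ 0) :
    0 < flatForm c (diffMap J h x X) (diffMap J h x X) :=
  _root_.flatForm_pos c (hh.mem x) (hh.diffMap_mem x X)
    fun h0 => hX (hh.injective_diff x (h0.trans (map_zero _).symm))

/-- The Weingarten formula: the differential of the unit normal field of a hypersurface of a
space form is tangent. -/
theorem diffMap_normal [FiniteDimensional ℝ E] (hdim : Module.finrank ℝ E + 1 = m)
    (hh : IsImmersionInto J (spaceForm c m) h)
    (hN : IsUnitNormalOn J (flatForm c) (spaceFormTangent c) h N Set.univ) (x : M)
    (X : TangentSpace J x) :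
    diffMap J N x X = -diffMap J h x (shapeOperator J (flatForm c) h N x X) := by
  have hNd := hN.hasDiff (x := x) Filter.univ_mem
  have h1 : diffMap J N x X ∈ tangentSub c (h x) := by
    intro hc
    have := HasDiff.bilin_eq_zero (flatFormL c m) (hh.hasDiff x) hNd (r := 0)
      (Filter.Eventually.of_forall fun y => hN.tangent y trivial hc) X
    simp only [flatFormL_apply] at this
    rw [flatForm_comm c _ (N x)] at this
    have h0 := hN.normal x trivial X
    linarith
  have h2 : flatForm c (N x) (diffMap J N x X) = 0 := by
    have := HasDiff.bilin_eq_zero (flatFormL c m) hNd hNd (r := 1)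
      (Filter.Eventually.of_forall fun y => hN.unit y trivial) X
    simp only [flatFormL_apply] at this
    rw [flatForm_comm c _ (N x)] at this
    linarith
  -- The tangent space of the space form is the image of `dh` plus the line of `N`, and the
  -- `N`-component of `dN X` vanishes because `N` has constant length.
  obtain ⟨Y, hY⟩ := exists_tangent_add_normal (E := TangentSpace J x) (flatFormL c m).toLinearMap₁₂
    (tangentSub c (h x))
    (diffMap J h x).toLinearMap (hh.injective_diff x) (hh.diffMap_mem x)
    ((finrank_tangentSub c (hh.mem x)).trans hdim.symm) (hN.tangent x trivial) (hN.unit x trivial)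
    (hN.normal x trivial) h1
  have hY' : diffMap J N x X = diffMap J h x Y := by
    refine hY.trans ?_
    have : ((flatFormL c m).toLinearMap₁₂ (N x)) (diffMap J N x X) = 0 := h2
    rw [this, zero_smul, add_zero]
    rfl
  have hA := isShapeOperator_shapeOperator (J := J) (flatFormL c m) (B := flatForm c)
    (fun _ _ => rfl) (f := h) (N := N) (x := x) (hh.flatForm_pos x)
  set A := shapeOperator J (flatForm c) h N x
  have h3 : A X + Y = 0 := by
    by_contra h0
    refine (hh.flatForm_pos x _ h0).ne' ?_
    have := hA X (A X + Y)
    rw [hY'] at this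
    have e : diffMap J h x (A X + Y) = diffMap J h x (A X) + diffMap J h x Y := map_add _ _ _
    nth_rewrite 1 [e]
    rw [flatForm_add_left, this]
    ring
  rw [hY', ← map_neg, eq_neg_of_add_eq_zero_right h3]

theorem hasDiff_parallelMap {x : M} {h' N' : TangentSpace J x →L[ℝ] Ambient c m}
    (hh : HasDiff J h x h')
    (hN : HasDiff J N x N') (s : ℝ) :
    HasDiff J (parallelMap c h N s) x (cosC c s • h' + sinC c s • N') := by
  have := (hh.clm (cosC c s • ContinuousLinearMap.id ℝ _)).add
    (hN.clm (sinC c s • ContinuousLinearMap.id ℝ _))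
  exact this

theorem hasDiff_parallelNormal {x : M} {h' N' : TangentSpace J x →L[ℝ] Ambient c m}
    (hh : HasDiff J h x h')
    (hN : HasDiff J N x N') (s : ℝ) :
    HasDiff J (parallelNormal c h N s) x ((-(c * sinC c s)) • h' + cosC c s • N') := by
  have := (hh.clm ((-(c * sinC c s)) • ContinuousLinearMap.id ℝ _)).add
    (hN.clm (cosC c s • ContinuousLinearMap.id ℝ _))
  exact this

theorem contMDiff_parallelMap (hh : ContMDiff J 𝓘(ℝ, Ambient c m) ∞ h)
    (hN : ContMDiff J 𝓘(ℝ, Ambient c m) ∞ N) (s : ℝ) :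
    ContMDiff J 𝓘(ℝ, Ambient c m) ∞ (parallelMap c h N s) :=
  (contDiff_const_smul _).contMDiff.comp hh |>.add ((contDiff_const_smul _).contMDiff.comp hN)

theorem contMDiff_parallelNormal (hh : ContMDiff J 𝓘(ℝ, Ambient c m) ∞ h)
    (hN : ContMDiff J 𝓘(ℝ, Ambient c m) ∞ N) (s : ℝ) :
    ContMDiff J 𝓘(ℝ, Ambient c m) ∞ (parallelNormal c h N s) :=
  (contDiff_const_smul _).contMDiff.comp hh |>.add ((contDiff_const_smul _).contMDiff.comp hN)

theorem isImmersionInto_parallelMap (hh : IsImmersionInto J (spaceForm c m) h)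
    (hN : IsUnitNormalOn J (flatForm c) (spaceFormTangent c) h N Set.univ) {s : ℝ}
    (hs : ∀ x, Function.Injective (diffMap J (parallelMap c h N s) x)) :
    IsImmersionInto J (spaceForm c m) (parallelMap c h N s) where
  smooth := contMDiff_parallelMap hh.smooth (contMDiffOn_univ.1 hN.smooth) s
  mem x := rotate_mem_spaceForm (hh.mem x) (hN.tangent x trivial) (hN.unit x trivial) s
  injective_diff := hs

theorem isUnitNormalOn_parallelNormal (hh : IsImmersionInto J (spaceForm c m) h)
    (hN : IsUnitNormalOn J (flatForm c) (spaceFormTangent c) h N Set.univ) (s : ℝ) :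
    IsUnitNormalOn J (flatForm c) (spaceFormTangent c) (parallelMap c h N s)
      (parallelNormal c h N s) Set.univ where
  smooth := contMDiffOn_univ.2
    (contMDiff_parallelNormal hh.smooth (contMDiffOn_univ.1 hN.smooth) s)
  tangent x _ := rotate_mem_tangent (hh.mem x) (hN.tangent x trivial) (hN.unit x trivial) s
  unit x _ := rotate_unit (hh.mem x) (hN.tangent x trivial) (hN.unit x trivial) s
  normal x _ X := by
    have hhd := hh.hasDiff x
    have hNd := hN.hasDiff (x := x) Filter.univ_mem
    rw [(hasDiff_parallelMap hhd hNd s).diffMap_apply]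
    have h1 : c * flatForm c (h x) (diffMap J h x X) = 0 := by
      by_cases hc : c = 0
      · simp [hc]
      · rw [hh.diffMap_mem x X hc, mul_zero]
    have h2 : flatForm c (N x) (diffMap J h x X) = 0 := hN.normal x trivial X
    have h3 : flatForm c (N x) (diffMap J N x X) = 0 := by
      have := HasDiff.bilin_eq_zero (flatFormL c m) hNd hNd (r := 1)
        (Filter.Eventually.of_forall fun y => hN.unit y trivial) X
      simp only [flatFormL_apply] at this
      rw [flatForm_comm c _ (N x)] at this
      linarith
    have h4 : c * flatForm c (h x) (diffMap J N x X) = 0 := by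
      by_cases hc : c = 0
      · simp [hc]
      · have := HasDiff.bilin_eq_zero (flatFormL c m) hhd hNd (r := 0)
          (Filter.Eventually.of_forall fun y => hN.tangent y trivial hc) X
        simp only [flatFormL_apply] at this
        rw [flatForm_comm c _ (N x), h2] at this
        rw [add_zero] at this
        rw [this, mul_zero]
    change flatForm c ((-(c * sinC c s)) • h x + cosC c s • N x)
      (cosC c s • diffMap J h x X + sinC c s • diffMap J N x X) = 0
    simp only [flatForm_add_left, flatForm_add_right, flatForm_smul_left, flatForm_smul_right]
    linear_combination (-(sinC c s * cosC c s)) * h1 - sinC c s ^ 2 * h4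
      + cosC c s ^ 2 * h2 + cosC c s * sinC c s * h3

theorem diffMap_parallelMap [FiniteDimensional ℝ E] (hdim : Module.finrank ℝ E + 1 = m)
    (hh : IsImmersionInto J (spaceForm c m) h)
    (hN : IsUnitNormalOn J (flatForm c) (spaceFormTangent c) h N Set.univ) (s : ℝ) (x : M)
    (X : TangentSpace J x) : diffMap J (parallelMap c h N s) x X
      = diffMap J h x (cosC c s • X - sinC c s • shapeOperator J (flatForm c) h N x X) := by
  rw [(hasDiff_parallelMap (hh.hasDiff x) (hN.hasDiff (x := x) Filter.univ_mem) s).diffMap_apply]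
  change cosC c s • diffMap J h x X + sinC c s • diffMap J N x X = _
  rw [diffMap_normal hdim hh hN, map_sub, map_smul, map_smul]
  module

/-- The shape operators of a parallel family. -/
theorem parallel_shape [FiniteDimensional ℝ E] (hdim : Module.finrank ℝ E + 1 = m)
    (hh : IsImmersionInto J (spaceForm c m) h)
    (hN : IsUnitNormalOn J (flatForm c) (spaceFormTangent c) h N Set.univ) {s : ℝ}
    (hs : ∀ x, Function.Injective (diffMap J (parallelMap c h N s) x)) (x : M) :
    (cosC c s • (1 : TangentSpace J x →ₗ[ℝ] TangentSpace J x)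
        - sinC c s • shapeOperator J (flatForm c) h N x) *
      shapeOperator J (flatForm c) (parallelMap c h N s) (parallelNormal c h N s) x
      = (c * sinC c s) • (1 : TangentSpace J x →ₗ[ℝ] TangentSpace J x)
        + cosC c s • shapeOperator J (flatForm c) h N x := by
  have hhd := hh.hasDiff x
  have hNd := hN.hasDiff (x := x) Filter.univ_mem
  have hW := diffMap_normal hdim hh hN x
  have hWs := diffMap_normal hdim (isImmersionInto_parallelMap hh hN hs)
    (isUnitNormalOn_parallelNormal hh hN s) x
  set A := shapeOperator J (flatForm c) h N x
  set T := shapeOperator J (flatForm c) (parallelMap c h N s) (parallelNormal c h N s) x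
  have e1 := diffMap_parallelMap hdim hh hN s x
  have e2 : ∀ X : TangentSpace J x, diffMap J (parallelNormal c h N s) x X
      = -diffMap J h x ((c * sinC c s) • X + cosC c s • A X) := fun X => by
    rw [(hasDiff_parallelNormal hhd hNd s).diffMap_apply]
    change (-(c * sinC c s)) • diffMap J h x X + cosC c s • diffMap J N x X = _
    rw [hW, map_add, map_smul, map_smul]
    module
  -- After applying the injective `dh`, the claim is the Weingarten formula of `h_s` with `dh_s` and
  -- `dN_s` expressed through `dh` and `A`.
  refine LinearMap.ext fun X => hh.injective_diff x ?_
  have := hWs X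
  rw [e1, e2, neg_inj] at this
  exact this.symm

/-- Since `dh_s = dh ∘ (C - S A)`, a kernel vector of `C - S A` would be a kernel vector of `dh_s`.
-/
theorem parallelDet_ne_zero [FiniteDimensional ℝ E] (hdim : Module.finrank ℝ E + 1 = m)
    (hh : IsImmersionInto J (spaceForm c m) h)
    (hN : IsUnitNormalOn J (flatForm c) (spaceFormTangent c) h N Set.univ) {s : ℝ}
    (hs : ∀ x, Function.Injective (diffMap J (parallelMap c h N s) x)) (x : M) :
    parallelDet c (shapeOperator J (flatForm c) h N x) s ≠ 0 := by
  intro h0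
  obtain ⟨X, hX, hX0⟩ :=
    (Submodule.ne_bot_iff _).1 (LinearMap.bot_lt_ker_of_det_eq_zero h0).ne'
  refine hX0 (hs x ?_)
  rw [map_zero, diffMap_parallelMap hdim hh hN]
  rw [LinearMap.mem_ker] at hX
  exact (congrArg (diffMap J h x) hX).trans (map_zero _)

/-- Links mean curvatures to determinants: the logarithmic derivative is minus the trace of the
shape operator of `h_s`. Positive dimension is needed to recover the trace from its average. -/
theorem hasDerivAt_parallelDet_shape [FiniteDimensional ℝ E] (hdim : Module.finrank ℝ E + 1 = m)
    (hE : 0 < Module.finrank ℝ E)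
    (hh : IsImmersionInto J (spaceForm c m) h)
    (hN : IsUnitNormalOn J (flatForm c) (spaceFormTangent c) h N Set.univ) {s : ℝ}
    (hs : ∀ x, Function.Injective (diffMap J (parallelMap c h N s) x)) (x : M) :
    HasDerivAt (parallelDet c (shapeOperator J (flatForm c) h N x))
      (-(parallelDet c (shapeOperator J (flatForm c) h N x) s *
        (Module.finrank ℝ E *
          meanCurvature J (flatForm c) (parallelMap c h N s) (parallelNormal c h N s) x))) s := by
  have := hasDerivAt_parallelDet c (parallel_shape hdim hh hN hs x)
  refine this.congr_deriv ?_
  have hE' : (Module.finrank ℝ E : ℝ) ≠ 0 := by positivity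
  rw [meanCurvature, mul_div_cancel₀ _ hE']

/-- The parallel hypersurfaces of an isoparametric hypersurface have constant mean curvature. -/
theorem exists_parallelMeanCurvature [FiniteDimensional ℝ E]
    (hdim : Module.finrank ℝ E + 1 = m) (hE : 0 < Module.finrank ℝ E)
    (hiso : IsIsoparametric J c h N) {δ : ℝ} (hδ : ParallelImmersions J c h N δ) :
    ∃ Hh, ParallelMeanCurvature J c h N δ Hh := by
  rcases isEmpty_or_nonempty M with hM | ⟨⟨x₀⟩⟩
  · exact ⟨0, fun s _ x => hM.elim x⟩
  refine ⟨fun s => meanCurvature J (flatForm c) (parallelMap c h N s) (parallelNormal c h N s) x₀,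
    fun s hs x => ?_⟩
  have h1 := hasDerivAt_parallelDet_shape hdim hE hiso.immersion hiso.unitNormal (hδ s hs) x
  have h2 := hasDerivAt_parallelDet_shape hdim hE hiso.immersion hiso.unitNormal (hδ s hs) x₀
  have hne := parallelDet_ne_zero hdim hiso.immersion hiso.unitNormal (hδ s hs) x₀
  -- The determinant depends on the operator only through its characteristic polynomial, so the two
  -- logarithmic derivatives belong to the same function.
  have heq : parallelDet c (shapeOperator J (flatForm c) h N x)
      = parallelDet c (shapeOperator J (flatForm c) h N x₀) :=
    funext fun t => parallelDet_congr rfl (hiso.const x x₀) c t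
  rw [heq] at h1
  have h3 := mul_left_cancel₀ hne (neg_inj.1 (h1.unique h2))
  exact mul_left_cancel₀ (by positivity) h3

/-- If the parallel hypersurfaces have constant mean curvature, then the hypersurface is
isoparametric. -/
theorem isIsoparametric_of_meanCurvature [FiniteDimensional ℝ E]
    (hdim : Module.finrank ℝ E + 1 = m) (hE : 0 < Module.finrank ℝ E)
    (hh : IsImmersionInto J (spaceForm c m) h)
    (hN : IsUnitNormalOn J (flatForm c) (spaceFormTangent c) h N Set.univ) {ε : ℝ} (hε : 0 < ε)
    (himm : ParallelImmersions J c h N ε)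
    (hmean : ∀ s ∈ Set.Ioo (-ε) ε, ∀ x y,
      meanCurvature J (flatForm c) (parallelMap c h N s) (parallelNormal c h N s) x =
        meanCurvature J (flatForm c) (parallelMap c h N s) (parallelNormal c h N s) y) :
    IsIsoparametric J c h N where
  immersion := hh
  unitNormal := hN
  const x y := by
    refine charpoly_eq_of_parallelDet_eq (c := c) rfl hε fun s hs => ?_
    set D := parallelDet c (shapeOperator J (flatForm c) h N x)
    set D' := parallelDet c (shapeOperator J (flatForm c) h N y)
    have hne : ∀ t ∈ Set.Ioo (-ε) ε, D' t ≠ 0 := fun t ht =>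
      parallelDet_ne_zero hdim hh hN (himm t ht) y
    -- Equal mean curvatures mean equal logarithmic derivatives, so the quotient is constant; its
    -- value at `0` is `1`.
    have hder : ∀ t ∈ Set.Ioo (-ε) ε, HasDerivAt (fun t => D t / D' t) 0 t := fun t ht => by
      have h1 := hasDerivAt_parallelDet_shape hdim hE hh hN (himm t ht) x
      have h2 := hasDerivAt_parallelDet_shape hdim hE hh hN (himm t ht) y
      refine (h1.div h2 (hne t ht)).congr_deriv ?_
      rw [hmean t ht x y]
      ring_nf
    have hconst := isOpen_Ioo.is_const_of_deriv_eq_zero (isPreconnected_Ioo)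
      (fun t ht => (hder t ht).differentiableAt.differentiableWithinAt)
      (fun t ht => (hder t ht).deriv) hs (⟨by linarith, hε⟩ : (0 : ℝ) ∈ Set.Ioo (-ε) ε)
    simp only [D, D', parallelDet_zero, div_one] at hconst
    exact (div_eq_one_iff_eq (hne s hs)).1 hconst

end SpaceFormHypersurface


/-! ### Open subsets of vector spaces -/

section OpensDiff

variable {E : Type*} [NormedAddCommGroup E] [NormedSpace ℝ E]

theorem hasMFDerivAt_opens_val (U : Opens E) (x : U) :
    HasMFDerivAt 𝓘(ℝ, E) 𝓘(ℝ, E) (Subtype.val : U → E) x (ContinuousLinearMap.id ℝ E) := by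
  refine ⟨continuous_subtype_val.continuousAt, ?_⟩
  have hev : writtenInExtChartAt 𝓘(ℝ, E) 𝓘(ℝ, E) x (Subtype.val : U → E) =ᶠ[nhds (x : E)] id := by
    filter_upwards [U.2.mem_nhds x.2] with y hy
    simp only [mfld_simps, writtenInExtChartAt]
    have : Nonempty U := ⟨x⟩
    exact (U.openPartialHomeomorphSubtypeCoe this).right_inv
      ((Set.ext_iff.1 (U.openPartialHomeomorphSubtypeCoe_target this) y).2 hy)
  have h1 : HasFDerivAt (writtenInExtChartAt 𝓘(ℝ, E) 𝓘(ℝ, E) x (Subtype.val : U → E))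
      (ContinuousLinearMap.id ℝ E) (x : E) := (hasFDerivAt_id (x : E)).congr_of_eventuallyEq hev
  exact h1.hasFDerivWithinAt

theorem ContDiffOn.contMDiff_opens {V : Type*} [NormedAddCommGroup V] [NormedSpace ℝ V]
    {F : E → V} {U : Opens E} (hF : ContDiffOn ℝ ∞ F U) :
    ContMDiff 𝓘(ℝ, E) 𝓘(ℝ, V) ∞ (fun x : U => F x) :=
  hF.contMDiffOn.comp_contMDiff contMDiff_subtype_val fun x => x.2

theorem HasFDerivAt.hasDiff_opens {V : Type*} [NormedAddCommGroup V] [NormedSpace ℝ V]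
    {F : E → V} {F' : E →L[ℝ] V} {U : Opens E} {x : U} (hF : HasFDerivAt F F' (x : E)) :
    HasDiff 𝓘(ℝ, E) (fun y : U => F y) x F' :=
  HasMFDerivAt.comp x (hasMFDerivAt_iff_hasFDerivAt.2 hF) (hasMFDerivAt_opens_val U x)

end OpensDiff

/-! ### The functions `a` and `b` -/

section Integrals

variable {δ : ℝ} {θ : ℝ → ℝ}

theorem uIcc_zero_subset {δ s : ℝ} (hs : s ∈ Set.Ioo (-δ) δ) :
    Set.uIcc 0 s ⊆ Set.Ioo (-δ) δ := by
  intro u hu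
  have := Set.mem_uIcc.1 hu
  constructor <;> rcases this with h | h <;> linarith [hs.1, hs.2, h.1, h.2]

theorem hasDerivAt_integral_zero {F : ℝ → ℝ} (hF : ContinuousOn F (Set.Ioo (-δ) δ)) {s : ℝ}
    (hs : s ∈ Set.Ioo (-δ) δ) : HasDerivAt (fun s => ∫ u in (0 : ℝ)..s, F u) (F s) s :=
  intervalIntegral.integral_hasDerivAt_right
    ((hF.mono (uIcc_zero_subset hs)).intervalIntegrable)
    (hF.stronglyMeasurableAtFilter isOpen_Ioo _ hs)
    (hF.continuousAt (isOpen_Ioo.mem_nhds hs))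

theorem hasDerivAt_intCos (hθ : ContinuousOn θ (Set.Ioo (-δ) δ)) {s : ℝ}
    (hs : s ∈ Set.Ioo (-δ) δ) : HasDerivAt (intCos θ) (Real.cos (θ s)) s :=
  hasDerivAt_integral_zero (F := fun u => Real.cos (θ u))
    (Real.continuous_cos.comp_continuousOn hθ) hs

theorem hasDerivAt_intSin (hθ : ContinuousOn θ (Set.Ioo (-δ) δ)) {s : ℝ}
    (hs : s ∈ Set.Ioo (-δ) δ) : HasDerivAt (intSin θ) (Real.sin (θ s)) s :=
  hasDerivAt_integral_zero (F := fun u => Real.sin (θ u))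
    (Real.continuous_sin.comp_continuousOn hθ) hs

theorem contDiffOn_of_hasDerivAt {F F' : ℝ → ℝ} {U : Set ℝ} (hU : IsOpen U)
    (hF : ∀ s ∈ U, HasDerivAt F (F' s) s) (hF' : ContDiffOn ℝ ∞ F' U) : ContDiffOn ℝ ∞ F U := by
  rw [contDiffOn_infty_iff_deriv_of_isOpen hU]
  exact ⟨fun s hs => (hF s hs).differentiableAt.differentiableWithinAt,
    hF'.congr fun s hs => (hF s hs).deriv⟩

theorem contDiffOn_intCos (hθ : ContDiffOn ℝ ∞ θ (Set.Ioo (-δ) δ)) :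
    ContDiffOn ℝ ∞ (intCos θ) (Set.Ioo (-δ) δ) :=
  contDiffOn_of_hasDerivAt isOpen_Ioo (fun _ hs => hasDerivAt_intCos hθ.continuousOn hs)
    (Real.contDiff_cos.comp_contDiffOn hθ)

theorem contDiffOn_intSin (hθ : ContDiffOn ℝ ∞ θ (Set.Ioo (-δ) δ)) :
    ContDiffOn ℝ ∞ (intSin θ) (Set.Ioo (-δ) δ) :=
  contDiffOn_of_hasDerivAt isOpen_Ioo (fun _ hs => hasDerivAt_intSin hθ.continuousOn hs)
    (Real.contDiff_sin.comp_contDiffOn hθ)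

theorem mem_Ioo_of_abs_le {r s : ℝ} (hs : s ∈ Set.Ioo (-δ) δ) (hr : |r| ≤ |s|) :
    r ∈ Set.Ioo (-δ) δ :=
  abs_lt.1 (hr.trans_lt (abs_lt.2 hs))

theorem abs_integral_le_of_abs_le_one {F : ℝ → ℝ} (hF : ∀ u, |F u| ≤ 1) (s : ℝ) :
    |∫ u in (0 : ℝ)..s, F u| ≤ |s| := by
  have := intervalIntegral.norm_integral_le_of_norm_le_const (a := 0) (b := s) (C := 1)
    (f := F) fun u _ => hF u
  simpa using this

/-- As `|cos| ≤ 1`, the time `a(s)` stays in the interval on which the parallel maps are known to be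
immersions. -/
theorem intCos_mem {s : ℝ} (hs : s ∈ Set.Ioo (-δ) δ) : intCos θ s ∈ Set.Ioo (-δ) δ :=
  mem_Ioo_of_abs_le hs (abs_integral_le_of_abs_le_one (fun _ => Real.abs_cos_le_one _) s)

theorem intSin_mem {s : ℝ} (hs : s ∈ Set.Ioo (-δ) δ) : intSin θ s ∈ Set.Ioo (-δ) δ :=
  mem_Ioo_of_abs_le hs (abs_integral_le_of_abs_le_one (fun _ => Real.abs_sin_le_one _) s)

end Integrals

/-! ### Differentials of rotated maps -/

section Rotated

variable {E : Type*} [NormedAddCommGroup E] [NormedSpace ℝ E]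
  {H : Type*} [TopologicalSpace H] {J : ModelWithCorners ℝ E H}
  {M : Type*} [TopologicalSpace M] [ChartedSpace H M] {c : ℝ} {m : ℕ}
  {σ : M → ℝ} {h N : M → Ambient c m} {x : M} {σ' : TangentSpace J x →L[ℝ] ℝ}
  {h' N' : TangentSpace J x →L[ℝ] Ambient c m}

/-- With a time depending on the point, the only additional term comes from `d h_s / ds = N_s`. -/
theorem hasDiff_rotated (hσ : HasDiff J σ x σ') (hh : HasDiff J h x h') (hN : HasDiff J N x N') :
    HasDiff J (fun y => parallelMap c h N (σ y) y) x
      (cosC c (σ x) • h' + sinC c (σ x) • N' + σ'.smulRight (parallelNormal c h N (σ x) x)) := by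
  have h1 := ((hasDerivAt_cosC c (σ x)).hasFDerivAt.comp_hasDiff hσ).smul hh
  have h2 := ((hasDerivAt_sinC c (σ x)).hasFDerivAt.comp_hasDiff hσ).smul hN
  refine HasMFDerivAt.congr_mfderiv (h1.add h2) ?_
  ext1 X
  change (cosC c (σ x) • h' X + (σ' X * -(c * sinC c (σ x))) • h x) +
    (sinC c (σ x) • N' X + (σ' X * cosC c (σ x)) • N x) =
    cosC c (σ x) • h' X + sinC c (σ x) • N' X +
      σ' X • ((-(c * sinC c (σ x))) • h x + cosC c (σ x) • N x)
  module

/-- Here the additional term comes from `d N_s / ds = -c h_s`. -/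
theorem hasDiff_rotatedNormal (hσ : HasDiff J σ x σ') (hh : HasDiff J h x h')
    (hN : HasDiff J N x N') :
    HasDiff J (fun y => parallelNormal c h N (σ y) y) x
      ((-(c * sinC c (σ x))) • h' + cosC c (σ x) • N'
        - σ'.smulRight (c • parallelMap c h N (σ x) x)) := by
  have h1 := (((hasDerivAt_sinC c (σ x)).const_mul c).neg.hasFDerivAt.comp_hasDiff hσ).smul hh
  have h2 := ((hasDerivAt_cosC c (σ x)).hasFDerivAt.comp_hasDiff hσ).smul hN
  refine HasMFDerivAt.congr_mfderiv (h1.add h2) ?_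
  ext1 X
  change ((-(c * sinC c (σ x))) • h' X + (σ' X * -(c * cosC c (σ x))) • h x) +
    (cosC c (σ x) • N' X + (σ' X * -(c * sinC c (σ x))) • N x) =
    (-(c * sinC c (σ x))) • h' X + cosC c (σ x) • N' X -
      σ' X • (c • (cosC c (σ x) • h x + sinC c (σ x) • N x))
  module

theorem contMDiff_rotated (hσ : ContMDiff J 𝓘(ℝ, ℝ) ∞ σ) (hh : ContMDiff J 𝓘(ℝ, Ambient c m) ∞ h)
    (hN : ContMDiff J 𝓘(ℝ, Ambient c m) ∞ N) :
    ContMDiff J 𝓘(ℝ, Ambient c m) ∞ (fun y => parallelMap c h N (σ y) y) :=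
  (((contDiff_cosC c).contMDiff.comp hσ).smul hh).add
    (((contDiff_sinC c).contMDiff.comp hσ).smul hN)

theorem contMDiff_rotatedNormal (hσ : ContMDiff J 𝓘(ℝ, ℝ) ∞ σ)
    (hh : ContMDiff J 𝓘(ℝ, Ambient c m) ∞ h) (hN : ContMDiff J 𝓘(ℝ, Ambient c m) ∞ N) :
    ContMDiff J 𝓘(ℝ, Ambient c m) ∞ (fun y => parallelNormal c h N (σ y) y) :=
  (((contDiff_const.mul (contDiff_sinC c)).neg.contMDiff.comp hσ).smul hh).add
    (((contDiff_cosC c).contMDiff.comp hσ).smul hN)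

end Rotated

/-! ### The angle map -/

section AngleMap

variable {E₁ : Type*} [NormedAddCommGroup E₁] [NormedSpace ℝ E₁]
  {H₁ : Type*} [TopologicalSpace H₁] {J₁ : ModelWithCorners ℝ E₁ H₁}
  {M₁ : Type*} [TopologicalSpace M₁] [ChartedSpace H₁ M₁]
  {E₂ : Type*} [NormedAddCommGroup E₂] [NormedSpace ℝ E₂]
  {H₂ : Type*} [TopologicalSpace H₂] {J₂ : ModelWithCorners ℝ E₂ H₂}
  {M₂ : Type*} [TopologicalSpace M₂] [ChartedSpace H₂ M₂]
  {c₁ c₂ : ℝ} {m₁ m₂ : ℕ} {h Nh : M₁ → Ambient c₁ m₁} {g Ng : M₂ → Ambient c₂ m₂}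
  {δ : ℝ} {θ : ℝ → ℝ}

/-- The unit normal field `(- sin θ Nʰ_a, cos θ Nᵍ_b)` of the angle map. -/
noncomputable def angleNormal (c₁ c₂ : ℝ) {m₁ m₂ : ℕ} (h Nh : M₁ → Ambient c₁ m₁)
    (g Ng : M₂ → Ambient c₂ m₂) (δ : ℝ) (θ : ℝ → ℝ) :
    symmInterval δ × M₁ × M₂ → Ambient c₁ m₁ × Ambient c₂ m₂ :=
  fun p => ((-Real.sin (θ p.1)) • parallelNormal c₁ h Nh (intCos θ p.1) p.2.1,
    Real.cos (θ p.1) • parallelNormal c₂ g Ng (intSin θ p.1) p.2.2)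

theorem contMDiff_angleMap (hθ : ContDiffOn ℝ ∞ θ (Set.Ioo (-δ) δ))
    (hh : ContMDiff J₁ 𝓘(ℝ, Ambient c₁ m₁) ∞ h) (hNh : ContMDiff J₁ 𝓘(ℝ, Ambient c₁ m₁) ∞ Nh)
    (hg : ContMDiff J₂ 𝓘(ℝ, Ambient c₂ m₂) ∞ g) (hNg : ContMDiff J₂ 𝓘(ℝ, Ambient c₂ m₂) ∞ Ng) :
    ContMDiff (𝓘(ℝ, ℝ).prod (J₁.prod J₂)) 𝓘(ℝ, Ambient c₁ m₁ × Ambient c₂ m₂) ∞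
      (angleMap c₁ c₂ h Nh g Ng δ θ) := by
  have ha : ContMDiff 𝓘(ℝ, ℝ) 𝓘(ℝ, ℝ) ∞ (fun s : symmInterval δ => intCos θ s) :=
    ContDiffOn.contMDiff_opens (U := symmInterval δ) (contDiffOn_intCos hθ)
  have hb : ContMDiff 𝓘(ℝ, ℝ) 𝓘(ℝ, ℝ) ∞ (fun s : symmInterval δ => intSin θ s) :=
    ContDiffOn.contMDiff_opens (U := symmInterval δ) (contDiffOn_intSin hθ)
  have h1 : ContMDiff (𝓘(ℝ, ℝ).prod (J₁.prod J₂)) J₁ ∞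
    (fun p : symmInterval δ × M₁ × M₂ => p.2.1) := contMDiff_fst.comp contMDiff_snd
  have h2 : ContMDiff (𝓘(ℝ, ℝ).prod (J₁.prod J₂)) J₂ ∞
    (fun p : symmInterval δ × M₁ × M₂ => p.2.2) := contMDiff_snd.comp contMDiff_snd
  exact (contMDiff_rotated (ha.comp contMDiff_fst) (hh.comp h1) (hNh.comp h1)).prodMk_space
    (contMDiff_rotated (hb.comp contMDiff_fst) (hg.comp h2) (hNg.comp h2))

theorem contMDiff_angleNormal (hθ : ContDiffOn ℝ ∞ θ (Set.Ioo (-δ) δ))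
    (hh : ContMDiff J₁ 𝓘(ℝ, Ambient c₁ m₁) ∞ h) (hNh : ContMDiff J₁ 𝓘(ℝ, Ambient c₁ m₁) ∞ Nh)
    (hg : ContMDiff J₂ 𝓘(ℝ, Ambient c₂ m₂) ∞ g) (hNg : ContMDiff J₂ 𝓘(ℝ, Ambient c₂ m₂) ∞ Ng) :
    ContMDiff (𝓘(ℝ, ℝ).prod (J₁.prod J₂)) 𝓘(ℝ, Ambient c₁ m₁ × Ambient c₂ m₂) ∞
      (angleNormal c₁ c₂ h Nh g Ng δ θ) := by
  have ha : ContMDiff 𝓘(ℝ, ℝ) 𝓘(ℝ, ℝ) ∞ (fun s : symmInterval δ => intCos θ s) :=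
    ContDiffOn.contMDiff_opens (U := symmInterval δ) (contDiffOn_intCos hθ)
  have hb : ContMDiff 𝓘(ℝ, ℝ) 𝓘(ℝ, ℝ) ∞ (fun s : symmInterval δ => intSin θ s) :=
    ContDiffOn.contMDiff_opens (U := symmInterval δ) (contDiffOn_intSin hθ)
  have hs : ContMDiff 𝓘(ℝ, ℝ) 𝓘(ℝ, ℝ) ∞ (fun s : symmInterval δ => -Real.sin (θ s)) :=
    ContDiffOn.contMDiff_opens (U := symmInterval δ) (F := fun s => -Real.sin (θ s))
      (Real.contDiff_sin.comp_contDiffOn hθ).neg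
  have hc : ContMDiff 𝓘(ℝ, ℝ) 𝓘(ℝ, ℝ) ∞ (fun s : symmInterval δ => Real.cos (θ s)) :=
    ContDiffOn.contMDiff_opens (U := symmInterval δ) (F := fun s => Real.cos (θ s))
      (Real.contDiff_cos.comp_contDiffOn hθ)
  have h1 : ContMDiff (𝓘(ℝ, ℝ).prod (J₁.prod J₂)) J₁ ∞
    (fun p : symmInterval δ × M₁ × M₂ => p.2.1) := contMDiff_fst.comp contMDiff_snd
  have h2 : ContMDiff (𝓘(ℝ, ℝ).prod (J₁.prod J₂)) J₂ ∞
    (fun p : symmInterval δ × M₁ × M₂ => p.2.2) := contMDiff_snd.comp contMDiff_snd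
  exact ((hs.comp contMDiff_fst).smul (contMDiff_rotatedNormal (ha.comp contMDiff_fst)
      (hh.comp h1) (hNh.comp h1))).prodMk_space
    ((hc.comp contMDiff_fst).smul (contMDiff_rotatedNormal (hb.comp contMDiff_fst)
      (hg.comp h2) (hNg.comp h2)))

theorem hasDiff_comp_fst {F : ℝ → ℝ} {F' : ℝ} {p : symmInterval δ × M₁ × M₂}
    (hF : HasDerivAt F F' p.1) :
    HasDiff (𝓘(ℝ, ℝ).prod (J₁.prod J₂)) (fun q : symmInterval δ × M₁ × M₂ => F q.1) p
      ((ContinuousLinearMap.toSpanSingleton ℝ F').comp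
        (ContinuousLinearMap.fst ℝ ℝ (E₁ × E₂))) :=
  HasDiff.comp_mfderiv (J := 𝓘(ℝ, ℝ)) (f := fun s : symmInterval δ => F s)
    (HasFDerivAt.hasDiff_opens (U := symmInterval δ) hF.hasFDerivAt) (hasMFDerivAt_fst p)

theorem hasDiff_comp_snd_fst {V : Type*} [NormedAddCommGroup V] [NormedSpace ℝ V] {F : M₁ → V}
    {p : symmInterval δ × M₁ × M₂} {F' : TangentSpace J₁ p.2.1 →L[ℝ] V}
    (hF : HasDiff J₁ F p.2.1 F') :
    HasDiff (𝓘(ℝ, ℝ).prod (J₁.prod J₂)) (fun q : symmInterval δ × M₁ × M₂ => F q.2.1) p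
      (F'.comp ((ContinuousLinearMap.fst ℝ E₁ E₂).comp
        (ContinuousLinearMap.snd ℝ ℝ (E₁ × E₂)))) :=
  HasDiff.comp_mfderiv (J := J₁) hF
    (HasMFDerivAt.comp p (hasMFDerivAt_fst (I := J₁) (I' := J₂) p.2) (hasMFDerivAt_snd p))

theorem hasDiff_comp_snd_snd {V : Type*} [NormedAddCommGroup V] [NormedSpace ℝ V] {F : M₂ → V}
    {p : symmInterval δ × M₁ × M₂} {F' : TangentSpace J₂ p.2.2 →L[ℝ] V}
    (hF : HasDiff J₂ F p.2.2 F') :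
    HasDiff (𝓘(ℝ, ℝ).prod (J₁.prod J₂)) (fun q : symmInterval δ × M₁ × M₂ => F q.2.2) p
      (F'.comp ((ContinuousLinearMap.snd ℝ E₁ E₂).comp
        (ContinuousLinearMap.snd ℝ ℝ (E₁ × E₂)))) :=
  HasDiff.comp_mfderiv (J := J₂) hF
    (HasMFDerivAt.comp p (hasMFDerivAt_snd (I := J₁) (I' := J₂) p.2) (hasMFDerivAt_snd p))

theorem diffMap_angleMap (hθ : ContinuousOn θ (Set.Ioo (-δ) δ)) {p : symmInterval δ × M₁ × M₂}
    (hh : MDifferentiableAt J₁ 𝓘(ℝ, Ambient c₁ m₁) h p.2.1)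
    (hNh : MDifferentiableAt J₁ 𝓘(ℝ, Ambient c₁ m₁) Nh p.2.1)
    (hg : MDifferentiableAt J₂ 𝓘(ℝ, Ambient c₂ m₂) g p.2.2)
    (hNg : MDifferentiableAt J₂ 𝓘(ℝ, Ambient c₂ m₂) Ng p.2.2)
    (r : ℝ) (X₁ : TangentSpace J₁ p.2.1) (X₂ : TangentSpace J₂ p.2.2) :
    diffMap (𝓘(ℝ, ℝ).prod (J₁.prod J₂)) (angleMap c₁ c₂ h Nh g Ng δ θ) p (r, X₁, X₂) =
      (diffMap J₁ (parallelMap c₁ h Nh (intCos θ p.1)) p.2.1 X₁ +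
          (r * Real.cos (θ p.1)) • parallelNormal c₁ h Nh (intCos θ p.1) p.2.1,
        diffMap J₂ (parallelMap c₂ g Ng (intSin θ p.1)) p.2.2 X₂ +
          (r * Real.sin (θ p.1)) • parallelNormal c₂ g Ng (intSin θ p.1) p.2.2) := by
  have ha := hasDiff_comp_fst (J₁ := J₁) (J₂ := J₂) (hasDerivAt_intCos hθ p.1.2)
  have hb := hasDiff_comp_fst (J₁ := J₁) (J₂ := J₂) (hasDerivAt_intSin hθ p.1.2)
  have h1 := hasDiff_rotated ha (hasDiff_comp_snd_fst (J₂ := J₂) hh.hasDiff)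
    (hasDiff_comp_snd_fst (J₂ := J₂) hNh.hasDiff)
  have h2 := hasDiff_rotated hb (hasDiff_comp_snd_snd (J₁ := J₁) hg.hasDiff)
    (hasDiff_comp_snd_snd (J₁ := J₁) hNg.hasDiff)
  have h3 : HasDiff (𝓘(ℝ, ℝ).prod (J₁.prod J₂)) (angleMap c₁ c₂ h Nh g Ng δ θ) p _ :=
    h1.prodMk h2
  rw [h3.diffMap_eq, (hasDiff_parallelMap hh.hasDiff hNh.hasDiff _).diffMap_eq,
    (hasDiff_parallelMap hg.hasDiff hNg.hasDiff _).diffMap_eq]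
  rfl

theorem diffMap_angleNormal (hθ : ContinuousOn θ (Set.Ioo (-δ) δ)) {p : symmInterval δ × M₁ × M₂}
    {θ' : ℝ} (hθ' : HasDerivAt θ θ' p.1)
    (hh : MDifferentiableAt J₁ 𝓘(ℝ, Ambient c₁ m₁) h p.2.1)
    (hNh : MDifferentiableAt J₁ 𝓘(ℝ, Ambient c₁ m₁) Nh p.2.1)
    (hg : MDifferentiableAt J₂ 𝓘(ℝ, Ambient c₂ m₂) g p.2.2)
    (hNg : MDifferentiableAt J₂ 𝓘(ℝ, Ambient c₂ m₂) Ng p.2.2)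
    (r : ℝ) (X₁ : TangentSpace J₁ p.2.1) (X₂ : TangentSpace J₂ p.2.2) :
    diffMap (𝓘(ℝ, ℝ).prod (J₁.prod J₂)) (angleNormal c₁ c₂ h Nh g Ng δ θ) p (r, X₁, X₂) =
      ((-Real.sin (θ p.1)) • (diffMap J₁ (parallelNormal c₁ h Nh (intCos θ p.1)) p.2.1 X₁ -
          (r * Real.cos (θ p.1)) • c₁ • parallelMap c₁ h Nh (intCos θ p.1) p.2.1) +
          (r * (-(Real.cos (θ p.1) * θ'))) • parallelNormal c₁ h Nh (intCos θ p.1) p.2.1,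
        Real.cos (θ p.1) • (diffMap J₂ (parallelNormal c₂ g Ng (intSin θ p.1)) p.2.2 X₂ -
          (r * Real.sin (θ p.1)) • c₂ • parallelMap c₂ g Ng (intSin θ p.1) p.2.2) +
          (r * (-Real.sin (θ p.1) * θ')) • parallelNormal c₂ g Ng (intSin θ p.1) p.2.2) := by
  have ha := hasDiff_comp_fst (J₁ := J₁) (J₂ := J₂) (hasDerivAt_intCos hθ p.1.2)
  have hb := hasDiff_comp_fst (J₁ := J₁) (J₂ := J₂) (hasDerivAt_intSin hθ p.1.2)
  have hs := hasDiff_comp_fst (J₁ := J₁) (J₂ := J₂) hθ'.sin.neg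
  have hc := hasDiff_comp_fst (J₁ := J₁) (J₂ := J₂) hθ'.cos
  have h1 := hs.smul (hasDiff_rotatedNormal ha (hasDiff_comp_snd_fst (J₂ := J₂) hh.hasDiff)
    (hasDiff_comp_snd_fst (J₂ := J₂) hNh.hasDiff))
  have h2 := hc.smul (hasDiff_rotatedNormal hb (hasDiff_comp_snd_snd (J₁ := J₁) hg.hasDiff)
    (hasDiff_comp_snd_snd (J₁ := J₁) hNg.hasDiff))
  have h3 : HasDiff (𝓘(ℝ, ℝ).prod (J₁.prod J₂)) (angleNormal c₁ c₂ h Nh g Ng δ θ) p _ :=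
    h1.prodMk h2
  rw [h3.diffMap_eq, (hasDiff_parallelNormal hh.hasDiff hNh.hasDiff _).diffMap_eq,
    (hasDiff_parallelNormal hg.hasDiff hNg.hasDiff _).diffMap_eq]
  rfl

end AngleMap


/-! ### First order geometry of the angle map. -/

section AngleHypersurface

variable {E₁ : Type*} [NormedAddCommGroup E₁] [NormedSpace ℝ E₁]
  {H₁ : Type*} [TopologicalSpace H₁] {J₁ : ModelWithCorners ℝ E₁ H₁}
  {M₁ : Type*} [TopologicalSpace M₁] [ChartedSpace H₁ M₁]
  {E₂ : Type*} [NormedAddCommGroup E₂] [NormedSpace ℝ E₂]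
  {H₂ : Type*} [TopologicalSpace H₂] {J₂ : ModelWithCorners ℝ E₂ H₂}
  {M₂ : Type*} [TopologicalSpace M₂] [ChartedSpace H₂ M₂]
  {c₁ c₂ : ℝ} {m₁ m₂ : ℕ} {h Nh : M₁ → Ambient c₁ m₁} {g Ng : M₂ → Ambient c₂ m₂}
  {δ : ℝ} {θ : ℝ → ℝ}

/-- Two hypersurfaces of space forms whose parallel maps at distance less than `δ` are immersions,
and a smooth angle function on `(-δ, δ)`. -/
structure AngleData (J₁ : ModelWithCorners ℝ E₁ H₁) (J₂ : ModelWithCorners ℝ E₂ H₂) (c₁ c₂ : ℝ)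
    {m₁ m₂ : ℕ} (h Nh : M₁ → Ambient c₁ m₁) (g Ng : M₂ → Ambient c₂ m₂) (δ : ℝ)
    (θ : ℝ → ℝ) : Prop where
  immersion₁ : IsImmersionInto J₁ (spaceForm c₁ m₁) h
  normal₁ : IsUnitNormalOn J₁ (flatForm c₁) (spaceFormTangent c₁) h Nh Set.univ
  immersion₂ : IsImmersionInto J₂ (spaceForm c₂ m₂) g
  normal₂ : IsUnitNormalOn J₂ (flatForm c₂) (spaceFormTangent c₂) g Ng Set.univ
  parallel₁ : ParallelImmersions J₁ c₁ h Nh δ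
  parallel₂ : ParallelImmersions J₂ c₂ g Ng δ
  smooth : ContDiffOn ℝ ∞ θ (Set.Ioo (-δ) δ)

namespace AngleData

variable (D : AngleData J₁ J₂ c₁ c₂ h Nh g Ng δ θ)

include D

theorem hasDerivAt (s : symmInterval δ) : HasDerivAt θ (deriv θ s) s :=
  ((D.smooth.contDiffAt (isOpen_Ioo.mem_nhds s.2)).differentiableAt (by simp)).hasDerivAt

theorem diffMap_eq (p : symmInterval δ × M₁ × M₂) (r : ℝ) (X₁ : TangentSpace J₁ p.2.1)
    (X₂ : TangentSpace J₂ p.2.2) :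
    diffMap (𝓘(ℝ, ℝ).prod (J₁.prod J₂)) (angleMap c₁ c₂ h Nh g Ng δ θ) p (r, X₁, X₂) =
      (diffMap J₁ (parallelMap c₁ h Nh (intCos θ p.1)) p.2.1 X₁ +
          (r * Real.cos (θ p.1)) • parallelNormal c₁ h Nh (intCos θ p.1) p.2.1,
        diffMap J₂ (parallelMap c₂ g Ng (intSin θ p.1)) p.2.2 X₂ +
          (r * Real.sin (θ p.1)) • parallelNormal c₂ g Ng (intSin θ p.1) p.2.2) :=
  diffMap_angleMap D.smooth.continuousOn (D.immersion₁.smooth.mdifferentiableAt (by simp))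
    ((contMDiffOn_univ.1 D.normal₁.smooth).mdifferentiableAt (by simp))
    (D.immersion₂.smooth.mdifferentiableAt (by simp))
    ((contMDiffOn_univ.1 D.normal₂.smooth).mdifferentiableAt (by simp)) r X₁ X₂

theorem diffMap_normal_eq (p : symmInterval δ × M₁ × M₂) (r : ℝ) (X₁ : TangentSpace J₁ p.2.1)
    (X₂ : TangentSpace J₂ p.2.2) :
    diffMap (𝓘(ℝ, ℝ).prod (J₁.prod J₂)) (angleNormal c₁ c₂ h Nh g Ng δ θ) p (r, X₁, X₂) =
      ((-Real.sin (θ p.1)) • (diffMap J₁ (parallelNormal c₁ h Nh (intCos θ p.1)) p.2.1 X₁ -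
          (r * Real.cos (θ p.1)) • c₁ • parallelMap c₁ h Nh (intCos θ p.1) p.2.1) +
          (r * (-(Real.cos (θ p.1) * deriv θ p.1))) • parallelNormal c₁ h Nh (intCos θ p.1) p.2.1,
        Real.cos (θ p.1) • (diffMap J₂ (parallelNormal c₂ g Ng (intSin θ p.1)) p.2.2 X₂ -
          (r * Real.sin (θ p.1)) • c₂ • parallelMap c₂ g Ng (intSin θ p.1) p.2.2) +
          (r * (-Real.sin (θ p.1) * deriv θ p.1)) • parallelNormal c₂ g Ng (intSin θ p.1) p.2.2) :=
  diffMap_angleNormal D.smooth.continuousOn (D.hasDerivAt p.1)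
    (D.immersion₁.smooth.mdifferentiableAt (by simp))
    ((contMDiffOn_univ.1 D.normal₁.smooth).mdifferentiableAt (by simp))
    (D.immersion₂.smooth.mdifferentiableAt (by simp))
    ((contMDiffOn_univ.1 D.normal₂.smooth).mdifferentiableAt (by simp)) r X₁ X₂

theorem immersion_parallel₁ (s : symmInterval δ) :
    IsImmersionInto J₁ (spaceForm c₁ m₁) (parallelMap c₁ h Nh (intCos θ s)) :=
  isImmersionInto_parallelMap D.immersion₁ D.normal₁ (D.parallel₁ _ (intCos_mem s.2))

theorem immersion_parallel₂ (s : symmInterval δ) :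
    IsImmersionInto J₂ (spaceForm c₂ m₂) (parallelMap c₂ g Ng (intSin θ s)) :=
  isImmersionInto_parallelMap D.immersion₂ D.normal₂ (D.parallel₂ _ (intSin_mem s.2))

theorem normal_parallel₁ (s : ℝ) :
    IsUnitNormalOn J₁ (flatForm c₁) (spaceFormTangent c₁) (parallelMap c₁ h Nh s)
      (parallelNormal c₁ h Nh s) Set.univ :=
  isUnitNormalOn_parallelNormal D.immersion₁ D.normal₁ s

theorem normal_parallel₂ (s : ℝ) :
    IsUnitNormalOn J₂ (flatForm c₂) (spaceFormTangent c₂) (parallelMap c₂ g Ng s)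
      (parallelNormal c₂ g Ng s) Set.univ :=
  isUnitNormalOn_parallelNormal D.immersion₂ D.normal₂ s

/-- Pairing the two components of the differential with the normals of the parallel hypersurfaces
isolates `r cos θ` and `r sin θ`, so `r = 0`. The remaining components vanish because the parallel
maps are immersions. -/
theorem isProductImmersion :
    IsProductImmersion (𝓘(ℝ, ℝ).prod (J₁.prod J₂)) c₁ c₂ (angleMap c₁ c₂ h Nh g Ng δ θ) where
  smooth := contMDiff_angleMap D.smooth D.immersion₁.smooth (contMDiffOn_univ.1 D.normal₁.smooth)
    D.immersion₂.smooth (contMDiffOn_univ.1 D.normal₂.smooth)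
  mem p := ⟨(D.immersion_parallel₁ p.1).mem p.2.1, (D.immersion_parallel₂ p.1).mem p.2.2⟩
  injective_diff p := by
    refine (injective_iff_map_eq_zero _).2 ?_
    rintro ⟨r, X₁, X₂⟩ h0
    have hd := D.diffMap_eq p r X₁ X₂
    rw [hd] at h0
    obtain ⟨h1, h2⟩ := Prod.mk_eq_zero.1 h0
    have n1 := (D.normal_parallel₁ (intCos θ p.1)).normal p.2.1 trivial X₁
    have n2 := (D.normal_parallel₂ (intSin θ p.1)).normal p.2.2 trivial X₂
    have u1 := (D.normal_parallel₁ (intCos θ p.1)).unit p.2.1 trivial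
    have u2 := (D.normal_parallel₂ (intSin θ p.1)).unit p.2.2 trivial
    have e1 := congrArg (flatForm c₁ (parallelNormal c₁ h Nh (intCos θ p.1) p.2.1)) h1
    have e2 := congrArg (flatForm c₂ (parallelNormal c₂ g Ng (intSin θ p.1) p.2.2)) h2
    rw [flatForm_add_right, flatForm_smul_right, n1, u1, flatForm_zero_right] at e1
    rw [flatForm_add_right, flatForm_smul_right, n2, u2, flatForm_zero_right] at e2
    have hr : r = 0 := by
      have := Real.sin_sq_add_cos_sq (θ p.1)
      linear_combination Real.cos (θ p.1) * e1 + Real.sin (θ p.1) * e2 - r * this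
    subst hr
    rw [zero_mul, zero_smul, add_zero] at h1 h2
    have hX1 : X₁ = 0 := (D.immersion_parallel₁ p.1).injective_diff p.2.1
        (h1.trans (map_zero _).symm)
    have hX2 : X₂ = 0 := (D.immersion_parallel₂ p.1).injective_diff p.2.2
        (h2.trans (map_zero _).symm)
    subst hX1 hX2
    rfl

/-- The vector `(-sin θ, cos θ)` is the quarter turn of `(cos θ, sin θ)`, the coefficients of `∂_s
f` in the plane of the two parallel normals; vectors from `TM₁` and `TM₂` are orthogonal to that
plane. -/
theorem isUnitNormalOn :
    IsUnitNormalOn (𝓘(ℝ, ℝ).prod (J₁.prod J₂)) (prodForm c₁ c₂) (prodTangent c₁ c₂)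
      (angleMap c₁ c₂ h Nh g Ng δ θ) (angleNormal c₁ c₂ h Nh g Ng δ θ) Set.univ where
  smooth := contMDiffOn_univ.2 <| contMDiff_angleNormal D.smooth D.immersion₁.smooth
    (contMDiffOn_univ.1 D.normal₁.smooth) D.immersion₂.smooth
    (contMDiffOn_univ.1 D.normal₂.smooth)
  tangent p _ := ⟨(tangentSub c₁ _).smul_mem _ ((D.normal_parallel₁ _).tangent p.2.1 trivial),
    (tangentSub c₂ _).smul_mem _ ((D.normal_parallel₂ _).tangent p.2.2 trivial)⟩
  unit p _ := by
    have u1 := (D.normal_parallel₁ (intCos θ p.1)).unit p.2.1 trivial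
    have u2 := (D.normal_parallel₂ (intSin θ p.1)).unit p.2.2 trivial
    simp only [prodForm, angleNormal, flatForm_smul_left, flatForm_smul_right, u1, u2]
    linear_combination Real.sin_sq_add_cos_sq (θ p.1)
  normal p _ X := by
    obtain ⟨r, X₁, X₂⟩ := X
    have hd := D.diffMap_eq p r X₁ X₂
    rw [hd]
    have n1 := (D.normal_parallel₁ (intCos θ p.1)).normal p.2.1 trivial X₁
    have n2 := (D.normal_parallel₂ (intSin θ p.1)).normal p.2.2 trivial X₂
    have u1 := (D.normal_parallel₁ (intCos θ p.1)).unit p.2.1 trivial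
    have u2 := (D.normal_parallel₂ (intSin θ p.1)).unit p.2.2 trivial
    simp only [prodForm, angleNormal, flatForm_smul_left, flatForm_smul_right, flatForm_add_right,
      u1, u2, n1, n2]
    ring

theorem diffMap_mem (p : symmInterval δ × M₁ × M₂)
    (X : TangentSpace (𝓘(ℝ, ℝ).prod (J₁.prod J₂)) p) :
    diffMap (𝓘(ℝ, ℝ).prod (J₁.prod J₂)) (angleMap c₁ c₂ h Nh g Ng δ θ) p X ∈
      prodTangent c₁ c₂ (angleMap c₁ c₂ h Nh g Ng δ θ p) :=
  have hd := D.isProductImmersion.hasDiff p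
  ⟨hd.fst.mem_spaceFormTangent
      (Filter.Eventually.of_forall fun q => (D.isProductImmersion.mem q).1) X,
    hd.snd.mem_spaceFormTangent
      (Filter.Eventually.of_forall fun q => (D.isProductImmersion.mem q).2) X⟩

end AngleData

end AngleHypersurface


/-! ### Shape operator, mean curvature and product tensor of the angle map. -/

section AngleShape

variable {E₁ : Type*} [NormedAddCommGroup E₁] [NormedSpace ℝ E₁]
  {H₁ : Type*} [TopologicalSpace H₁] {J₁ : ModelWithCorners ℝ E₁ H₁}
  {M₁ : Type*} [TopologicalSpace M₁] [ChartedSpace H₁ M₁]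
  {E₂ : Type*} [NormedAddCommGroup E₂] [NormedSpace ℝ E₂]
  {H₂ : Type*} [TopologicalSpace H₂] {J₂ : ModelWithCorners ℝ E₂ H₂}
  {M₂ : Type*} [TopologicalSpace M₂] [ChartedSpace H₂ M₂]
  {c₁ c₂ : ℝ} {m₁ m₂ : ℕ} {h Nh : M₁ → Ambient c₁ m₁} {g Ng : M₂ → Ambient c₂ m₂}
  {δ : ℝ} {θ : ℝ → ℝ}

/-- For `c = 0` tangency is no condition, and the factor `c` allows all curvatures to be treated at
once. -/
theorem mul_flatForm_eq_zero {c : ℝ} {m : ℕ} {p v : Ambient c m}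
    (hv : v ∈ spaceFormTangent c p) : c * flatForm c p v = 0 := by
  by_cases hc : c = 0
  · simp [hc]
  · rw [hv hc, mul_zero]

variable (J₁ J₂) in
/-- The tangent vector of the product manifold with the given components. -/
noncomputable def tvec (p : symmInterval δ × M₁ × M₂) (r : ℝ) (X₁ : TangentSpace J₁ p.2.1)
    (X₂ : TangentSpace J₂ p.2.2) : TangentSpace (𝓘(ℝ, ℝ).prod (J₁.prod J₂)) p :=
  (r, X₁, X₂)

theorem exists_eq_tvec (p : symmInterval δ × M₁ × M₂)
    (X : TangentSpace (𝓘(ℝ, ℝ).prod (J₁.prod J₂)) p) :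
    ∃ (r : ℝ) (X₁ : TangentSpace J₁ p.2.1) (X₂ : TangentSpace J₂ p.2.2),
      X = tvec J₁ J₂ p r X₁ X₂ :=
  ⟨X.1, X.2.1, X.2.2, rfl⟩

theorem AngleData.diffMap_tvec (D : AngleData J₁ J₂ c₁ c₂ h Nh g Ng δ θ)
    (p : symmInterval δ × M₁ × M₂) (r : ℝ) (X₁ : TangentSpace J₁ p.2.1)
    (X₂ : TangentSpace J₂ p.2.2) :
    diffMap (𝓘(ℝ, ℝ).prod (J₁.prod J₂)) (angleMap c₁ c₂ h Nh g Ng δ θ) p (tvec J₁ J₂ p r X₁ X₂) =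
      (diffMap J₁ (parallelMap c₁ h Nh (intCos θ p.1)) p.2.1 X₁ +
          (r * Real.cos (θ p.1)) • parallelNormal c₁ h Nh (intCos θ p.1) p.2.1,
        diffMap J₂ (parallelMap c₂ g Ng (intSin θ p.1)) p.2.2 X₂ +
          (r * Real.sin (θ p.1)) • parallelNormal c₂ g Ng (intSin θ p.1) p.2.2) :=
  D.diffMap_eq p r X₁ X₂

variable (J₁ J₂) in
/-- The block diagonal endomorphism with blocks `r`, `A₁`, `A₂`. -/
noncomputable def blockDiag (p : symmInterval δ × M₁ × M₂) (r : ℝ)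
    (A₁ : TangentSpace J₁ p.2.1 →ₗ[ℝ] TangentSpace J₁ p.2.1)
    (A₂ : TangentSpace J₂ p.2.2 →ₗ[ℝ] TangentSpace J₂ p.2.2) :
    TangentSpace (𝓘(ℝ, ℝ).prod (J₁.prod J₂)) p →ₗ[ℝ]
      TangentSpace (𝓘(ℝ, ℝ).prod (J₁.prod J₂)) p :=
  (r • LinearMap.id : ℝ →ₗ[ℝ] ℝ).prodMap (A₁.prodMap A₂)

theorem blockDiag_apply (p : symmInterval δ × M₁ × M₂) (r : ℝ)
    (A₁ : TangentSpace J₁ p.2.1 →ₗ[ℝ] TangentSpace J₁ p.2.1)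
    (A₂ : TangentSpace J₂ p.2.2 →ₗ[ℝ] TangentSpace J₂ p.2.2) (t : ℝ)
    (X₁ : TangentSpace J₁ p.2.1) (X₂ : TangentSpace J₂ p.2.2) :
    blockDiag J₁ J₂ p r A₁ A₂ (tvec J₁ J₂ p t X₁ X₂) = tvec J₁ J₂ p (r * t) (A₁ X₁) (A₂ X₂) := rfl

theorem trace_blockDiag [FiniteDimensional ℝ E₁] [FiniteDimensional ℝ E₂]
    (p : symmInterval δ × M₁ × M₂) (r : ℝ)
    (A₁ : TangentSpace J₁ p.2.1 →ₗ[ℝ] TangentSpace J₁ p.2.1)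
    (A₂ : TangentSpace J₂ p.2.2 →ₗ[ℝ] TangentSpace J₂ p.2.2) :
    LinearMap.trace ℝ (TangentSpace (𝓘(ℝ, ℝ).prod (J₁.prod J₂)) p) (blockDiag J₁ J₂ p r A₁ A₂) =
      r + (LinearMap.trace ℝ (TangentSpace J₁ p.2.1) A₁ +
        LinearMap.trace ℝ (TangentSpace J₂ p.2.2) A₂) := by
  have h1 := LinearMap.trace_prodMap' (r • LinearMap.id : ℝ →ₗ[ℝ] ℝ) (A₁.prodMap A₂)
  have h3 := LinearMap.trace_prodMap' A₁ A₂
  have h2 : LinearMap.trace ℝ ℝ (r • LinearMap.id) = r := by simp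
  rw [h2, h3] at h1
  exact h1

namespace AngleData

/-- The shape operator of the angle map. -/
theorem isShapeOperator (D : AngleData J₁ J₂ c₁ c₂ h Nh g Ng δ θ)
    [FiniteDimensional ℝ E₁] [FiniteDimensional ℝ E₂]
    (hd₁ : Module.finrank ℝ E₁ + 1 = m₁) (hd₂ : Module.finrank ℝ E₂ + 1 = m₂)
    (p : symmInterval δ × M₁ × M₂) :
    IsShapeOperator (𝓘(ℝ, ℝ).prod (J₁.prod J₂)) (prodForm c₁ c₂) (angleMap c₁ c₂ h Nh g Ng δ θ)
      (angleNormal c₁ c₂ h Nh g Ng δ θ) p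
      (blockDiag J₁ J₂ p (deriv θ p.1)
        ((-Real.sin (θ p.1)) • shapeOperator J₁ (flatForm c₁)
          (parallelMap c₁ h Nh (intCos θ p.1)) (parallelNormal c₁ h Nh (intCos θ p.1)) p.2.1)
        (Real.cos (θ p.1) • shapeOperator J₂ (flatForm c₂)
          (parallelMap c₂ g Ng (intSin θ p.1)) (parallelNormal c₂ g Ng (intSin θ p.1)) p.2.2)) := by
  intro X Y
  obtain ⟨r, X₁, X₂, rfl⟩ := exists_eq_tvec p X
  obtain ⟨t, Y₁, Y₂, rfl⟩ := exists_eq_tvec p Y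
  have i1 := D.immersion_parallel₁ p.1
  have i2 := D.immersion_parallel₂ p.1
  have ν1 := D.normal_parallel₁ (intCos θ p.1)
  have ν2 := D.normal_parallel₂ (intSin θ p.1)
  have w1 := diffMap_normal hd₁ i1 ν1 p.2.1 X₁
  have w2 := diffMap_normal hd₂ i2 ν2 p.2.2 X₂
  have n1 := ν1.normal p.2.1 trivial
  have n2 := ν2.normal p.2.2 trivial
  have u1 := ν1.unit p.2.1 trivial
  have u2 := ν2.unit p.2.2 trivial
  have t1 := mul_flatForm_eq_zero (ν1.tangent p.2.1 trivial)
  have t2 := mul_flatForm_eq_zero (ν2.tangent p.2.2 trivial)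
  have s1 := mul_flatForm_eq_zero (i1.diffMap_mem p.2.1 Y₁)
  have s2 := mul_flatForm_eq_zero (i2.diffMap_mem p.2.2 Y₂)
  have eN : diffMap (𝓘(ℝ, ℝ).prod (J₁.prod J₂)) (angleNormal c₁ c₂ h Nh g Ng δ θ) p
    (tvec J₁ J₂ p r X₁ X₂) = _ := D.diffMap_normal_eq p r X₁ X₂
  have eY := D.diffMap_tvec p t Y₁ Y₂
  rw [blockDiag_apply]
  have eA := D.diffMap_tvec p (deriv θ p.1 * r)
    (((-Real.sin (θ p.1)) • shapeOperator J₁ (flatForm c₁)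
          (parallelMap c₁ h Nh (intCos θ p.1)) (parallelNormal c₁ h Nh (intCos θ p.1)) p.2.1) X₁)
    ((Real.cos (θ p.1) • shapeOperator J₂ (flatForm c₂)
          (parallelMap c₂ g Ng (intSin θ p.1)) (parallelNormal c₂ g Ng (intSin θ p.1)) p.2.2) X₂)
  rw [eN, eY, eA, w1, w2, LinearMap.smul_apply, LinearMap.smul_apply, map_smul, map_smul]
  have n1A := n1 (shapeOperator J₁ (flatForm c₁) (parallelMap c₁ h Nh (intCos θ p.1))
    (parallelNormal c₁ h Nh (intCos θ p.1)) p.2.1 X₁)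
  have n2A := n2 (shapeOperator J₂ (flatForm c₂) (parallelMap c₂ g Ng (intSin θ p.1))
    (parallelNormal c₂ g Ng (intSin θ p.1)) p.2.2 X₂)
  have n1Y := n1 Y₁
  have n2Y := n2 Y₂
  clear eN eY eA w1 w2 n1 n2
  generalize diffMap J₁ (parallelMap c₁ h Nh (intCos θ p.1)) p.2.1
    (shapeOperator J₁ (flatForm c₁) (parallelMap c₁ h Nh (intCos θ p.1))
    (parallelNormal c₁ h Nh (intCos θ p.1)) p.2.1 X₁) = a₁ at *
  generalize diffMap J₂ (parallelMap c₂ g Ng (intSin θ p.1)) p.2.2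
    (shapeOperator J₂ (flatForm c₂) (parallelMap c₂ g Ng (intSin θ p.1))
    (parallelNormal c₂ g Ng (intSin θ p.1)) p.2.2 X₂) = a₂ at *
  rw [flatForm_comm] at n1A n2A
  simp only [prodForm, flatForm_smul_left, flatForm_smul_right, flatForm_add_right,
    flatForm_add_left, flatForm_sub_left, flatForm_neg_left, u1, u2, n1A, n2A, n1Y, n2Y]
  -- What remains stems from `d N_s / ds = -c h_s` in both factors, and such position vectors are
  -- orthogonal to the tangent vectors of `f`.
  linear_combination Real.sin (θ p.1) * r * Real.cos (θ p.1) *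
      (s1 + t * Real.cos (θ p.1) * t1) -
    Real.sin (θ p.1) * r * Real.cos (θ p.1) * (s2 + t * Real.sin (θ p.1) * t2)

theorem prodForm_diffMap_pos (D : AngleData J₁ J₂ c₁ c₂ h Nh g Ng δ θ)
    (p : symmInterval δ × M₁ × M₂)
    (X : TangentSpace (𝓘(ℝ, ℝ).prod (J₁.prod J₂)) p) (hX : X ≠ 0) :
    0 < prodForm c₁ c₂
      (diffMap (𝓘(ℝ, ℝ).prod (J₁.prod J₂)) (angleMap c₁ c₂ h Nh g Ng δ θ) p X)
      (diffMap (𝓘(ℝ, ℝ).prod (J₁.prod J₂)) (angleMap c₁ c₂ h Nh g Ng δ θ) p X) :=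
  prodForm_pos c₁ c₂ (D.isProductImmersion.mem p) (D.diffMap_mem p X)
    fun h0 => hX (D.isProductImmersion.injective_diff p (h0.trans (map_zero _).symm))

theorem shapeOperator_eq (D : AngleData J₁ J₂ c₁ c₂ h Nh g Ng δ θ)
    [FiniteDimensional ℝ E₁] [FiniteDimensional ℝ E₂]
    (hd₁ : Module.finrank ℝ E₁ + 1 = m₁) (hd₂ : Module.finrank ℝ E₂ + 1 = m₂)
    (p : symmInterval δ × M₁ × M₂) :
    shapeOperator (𝓘(ℝ, ℝ).prod (J₁.prod J₂)) (prodForm c₁ c₂) (angleMap c₁ c₂ h Nh g Ng δ θ)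
      (angleNormal c₁ c₂ h Nh g Ng δ θ) p =
      blockDiag J₁ J₂ p (deriv θ p.1)
        ((-Real.sin (θ p.1)) • shapeOperator J₁ (flatForm c₁)
          (parallelMap c₁ h Nh (intCos θ p.1)) (parallelNormal c₁ h Nh (intCos θ p.1)) p.2.1)
        (Real.cos (θ p.1) • shapeOperator J₂ (flatForm c₂)
          (parallelMap c₂ g Ng (intSin θ p.1)) (parallelNormal c₂ g Ng (intSin θ p.1)) p.2.2) :=
  IsShapeOperator.eq (prodFormL c₁ c₂ m₁ m₂) (fun _ _ => rfl) (D.prodForm_diffMap_pos p)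
    (D.isShapeOperator hd₁ hd₂ p)

/-- The mean curvature of the angle map. -/
theorem meanCurvature_eq (D : AngleData J₁ J₂ c₁ c₂ h Nh g Ng δ θ)
    [FiniteDimensional ℝ E₁] [FiniteDimensional ℝ E₂]
    (hd₁ : Module.finrank ℝ E₁ + 1 = m₁) (hd₂ : Module.finrank ℝ E₂ + 1 = m₂)
    (hE₁ : 0 < Module.finrank ℝ E₁) (hE₂ : 0 < Module.finrank ℝ E₂)
    (p : symmInterval δ × M₁ × M₂) :
    (1 + (Module.finrank ℝ E₁ + Module.finrank ℝ E₂) : ℝ) *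
        meanCurvature (𝓘(ℝ, ℝ).prod (J₁.prod J₂)) (prodForm c₁ c₂)
          (angleMap c₁ c₂ h Nh g Ng δ θ) (angleNormal c₁ c₂ h Nh g Ng δ θ) p =
      deriv θ p.1 - Module.finrank ℝ E₁ * Real.sin (θ p.1) *
          meanCurvature J₁ (flatForm c₁) (parallelMap c₁ h Nh (intCos θ p.1))
            (parallelNormal c₁ h Nh (intCos θ p.1)) p.2.1
        + Module.finrank ℝ E₂ * Real.cos (θ p.1) *
          meanCurvature J₂ (flatForm c₂) (parallelMap c₂ g Ng (intSin θ p.1))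
            (parallelNormal c₂ g Ng (intSin θ p.1)) p.2.2 := by
  have hE₁' : (Module.finrank ℝ E₁ : ℝ) ≠ 0 := by positivity
  have hE₂' : (Module.finrank ℝ E₂ : ℝ) ≠ 0 := by positivity
  rw [meanCurvature, D.shapeOperator_eq hd₁ hd₂, trace_blockDiag, map_smul, map_smul,
    Module.finrank_prod, Module.finrank_prod, Module.finrank_self, meanCurvature, meanCurvature]
  push_cast
  have : (1 + (Module.finrank ℝ E₁ + Module.finrank ℝ E₂) : ℝ) ≠ 0 := by positivity
  simp only [smul_eq_mul]
  field_simp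
  ring

/-- The witness for `R` has scalar blocks `sin² θ`, `0`, `1`, and these commute with the blocks of
the shape operator. -/
theorem inClassA (D : AngleData J₁ J₂ c₁ c₂ h Nh g Ng δ θ)
    [FiniteDimensional ℝ E₁] [FiniteDimensional ℝ E₂]
    (hd₁ : Module.finrank ℝ E₁ + 1 = m₁) (hd₂ : Module.finrank ℝ E₂ + 1 = m₂) :
    InClassA (𝓘(ℝ, ℝ).prod (J₁.prod J₂)) c₁ c₂ (angleMap c₁ c₂ h Nh g Ng δ θ) := by
  refine fun p₀ => ⟨Set.univ, isOpen_univ, trivial, angleNormal c₁ c₂ h Nh g Ng δ θ,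
    D.isUnitNormalOn, fun p _ => ⟨blockDiag J₁ J₂ p (Real.sin (θ p.1) ^ 2) 0 LinearMap.id,
      ?_, ?_⟩⟩
  · intro X
    obtain ⟨r, X₁, X₂, rfl⟩ := exists_eq_tvec p X
    rw [blockDiag_apply]
    have e1 := D.diffMap_tvec p r X₁ X₂
    have e2 := D.diffMap_tvec p (Real.sin (θ p.1) ^ 2 * r)
      ((0 : TangentSpace J₁ p.2.1 →ₗ[ℝ] TangentSpace J₁ p.2.1) X₁) X₂
    have n2 := (D.normal_parallel₂ (intSin θ p.1)).normal p.2.2 trivial X₂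
    have u2 := (D.normal_parallel₂ (intSin θ p.1)).unit p.2.2 trivial
    rw [LinearMap.id_apply, e1, e2]
    rw [LinearMap.zero_apply, map_zero]
    rw [flatForm_comm] at n2
    simp only [prodForm, angleNormal, flatForm_zero_left, flatForm_add_left, flatForm_smul_left,
      flatForm_smul_right, n2, u2]
    refine Prod.ext ?_ ?_
    · simp only [Prod.fst_add, Prod.smul_fst]
      module
    · simp only [Prod.snd_add, Prod.smul_snd]
      have := Real.cos_sq' (θ p.1)
      -- The second component of `π₂ ∂_s f = sin² θ ∂_s f + sin θ cos θ N`.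
      have e : r * Real.sin (θ p.1) = Real.sin (θ p.1) ^ 2 * r * Real.sin (θ p.1) +
          (r * Real.sin (θ p.1) * Real.cos (θ p.1)) * Real.cos (θ p.1) := by
        linear_combination (-r * Real.sin (θ p.1)) * this
      nth_rewrite 1 [e]
      module
  · rw [D.shapeOperator_eq hd₁ hd₂]
    refine LinearMap.ext fun X => ?_
    obtain ⟨r, X₁, X₂, rfl⟩ := exists_eq_tvec p X
    rw [Module.End.mul_apply, Module.End.mul_apply]
    simp only [blockDiag_apply]
    simp [mul_left_comm]

end AngleData

end AngleShape


/-! ### Splitting and the vanishing of a component of the unit normal. -/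

section NowhereSplits

variable {E : Type*} [NormedAddCommGroup E] [NormedSpace ℝ E]
  {H : Type*} [TopologicalSpace H] {J : ModelWithCorners ℝ E H}
  {M : Type*} [TopologicalSpace M] [ChartedSpace H M]
  {E₁ : Type*} [NormedAddCommGroup E₁] [NormedSpace ℝ E₁]
  {H₁ : Type*} [TopologicalSpace H₁] {J₁ : ModelWithCorners ℝ E₁ H₁}
  {M₁ : Type*} [TopologicalSpace M₁] [ChartedSpace H₁ M₁]
  {E₂ : Type*} [NormedAddCommGroup E₂] [NormedSpace ℝ E₂]
  {H₂ : Type*} [TopologicalSpace H₂] {J₂ : ModelWithCorners ℝ E₂ H₂}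
  {M₂ : Type*} [TopologicalSpace M₂] [ChartedSpace H₂ M₂]
  {c₁ c₂ : ℝ} {m₁ m₂ : ℕ}

/-- A tangent vector of a space form that is orthogonal to an immersed open subset vanishes. -/
theorem eq_zero_of_orthogonal [FiniteDimensional ℝ E] {c : ℝ} {m : ℕ} {i : M → Ambient c m}
    (hi : IsImmersionInto J (spaceForm c m) i) (hdim : Module.finrank ℝ E = m) (x : M)
    {v : Ambient c m} (hv : v ∈ spaceFormTangent c (i x))
    (h : ∀ X : TangentSpace J x, flatForm c v (diffMap J i x X) = 0) : v = 0 := by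
  let G : TangentSpace J x →ₗ[ℝ] tangentSub c (i x) :=
    (diffMap J i x).toLinearMap.codRestrict _ (hi.diffMap_mem x)
  have hG : Function.Injective G := fun X Y hXY =>
    hi.injective_diff x (congrArg Subtype.val hXY)
  have hs : Function.Surjective G :=
    (LinearMap.injective_iff_surjective_of_finrank_eq_finrank
      (hdim.trans (finrank_tangentSub c (hi.mem x)).symm)).1 hG
  obtain ⟨X, hX⟩ := hs ⟨v, hv⟩
  have hX' : diffMap J i x X = v := congrArg Subtype.val hX
  by_contra h0
  have := h X
  rw [hX'] at this
  exact (flatForm_pos c (hi.mem x) hv h0).ne' this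

theorem hasDiff_prodMap_inl {V W : Type*} [NormedAddCommGroup V] [NormedSpace ℝ V]
    [NormedAddCommGroup W] [NormedSpace ℝ W] {f : M → V × W} {Φ : M₁ × M₂ → M} {u : M₁ × M₂}
    (hf : MDifferentiableAt J 𝓘(ℝ, V × W) f (Φ u))
    (hΦ : MDifferentiableAt (J₁.prod J₂) J Φ u) {f₁ : M₁ → V} {f₂ : M₂ → W}
    (hf₁ : MDifferentiableAt J₁ 𝓘(ℝ, V) f₁ u.1) (hf₂ : MDifferentiableAt J₂ 𝓘(ℝ, W) f₂ u.2)
    (h : ∀ u, f (Φ u) = (f₁ u.1, f₂ u.2)) (X : TangentSpace (J₁.prod J₂) u) :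
    diffMap J f (Φ u) (mfderiv (J₁.prod J₂) J Φ u X) =
      (diffMap J₁ f₁ u.1 X.1, diffMap J₂ f₂ u.2 X.2) := by
  have e1 := hf.hasDiff.comp_mfderiv hΦ.hasMFDerivAt
  have e2 : HasDiff (J₁.prod J₂) (fun z : M₁ × M₂ => (f₁ z.1, f₂ z.2)) u _ :=
    (hf₁.hasDiff.comp_mfderiv (hasMFDerivAt_fst (I := J₁) (I' := J₂) u)).prodMk
      (hf₂.hasDiff.comp_mfderiv (hasMFDerivAt_snd (I := J₁) (I' := J₂) u))
  have e3 : (fun z => f (Φ z)) = fun z : M₁ × M₂ => (f₁ z.1, f₂ z.2) := funext h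
  rw [e3] at e1
  exact DFunLike.congr_fun (e1.unique e2) X

variable {f N : M → Ambient c₁ m₁ × Ambient c₂ m₂} {U : Set M}

/-- The vectors `(0, di₂ X)` are tangent to `f`, hence orthogonal to the normal; by equality of
dimensions they fill the tangent space of the second factor. -/
theorem normal_snd_eq_zero_of_split [FiniteDimensional ℝ E₂]
    (hf : IsProductImmersion J c₁ c₂ f)
    (hN : IsUnitNormalOn J (prodForm c₁ c₂) (prodTangent c₁ c₂) f N U)
    {Φ : M₁ × M₂ → M} (hΦ : ContMDiff (J₁.prod J₂) J ∞ Φ)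
    {f₁ : M₁ → Ambient c₁ m₁} {i₂ : M₂ → Ambient c₂ m₂}
    (hf₁ : IsImmersionInto J₁ (spaceForm c₁ m₁) f₁)
    (hi₂ : IsImmersionInto J₂ (spaceForm c₂ m₂) i₂) (hdim : Module.finrank ℝ E₂ = m₂)
    (h : ∀ u, f (Φ u) = (f₁ u.1, i₂ u.2)) (u : M₁ × M₂) (hu : Φ u ∈ U) : (N (Φ u)).2 = 0 := by
  have ht := (hN.tangent _ hu).2
  rw [h u] at ht
  refine eq_zero_of_orthogonal hi₂ hdim u.2 ht fun X => ?_
  have e := hasDiff_prodMap_inl (J := J) (J₁ := J₁) (J₂ := J₂)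
    (hf.smooth.mdifferentiableAt (by simp)) (hΦ.mdifferentiableAt (by simp) (x := u))
    (hf₁.smooth.mdifferentiableAt (by simp)) (hi₂.smooth.mdifferentiableAt (by simp)) h
    ((0, X) : TangentSpace J₁ u.1 × TangentSpace J₂ u.2)
  have hn := hN.normal _ hu (mfderiv (J₁.prod J₂) J Φ u
    ((0, X) : TangentSpace J₁ u.1 × TangentSpace J₂ u.2))
  rw [e, prodForm] at hn
  simpa using hn

theorem normal_fst_eq_zero_of_split [FiniteDimensional ℝ E₁]
    (hf : IsProductImmersion J c₁ c₂ f)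
    (hN : IsUnitNormalOn J (prodForm c₁ c₂) (prodTangent c₁ c₂) f N U)
    {Φ : M₁ × M₂ → M} (hΦ : ContMDiff (J₁.prod J₂) J ∞ Φ)
    {i₁ : M₁ → Ambient c₁ m₁} {f₂ : M₂ → Ambient c₂ m₂}
    (hi₁ : IsImmersionInto J₁ (spaceForm c₁ m₁) i₁) (hdim : Module.finrank ℝ E₁ = m₁)
    (hf₂ : IsImmersionInto J₂ (spaceForm c₂ m₂) f₂)
    (h : ∀ u, f (Φ u) = (i₁ u.1, f₂ u.2)) (u : M₁ × M₂) (hu : Φ u ∈ U) : (N (Φ u)).1 = 0 := by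
  have ht := (hN.tangent _ hu).1
  rw [h u] at ht
  refine eq_zero_of_orthogonal hi₁ hdim u.1 ht fun X => ?_
  have e := hasDiff_prodMap_inl (J := J) (J₁ := J₁) (J₂ := J₂)
    (hf.smooth.mdifferentiableAt (by simp)) (hΦ.mdifferentiableAt (by simp) (x := u))
    (hi₁.smooth.mdifferentiableAt (by simp)) (hf₂.smooth.mdifferentiableAt (by simp)) h
    ((X, 0) : TangentSpace J₁ u.1 × TangentSpace J₂ u.2)
  have hn := hN.normal _ hu (mfderiv (J₁.prod J₂) J Φ u
    ((X, 0) : TangentSpace J₁ u.1 × TangentSpace J₂ u.2))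
  rw [e, prodForm] at hn
  simpa using hn

/-- On an open set on which it splits, a hypersurface has a unit normal tangent to a factor. -/
theorem SplitsOn.normal_eq_zero (hf : IsProductImmersion J c₁ c₂ f)
    (hN : IsUnitNormalOn J (prodForm c₁ c₂) (prodTangent c₁ c₂) f N Set.univ) {W : Set M}
    (hW : SplitsOn J c₁ c₂ f W) : (∀ x ∈ W, (N x).2 = 0) ∨ ∀ x ∈ W, (N x).1 = 0 := by
  rcases hW with ⟨U₁, U₂, Φ, f₁, i₂, hΦ, rfl, hf₁, hi₂, -, h⟩
      | ⟨U₁, U₂, Φ, i₁, f₂, hΦ, rfl, hi₁, -, hf₂, h⟩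
  · left
    rintro _ ⟨u, rfl⟩
    exact normal_snd_eq_zero_of_split hf hN hΦ.smooth hf₁ hi₂ (by simp) h u trivial
  · right
    rintro _ ⟨u, rfl⟩
    exact normal_fst_eq_zero_of_split hf hN hΦ.smooth hi₁ (by simp) hf₂ h u trivial

/-- Where `f` splits, `cos θ` or `sin θ` vanishes. The projection of an open set to the interval is
open, so this would put an open set into the exceptional set of parameters. -/
theorem AngleData.nowhereSplits {h Nh : M₁ → Ambient c₁ m₁} {g Ng : M₂ → Ambient c₂ m₂}
    {δ : ℝ} {θ : ℝ → ℝ} (D : AngleData J₁ J₂ c₁ c₂ h Nh g Ng δ θ)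
    (hθ : interior {s | s ∈ Set.Ioo (-δ) δ ∧ ∃ j : ℤ, θ s = j * (Real.pi / 2)} = ∅) :
    NowhereSplits (𝓘(ℝ, ℝ).prod (J₁.prod J₂)) c₁ c₂ (angleMap c₁ c₂ h Nh g Ng δ θ) := by
  intro W hW hne hsplit
  have hU : IsOpen (Subtype.val '' (Prod.fst '' W) : Set ℝ) :=
    (symmInterval δ).2.isOpenMap_subtype_val _ (isOpenMap_fst _ hW)
  have hsub : (Subtype.val '' (Prod.fst '' W) : Set ℝ) ⊆
      {s | s ∈ Set.Ioo (-δ) δ ∧ ∃ j : ℤ, θ s = j * (Real.pi / 2)} := by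
    rintro _ ⟨_, ⟨p, hp, rfl⟩, rfl⟩
    refine ⟨p.1.2, ?_⟩
    have u1 := (D.normal_parallel₁ (intCos θ p.1)).unit p.2.1 trivial
    have u2 := (D.normal_parallel₂ (intSin θ p.1)).unit p.2.2 trivial
    rcases hsplit.normal_eq_zero D.isProductImmersion D.isUnitNormalOn with h0 | h0
    · have h1 := congrArg (fun v => flatForm c₂ v (parallelNormal c₂ g Ng (intSin θ p.1) p.2.2))
        (h0 p hp)
      simp only [angleNormal, flatForm_smul_left, u2, flatForm_zero_left, mul_one] at h1
      obtain ⟨j, hj⟩ := Real.cos_eq_zero_iff.1 h1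
      exact ⟨2 * j + 1, by rw [hj]; push_cast; ring⟩
    · have h1 := congrArg (fun v => flatForm c₁ v (parallelNormal c₁ h Nh (intCos θ p.1) p.2.1))
        (h0 p hp)
      simp only [angleNormal, flatForm_smul_left, u1, flatForm_zero_left, mul_one,
        neg_eq_zero] at h1
      obtain ⟨j, hj⟩ := Real.sin_eq_zero_iff.1 h1
      exact ⟨2 * j, by rw [← hj]; push_cast; ring⟩
  have := interior_maximal hsub hU
  rw [hθ, Set.subset_empty_iff, Set.image_eq_empty, Set.image_eq_empty] at this
  exact hne.ne_empty this

end NowhereSplits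

/-! ### The direct statement. -/

theorem direct_statement (n k : ℕ) (hk : 2 ≤ k) (hkn : k + 1 ≤ n) (c₁ c₂ 𝓗 : ℝ)
    (M₁ : Type*) [TopologicalSpace M₁] [ChartedSpace (EuclideanSpace ℝ (Fin (k - 1))) M₁]
    (M₂ : Type*) [TopologicalSpace M₂] [ChartedSpace (EuclideanSpace ℝ (Fin (n - k))) M₂]
    (h Nh : M₁ → Ambient c₁ k) (g Ng : M₂ → Ambient c₂ (n - k + 1)) (δ : ℝ)
    (hh : IsIsoparametric (𝓡 (k - 1)) c₁ h Nh) (hg : IsIsoparametric (𝓡 (n - k)) c₂ g Ng)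
    (hpar₁ : ParallelImmersions (𝓡 (k - 1)) c₁ h Nh δ)
    (hpar₂ : ParallelImmersions (𝓡 (n - k)) c₂ g Ng δ) :
    (∃ Hh, ParallelMeanCurvature (𝓡 (k - 1)) c₁ h Nh δ Hh) ∧
    (∃ Hg, ParallelMeanCurvature (𝓡 (n - k)) c₂ g Ng δ Hg) ∧
    ∀ Hh Hg θ : ℝ → ℝ,
      ParallelMeanCurvature (𝓡 (k - 1)) c₁ h Nh δ Hh →
      ParallelMeanCurvature (𝓡 (n - k)) c₂ g Ng δ Hg →
      IsAngleSolution n k 𝓗 δ Hh Hg θ →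
      IsProductImmersion (𝓘(ℝ, ℝ).prod ((𝓡 (k - 1)).prod (𝓡 (n - k)))) c₁ c₂
        (angleMap c₁ c₂ h Nh g Ng δ θ) ∧
      HasConstantMeanCurvature (𝓘(ℝ, ℝ).prod ((𝓡 (k - 1)).prod (𝓡 (n - k)))) c₁ c₂
        (angleMap c₁ c₂ h Nh g Ng δ θ) 𝓗 ∧
      InClassA (𝓘(ℝ, ℝ).prod ((𝓡 (k - 1)).prod (𝓡 (n - k)))) c₁ c₂
        (angleMap c₁ c₂ h Nh g Ng δ θ) ∧
      NowhereSplits (𝓘(ℝ, ℝ).prod ((𝓡 (k - 1)).prod (𝓡 (n - k)))) c₁ c₂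
        (angleMap c₁ c₂ h Nh g Ng δ θ) := by
  have d1 : Module.finrank ℝ (EuclideanSpace ℝ (Fin (k - 1))) + 1 = k := by
    rw [finrank_euclideanSpace_fin]
    omega
  have d2 : Module.finrank ℝ (EuclideanSpace ℝ (Fin (n - k))) + 1 = n - k + 1 := by
    rw [finrank_euclideanSpace_fin]
  have e1 : 0 < Module.finrank ℝ (EuclideanSpace ℝ (Fin (k - 1))) := by omega
  have e2 : 0 < Module.finrank ℝ (EuclideanSpace ℝ (Fin (n - k))) := by
    rw [finrank_euclideanSpace_fin]
    omega
  refine ⟨exists_parallelMeanCurvature d1 e1 hh hpar₁, exists_parallelMeanCurvature d2 e2 hg hpar₂,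
    fun Hh Hg θ hHh hHg hθ => ?_⟩
  have D : AngleData (𝓡 (k - 1)) (𝓡 (n - k)) c₁ c₂ h Nh g Ng δ θ :=
    ⟨hh.immersion, hh.unitNormal, hg.immersion, hg.unitNormal, hpar₁, hpar₂, hθ.smooth⟩
  refine ⟨D.isProductImmersion, fun p₀ => ⟨Set.univ, isOpen_univ, trivial, _, D.isUnitNormalOn,
    fun p _ => ?_⟩, D.inClassA d1 d2, D.nowhereSplits hθ.interior_empty⟩
  have hm := D.meanCurvature_eq d1 d2 e1 e2 p
  -- The constants apply at the times `a(s)` and `b(s)` because these lie in `(-δ, δ)`.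
  rw [hHh _ (intCos_mem p.1.2), hHg _ (intSin_mem p.1.2)] at hm
  have ho := hθ.ode p.1 p.1.2
  have f1 : (Module.finrank ℝ (EuclideanSpace ℝ (Fin (k - 1))) : ℝ) = (k : ℝ) - 1 := by
    rw [finrank_euclideanSpace_fin, Nat.cast_sub (by omega), Nat.cast_one]
  have f2 : (Module.finrank ℝ (EuclideanSpace ℝ (Fin (n - k))) : ℝ) = (n : ℝ) - k := by
    rw [finrank_euclideanSpace_fin, Nat.cast_sub (by omega)]
  rw [f1, f2, ho] at hm
  have hn : (n : ℝ) ≠ 0 := by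
    have : n ≠ 0 := by omega
    exact_mod_cast this
  refine mul_left_cancel₀ hn ?_
  rw [← hm]
  ring


/-! ### Pointwise data of a hypersurface of a product of space forms -/

section PointData

variable {E : Type*} [AddCommGroup E] [Module ℝ E] [TopologicalSpace E]
  {c₁ c₂ : ℝ} {m₁ m₂ : ℕ}

/-- The position `(p₁, p₂)`, the unit normal `(N₁, N₂)` and their differentials `(L₁, L₂)`,
`(K₁, K₂)` at a point of a hypersurface of a product of space forms. -/
structure PointData (p₁ N₁ : Ambient c₁ m₁) (p₂ N₂ : Ambient c₂ m₂)
    (L₁ K₁ : E →L[ℝ] Ambient c₁ m₁) (L₂ K₂ : E →L[ℝ] Ambient c₂ m₂) : Prop where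
  mem₁ : p₁ ∈ spaceForm c₁ m₁
  mem₂ : p₂ ∈ spaceForm c₂ m₂
  tangent₁ : N₁ ∈ spaceFormTangent c₁ p₁
  tangent₂ : N₂ ∈ spaceFormTangent c₂ p₂
  unit : flatForm c₁ N₁ N₁ + flatForm c₂ N₂ N₂ = 1
  normal : ∀ X, flatForm c₁ N₁ (L₁ X) + flatForm c₂ N₂ (L₂ X) = 0
  diff_mem₁ : ∀ X, L₁ X ∈ spaceFormTangent c₁ p₁
  diff_mem₂ : ∀ X, L₂ X ∈ spaceFormTangent c₂ p₂
  inj : ∀ X, L₁ X = 0 → L₂ X = 0 → X = 0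
  onto : ∀ w₁ ∈ spaceFormTangent c₁ p₁, ∀ w₂ ∈ spaceFormTangent c₂ p₂,
    flatForm c₁ N₁ w₁ + flatForm c₂ N₂ w₂ = 0 → ∃ X, L₁ X = w₁ ∧ L₂ X = w₂
  unit_diff : ∀ X, flatForm c₁ N₁ (K₁ X) + flatForm c₂ N₂ (K₂ X) = 0
  tangent_diff₁ : c₁ ≠ 0 → ∀ X, flatForm c₁ p₁ (K₁ X) + flatForm c₁ (L₁ X) N₁ = 0
  tangent_diff₂ : c₂ ≠ 0 → ∀ X, flatForm c₂ p₂ (K₂ X) + flatForm c₂ (L₂ X) N₂ = 0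

variable {p₁ N₁ : Ambient c₁ m₁} {p₂ N₂ : Ambient c₂ m₂}
    {L₁ K₁ : E →L[ℝ] Ambient c₁ m₁} {L₂ K₂ : E →L[ℝ] Ambient c₂ m₂}

/-- The two factors play the same role, so each one-sided statement serves twice. -/
theorem PointData.swap (P : PointData p₁ N₁ p₂ N₂ L₁ K₁ L₂ K₂) :
    PointData p₂ N₂ p₁ N₁ L₂ K₂ L₁ K₁ where
  mem₁ := P.mem₂
  mem₂ := P.mem₁
  tangent₁ := P.tangent₂
  tangent₂ := P.tangent₁
  unit := (add_comm _ _).trans P.unit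
  normal X := (add_comm _ _).trans (P.normal X)
  diff_mem₁ := P.diff_mem₂
  diff_mem₂ := P.diff_mem₁
  inj X h1 h2 := P.inj X h2 h1
  onto w₁ h₁ w₂ h₂ h := by
    obtain ⟨X, h3, h4⟩ := P.onto w₂ h₂ w₁ h₁ ((add_comm _ _).trans h)
    exact ⟨X, h4, h3⟩
  unit_diff X := (add_comm _ _).trans (P.unit_diff X)
  tangent_diff₁ := P.tangent_diff₂
  tangent_diff₂ := P.tangent_diff₁

/-- If the shape operator preserves the kernel of the differential of the second component, then
the second component of the unit normal is constant along it. -/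
theorem PointData.normal_diff_eq_zero (P : PointData p₁ N₁ p₂ N₂ L₁ K₁ L₂ K₂) (hN₁ : N₁ ≠ 0)
    {A : E → E}
    (hA : ∀ X Y, flatForm c₁ (L₁ (A X)) (L₁ Y) + flatForm c₂ (L₂ (A X)) (L₂ Y) =
      -(flatForm c₁ (K₁ X) (L₁ Y) + flatForm c₂ (K₂ X) (L₂ Y)))
    (hker : ∀ X, L₂ X = 0 → L₂ (A X) = 0) {X : E} (hX : L₂ X = 0) : K₂ X = 0 := by
  have hp := flatForm_pos c₁ P.mem₁ P.tangent₁ hN₁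
  have hAX := hker X hX
  have hn := P.normal (A X)
  rw [hAX, flatForm_zero_right, add_zero] at hn
  have hu := P.unit_diff X
  have key : ∀ w ∈ spaceFormTangent c₂ p₂, flatForm c₁ N₁ N₁ * flatForm c₂ (K₂ X) w =
      -(flatForm c₂ N₂ w * flatForm c₂ N₂ (K₂ X)) := by
    intro w hw
    -- The vector `|N₁|² (0, w)` is corrected by a multiple of `(N₁, 0)` to become orthogonal to
    -- `N`. The correction does not see `A X`, whose image lies in the first factor and is
    -- orthogonal to `N₁`.
    obtain ⟨Y, hY1, hY2⟩ := P.onto (-(flatForm c₂ N₂ w) • N₁)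
      ((tangentSub c₁ p₁).smul_mem _ P.tangent₁) (flatForm c₁ N₁ N₁ • w)
      ((tangentSub c₂ p₂).smul_mem _ hw) (by
        rw [flatForm_smul_right, flatForm_smul_right]
        ring)
    have h := hA X Y
    rw [hAX, hY1, hY2] at h
    simp only [flatForm_smul_right, flatForm_zero_left, flatForm_comm c₁ _ N₁, hn] at h
    linear_combination h + flatForm c₂ N₂ w * hu
  -- Testing with `w = N₂` and using `|N₁|² + |N₂|² = 1`.
  have h0 : flatForm c₂ N₂ (K₂ X) = 0 := by
    have h1 := key N₂ P.tangent₂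
    rw [flatForm_comm c₂ (K₂ X)] at h1
    linear_combination h1 - flatForm c₂ N₂ (K₂ X) * P.unit
  have hT : K₂ X ∈ spaceFormTangent c₂ p₂ := by
    intro hc
    have := P.tangent_diff₂ hc X
    rwa [hX, flatForm_zero_left, add_zero] at this
  by_contra hne
  -- Testing with `w = K₂ X` gives `|N₁|² |K₂ X|² = 0`.
  have h2 := key (K₂ X) hT
  rw [h0, mul_zero, neg_zero] at h2
  exact (mul_pos hp (flatForm_pos c₂ P.mem₂ hT hne)).ne' h2

/-- The eigenspaces of the product tensor are preserved by operators commuting with it. -/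
theorem PointData.ker_of_commute (P : PointData p₁ N₁ p₂ N₂ L₁ K₁ L₂ K₂) (hN₁ : N₁ ≠ 0)
    (hN₂ : N₂ ≠ 0) {A R : E →ₗ[ℝ] E} (hR₁ : ∀ X, L₁ (R X) = -(flatForm c₂ (L₂ X) N₂) • N₁)
    (hR₂ : ∀ X, L₂ X = L₂ (R X) + flatForm c₂ (L₂ X) N₂ • N₂) (hAR : Commute A R) :
    (∀ X, L₂ X = 0 → L₂ (A X) = 0) ∧ ∀ X, L₁ X = 0 → L₁ (A X) = 0 := by
  have hcomm : ∀ X, A (R X) = R (A X) := fun X => LinearMap.congr_fun hAR X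
  constructor
  · intro X hX
    -- The kernel of `L₂` is the eigenspace of `R` for `0`; the inclusion needed for `A X` uses `N₁
    -- ≠ 0`.
    have h1 : R X = 0 := by
      refine P.inj _ ?_ ?_
      · rw [hR₁, hX, flatForm_zero_left, neg_zero, zero_smul]
      · have := hR₂ X
        rw [hX, flatForm_zero_left, zero_smul, add_zero] at this
        exact this.symm
    have h2 : R (A X) = 0 := by rw [← hcomm, h1, map_zero]
    have h3 := hR₁ (A X)
    rw [h2, map_zero] at h3
    have h4 : flatForm c₂ (L₂ (A X)) N₂ = 0 := by
      rcases smul_eq_zero.1 h3.symm with h | h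
      · linarith
      · exact absurd h hN₁
    rw [hR₂ (A X), h2, map_zero, h4, zero_smul, add_zero]
  · intro X hX
    have h0 : flatForm c₂ (L₂ X) N₂ = 0 := by
      have := P.normal X
      rwa [hX, flatForm_zero_right, zero_add, flatForm_comm] at this
    -- The kernel of `L₁` is the eigenspace of `R` for `1`; the inclusion needed for `A X` uses `N₂
    -- ≠ 0`.
    have h1 : R X = X := by
      refine sub_eq_zero.1 (P.inj _ ?_ ?_)
      · rw [map_sub, hR₁, hX, h0, neg_zero, zero_smul, sub_zero]
      · have := hR₂ X
        rw [h0, zero_smul, add_zero] at this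
        rw [map_sub, ← this, sub_self]
    have h2 : R (A X) = A X := by rw [← hcomm, h1]
    have h3 := hR₁ (A X)
    have h4 := hR₂ (A X)
    rw [h2] at h3 h4
    have h5 : flatForm c₂ (L₂ (A X)) N₂ = 0 := by
      rcases smul_eq_zero.1 (left_eq_add.1 h4) with h | h
      · exact h
      · exact absurd h hN₂
    rw [h3, h5, neg_zero, zero_smul]

end PointData

theorem Submodule.finrank_prod {V W : Type*} [AddCommGroup V] [Module ℝ V] [AddCommGroup W]
    [Module ℝ W] [FiniteDimensional ℝ V] [FiniteDimensional ℝ W] (p : Submodule ℝ V)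
    (q : Submodule ℝ W) :
    Module.finrank ℝ (p.prod q) = Module.finrank ℝ p + Module.finrank ℝ q := by
  rw [← Module.finrank_prod]
  exact LinearEquiv.finrank_eq
    { toFun := fun v => (⟨v.1.1, v.2.1⟩, ⟨v.1.2, v.2.2⟩)
      invFun := fun v => ⟨(v.1.1, v.2.1), v.1.2, v.2.2⟩
      map_add' := fun _ _ => rfl
      map_smul' := fun _ _ => rfl
      left_inv := fun _ => rfl
      right_inv := fun _ => rfl }

/-! ### Point data from a map and its unit normal field. -/

section PointDataOf

variable {E : Type*} [NormedAddCommGroup E] [NormedSpace ℝ E] [FiniteDimensional ℝ E]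
  {H : Type*} [TopologicalSpace H] {J : ModelWithCorners ℝ E H}
  {M : Type*} [TopologicalSpace M] [ChartedSpace H M]
  {c₁ c₂ : ℝ} {m₁ m₂ : ℕ} {f N : M → Ambient c₁ m₁ × Ambient c₂ m₂} {x : M}

/-- The dimension count makes the image of the differential the full orthogonal complement of the
normal, which is the field `onto`; the last three fields differentiate constant scalar products. -/
theorem pointData_of_hasDiff {L K : TangentSpace J x →L[ℝ] Ambient c₁ m₁ × Ambient c₂ m₂}
    (hL : HasDiff J f x L) (hK : HasDiff J N x K)
    (hmem : ∀ᶠ y in nhds x, f y ∈ spaceForm c₁ m₁ ×ˢ spaceForm c₂ m₂)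
    (htan : ∀ᶠ y in nhds x, N y ∈ prodTangent c₁ c₂ (f y))
    (hunit : ∀ᶠ y in nhds x, prodForm c₁ c₂ (N y) (N y) = 1)
    (hnormal : ∀ X, prodForm c₁ c₂ (N x) (L X) = 0) (hinj : Function.Injective L)
    (hdim : m₁ + m₂ = Module.finrank ℝ E + 1) :
    PointData (f x).1 (N x).1 (f x).2 (N x).2
      ((ContinuousLinearMap.fst ℝ _ _).comp L) ((ContinuousLinearMap.fst ℝ _ _).comp K)
      ((ContinuousLinearMap.snd ℝ _ _).comp L) ((ContinuousLinearMap.snd ℝ _ _).comp K) := by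
  have hL1 := hL.fst.mem_spaceFormTangent (hmem.mono fun y hy => hy.1)
  have hL2 := hL.snd.mem_spaceFormTangent (hmem.mono fun y hy => hy.2)
  have hmx := hmem.self_of_nhds
  have htx := htan.self_of_nhds
  refine ⟨hmx.1, hmx.2, htx.1, htx.2, hunit.self_of_nhds, hnormal, hL1, hL2, ?_, ?_, ?_, ?_, ?_⟩
  · exact fun X h1 h2 => hinj ((Prod.ext h1 h2 : L X = 0).trans (map_zero L).symm)
  · intro w₁ h₁ w₂ h₂ h
    have hfin : Module.finrank ℝ ((tangentSub c₁ (f x).1).prod (tangentSub c₂ (f x).2)) =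
        Module.finrank ℝ (TangentSpace J x) + 1 := by
      rw [Submodule.finrank_prod, finrank_tangentSub c₁ hmx.1, finrank_tangentSub c₂ hmx.2]
      exact hdim
    obtain ⟨X, hX⟩ := exists_tangent_add_normal (E := TangentSpace J x)
      (prodFormL c₁ c₂ m₁ m₂).toLinearMap₁₂
      ((tangentSub c₁ (f x).1).prod (tangentSub c₂ (f x).2)) L.toLinearMap hinj
      (fun X => ⟨hL1 X, hL2 X⟩) hfin (N := N x) htx hunit.self_of_nhds hnormal
      (w := (w₁, w₂)) ⟨h₁, h₂⟩
    have h0 : (prodFormL c₁ c₂ m₁ m₂).toLinearMap₁₂ (N x) (w₁, w₂) = 0 := h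
    rw [h0, zero_smul, add_zero] at hX
    exact ⟨X, (congrArg Prod.fst hX).symm, (congrArg Prod.snd hX).symm⟩
  · intro X
    have := HasDiff.bilin_eq_zero (prodFormL c₁ c₂ m₁ m₂) hK hK hunit X
    simp only [prodFormL_apply, prodForm_comm c₁ c₂ (K X)] at this
    have h2 : prodForm c₁ c₂ (N x) (K X) = 0 := by linarith
    exact h2
  · intro hc X
    exact HasDiff.bilin_eq_zero (flatFormL c₁ m₁) hL.fst hK.fst (htan.mono fun y hy => hy.1 hc) X
  · intro hc X
    exact HasDiff.bilin_eq_zero (flatFormL c₂ m₂) hL.snd hK.snd (htan.mono fun y hy => hy.2 hc) X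

end PointDataOf


/-! ### Consequences of class `𝒜` for an arbitrary local unit normal. -/

section ClassA

variable {E : Type*} [NormedAddCommGroup E] [NormedSpace ℝ E] [FiniteDimensional ℝ E]
  {H : Type*} [TopologicalSpace H] {J : ModelWithCorners ℝ E H}
  {M : Type*} [TopologicalSpace M] [ChartedSpace H M]
  {c₁ c₂ : ℝ} {m₁ m₂ : ℕ} {f N N' : M → Ambient c₁ m₁ × Ambient c₂ m₂} {U : Set M} {x : M}

theorem IsUnitNormalOn.pointData (hf : IsProductImmersion J c₁ c₂ f)
    (hdim : m₁ + m₂ = Module.finrank ℝ E + 1)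
    (hN : IsUnitNormalOn J (prodForm c₁ c₂) (prodTangent c₁ c₂) f N U) (hU : U ∈ nhds x) :
    PointData (f x).1 (N x).1 (f x).2 (N x).2
      ((ContinuousLinearMap.fst ℝ _ _).comp (diffMap J f x))
      ((ContinuousLinearMap.fst ℝ _ _).comp (diffMap J N x))
      ((ContinuousLinearMap.snd ℝ _ _).comp (diffMap J f x))
      ((ContinuousLinearMap.snd ℝ _ _).comp (diffMap J N x)) :=
  pointData_of_hasDiff (hf.hasDiff x) (hN.hasDiff hU) (Filter.Eventually.of_forall hf.mem)
    (Filter.mem_of_superset hU hN.tangent) (Filter.mem_of_superset hU hN.unit)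
    (hN.normal x (mem_of_mem_nhds hU)) (hf.injective_diff x) hdim

/-- Unit normals are unique up to sign. -/
theorem IsUnitNormalOn.eq_smul (hf : IsProductImmersion J c₁ c₂ f)
    (hdim : m₁ + m₂ = Module.finrank ℝ E + 1) {U' : Set M}
    (hN : IsUnitNormalOn J (prodForm c₁ c₂) (prodTangent c₁ c₂) f N U) (hU : U ∈ nhds x)
    (hN' : IsUnitNormalOn J (prodForm c₁ c₂) (prodTangent c₁ c₂) f N' U') (hU' : U' ∈ nhds x) :
    N' x = prodForm c₁ c₂ (N x) (N' x) • N x ∧ prodForm c₁ c₂ (N x) (N' x) ^ 2 = 1 := by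
  have P := hN.pointData hf hdim hU
  have hx := mem_of_mem_nhds hU
  have hx' := mem_of_mem_nhds hU'
  set ε := prodForm c₁ c₂ (N x) (N' x) with hε
  set β := prodFormL c₁ c₂ m₁ m₂
  have hβ : ∀ v w, prodForm c₁ c₂ v w = β v w := fun _ _ => rfl
  have hu := hN.unit x hx
  have hu' := hN'.unit x hx'
  have ht := hN.tangent x hx
  have ht' := hN'.tangent x hx'
  have hw : N' x - ε • N x ∈ prodTangent c₁ c₂ (f x) :=
    ⟨(tangentSub c₁ _).sub_mem ht'.1 ((tangentSub c₁ _).smul_mem _ ht.1),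
      (tangentSub c₂ _).sub_mem ht'.2 ((tangentSub c₂ _).smul_mem _ ht.2)⟩
  have hNw : prodForm c₁ c₂ (N x) (N' x - ε • N x) = 0 := by
    rw [hβ, map_sub, map_smul, ← hβ, ← hβ, hu, ← hε]
    simp
  -- The vector `N' - ε N` is orthogonal to `N`, hence tangent to `f`, hence orthogonal to `N'` as
  -- well. So it is orthogonal to itself.
  obtain ⟨X, hX1, hX2⟩ := P.onto _ hw.1 _ hw.2 hNw
  have hX : diffMap J f x X = N' x - ε • N x := Prod.ext hX1 hX2
  have h0 : N' x - ε • N x = 0 := by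
    by_contra hne
    refine (prodForm_pos c₁ c₂ (hf.mem x) hw hne).ne' ?_
    have e : β (N' x - ε • N x) = β (N' x) - ε • β (N x) := by rw [map_sub, map_smul]
    have h1 := hN'.normal x hx' X
    rw [hX, hβ] at h1
    rw [hβ] at hNw
    rw [hβ, e, sub_apply, smul_apply, h1, hNw]
    simp
  have h1 := sub_eq_zero.1 h0
  refine ⟨h1, ?_⟩
  rw [h1, hβ] at hu'
  simp only [map_smul, smul_apply, smul_eq_mul] at hu'
  rw [← hβ, hu] at hu'
  linarith

/-- The scalar product of two unit normals is continuous with values `±1`, so it is locally constant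
and the normals also have proportional differentials. -/
theorem IsUnitNormalOn.eventually_eq_smul (hf : IsProductImmersion J c₁ c₂ f)
    (hdim : m₁ + m₂ = Module.finrank ℝ E + 1) {U' : Set M}
    (hN : IsUnitNormalOn J (prodForm c₁ c₂) (prodTangent c₁ c₂) f N U) (hU : IsOpen U)
    (hx : x ∈ U) (hN' : IsUnitNormalOn J (prodForm c₁ c₂) (prodTangent c₁ c₂) f N' U')
    (hU' : IsOpen U') (hx' : x ∈ U') :
    ∃ ε : ℝ, ε ≠ 0 ∧ N' =ᶠ[nhds x] fun y => ε • N y := by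
  have hcont : ContinuousAt (fun y => prodForm c₁ c₂ (N y) (N' y)) x := by
    have h1 := (hN.hasDiff (hU.mem_nhds hx)).1
    have h2 := (hN'.hasDiff (hU'.mem_nhds hx')).1
    exact ((prodFormL c₁ c₂ m₁ m₂).continuous.continuousAt.comp h1).clm_apply h2
  have hsq := (hN.eq_smul hf hdim (hU.mem_nhds hx) hN' (hU'.mem_nhds hx')).2
  refine ⟨prodForm c₁ c₂ (N x) (N' x), fun h0 => by simp [h0] at hsq, ?_⟩
  filter_upwards [hU.mem_nhds hx, hU'.mem_nhds hx',
    Metric.continuousAt_iff'.1 hcont 1 one_pos] with y hy hy' hd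
  obtain ⟨e, hsq'⟩ := hN.eq_smul hf hdim (hU.mem_nhds hy) hN' (hU'.mem_nhds hy')
  have : prodForm c₁ c₂ (N y) (N' y) = prodForm c₁ c₂ (N x) (N' x) := by
    rw [Real.dist_eq] at hd
    rcases sq_eq_sq_iff_eq_or_eq_neg.1 (hsq'.trans hsq.symm) with h | h
    · exact h
    · have hd' := abs_lt.1 hd
      rw [h] at hd'
      nlinarith [hd'.1, hd'.2]
  rw [← this]
  exact e

/-- In class `𝒜`, each component of the unit normal is constant along the kernel of the
differential of the corresponding component of the immersion. -/
theorem InClassA.normal_diff_eq_zero (hA : InClassA J c₁ c₂ f) (hf : IsProductImmersion J c₁ c₂ f)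
    (hdim : m₁ + m₂ = Module.finrank ℝ E + 1)
    (hN : IsUnitNormalOn J (prodForm c₁ c₂) (prodTangent c₁ c₂) f N U) (hU : IsOpen U)
    (hx : x ∈ U) (h₁ : (N x).1 ≠ 0) (h₂ : (N x).2 ≠ 0) (X : TangentSpace J x) :
    ((diffMap J f x X).2 = 0 → (diffMap J N x X).2 = 0) ∧
      ((diffMap J f x X).1 = 0 → (diffMap J N x X).1 = 0) := by
  obtain ⟨U', hU', hx', N', hN', hR⟩ := hA x
  obtain ⟨R, hR, hcomm⟩ := hR x hx'
  -- Class `𝒜` comes with its own unit normal `N'`; the locally constant sign transfers the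
  -- conclusion to `N`.
  obtain ⟨ε, hε, heq⟩ := hN.eventually_eq_smul hf hdim hU hx hN' hU' hx'
  have hx0 : N' x = ε • N x := heq.self_of_nhds
  have P := hN'.pointData hf hdim (hU'.mem_nhds hx')
  have hd : diffMap J N' x X = ε • diffMap J N x X := by
    have := ((hN.hasDiff (hU.mem_nhds hx)).clm (ε • ContinuousLinearMap.id ℝ _)).congr heq
    exact this.diffMap_apply X
  have h₁' : (N' x).1 ≠ 0 := by
    rw [hx0]
    exact smul_ne_zero hε h₁
  have h₂' : (N' x).2 ≠ 0 := by
    rw [hx0]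
    exact smul_ne_zero hε h₂
  have hpos : ∀ Y : TangentSpace J x, Y ≠ 0 →
      0 < prodForm c₁ c₂ (diffMap J f x Y) (diffMap J f x Y) := fun Y hY =>
    prodForm_pos c₁ c₂ (hf.mem x) ⟨P.diff_mem₁ Y, P.diff_mem₂ Y⟩
      fun h0 => hY (hf.injective_diff x (h0.trans (map_zero _).symm))
  have hS := isShapeOperator_shapeOperator (J := J) (prodFormL c₁ c₂ m₁ m₂)
    (B := prodForm c₁ c₂) (fun _ _ => rfl) (f := f) (N := N') (x := x) hpos
  set A := shapeOperator J (prodForm c₁ c₂) f N' x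
  have hκ : ∀ Y : TangentSpace J x, prodForm c₁ c₂ (0, (diffMap J f x Y).2) (N' x) =
      flatForm c₂ (diffMap J f x Y).2 (N' x).2 := fun Y => by simp [prodForm]
  obtain ⟨k1, k2⟩ := P.ker_of_commute h₁' h₂' (A := A) (R := R)
    (fun Y => by
      have := congrArg Prod.fst (hR Y)
      rw [hκ] at this
      simp only [Prod.fst_add, Prod.smul_fst] at this
      rw [neg_smul]
      exact eq_neg_of_add_eq_zero_left this.symm)
    (fun Y => by
      have := congrArg Prod.snd (hR Y)
      rw [hκ] at this
      exact this) hcomm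
  have hS' : ∀ Y Z : TangentSpace J x, flatForm c₁ (diffMap J f x (A Y)).1 (diffMap J f x Z).1 +
      flatForm c₂ (diffMap J f x (A Y)).2 (diffMap J f x Z).2 =
      -(flatForm c₁ (diffMap J N' x Y).1 (diffMap J f x Z).1 +
        flatForm c₂ (diffMap J N' x Y).2 (diffMap J f x Z).2) := hS
  constructor
  · intro hX
    have h0 : (diffMap J N' x X).2 = 0 := P.normal_diff_eq_zero h₁' (A := A) hS' k1 hX
    rw [hd] at h0
    exact (smul_eq_zero.1 h0).resolve_left hε
  · intro hX
    have h0 : (diffMap J N' x X).1 = 0 := P.swap.normal_diff_eq_zero h₂' (A := A)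
      (fun Y Z => by
        have := hS' Y Z
        rw [add_comm, add_comm (flatForm c₂ _ _)]
        exact this) k2 hX
    rw [hd] at h0
    exact (smul_eq_zero.1 h0).resolve_left hε

end ClassA


/-! ### The adapted frame at a point of a hypersurface in class `𝒜` -/

section Frame

variable {E : Type*} [AddCommGroup E] [Module ℝ E] [TopologicalSpace E]
  {c₁ c₂ : ℝ} {m₁ m₂ : ℕ}

/-- The unit normal is written as `(- p η₁, q η₂)` with unit vectors `η₁`, `η₂`; `D₁`, `D₂`, `p'`,
`q'` are the differentials of `η₁`, `η₂`, `p`, `q`. -/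
structure Frame (p₁ η₁ : Ambient c₁ m₁) (p₂ η₂ : Ambient c₂ m₂) (p q : ℝ)
    (L₁ D₁ : E →L[ℝ] Ambient c₁ m₁) (L₂ D₂ : E →L[ℝ] Ambient c₂ m₂)
    (p' q' : E →L[ℝ] ℝ) : Prop where
  mem₁ : p₁ ∈ spaceForm c₁ m₁
  mem₂ : p₂ ∈ spaceForm c₂ m₂
  tangent₁ : η₁ ∈ spaceFormTangent c₁ p₁
  tangent₂ : η₂ ∈ spaceFormTangent c₂ p₂
  unit₁ : flatForm c₁ η₁ η₁ = 1
  unit₂ : flatForm c₂ η₂ η₂ = 1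
  p_pos : 0 < p
  q_pos : 0 < q
  sq_add : p ^ 2 + q ^ 2 = 1
  normal : ∀ X, p * flatForm c₁ η₁ (L₁ X) = q * flatForm c₂ η₂ (L₂ X)
  diff_mem₁ : ∀ X, L₁ X ∈ spaceFormTangent c₁ p₁
  diff_mem₂ : ∀ X, L₂ X ∈ spaceFormTangent c₂ p₂
  inj : ∀ X, L₁ X = 0 → L₂ X = 0 → X = 0
  onto : ∀ w₁ ∈ spaceFormTangent c₁ p₁, ∀ w₂ ∈ spaceFormTangent c₂ p₂,
    p * flatForm c₁ η₁ w₁ = q * flatForm c₂ η₂ w₂ → ∃ X, L₁ X = w₁ ∧ L₂ X = w₂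
  unit_diff₁ : ∀ X, flatForm c₁ η₁ (D₁ X) = 0
  unit_diff₂ : ∀ X, flatForm c₂ η₂ (D₂ X) = 0
  tangent_diff₁ : c₁ ≠ 0 → ∀ X, flatForm c₁ p₁ (D₁ X) + flatForm c₁ (L₁ X) η₁ = 0
  tangent_diff₂ : c₂ ≠ 0 → ∀ X, flatForm c₂ p₂ (D₂ X) + flatForm c₂ (L₂ X) η₂ = 0
  sq_diff : ∀ X, p * p' X + q * q' X = 0
  const₁ : ∀ X, L₁ X = 0 → D₁ X = 0 ∧ p' X = 0
  const₂ : ∀ X, L₂ X = 0 → D₂ X = 0 ∧ q' X = 0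
  symm : ∀ X Y,
    flatForm c₁ (p • D₁ X + p' X • η₁) (L₁ Y) - flatForm c₂ (q • D₂ X + q' X • η₂) (L₂ Y) =
    flatForm c₁ (p • D₁ Y + p' Y • η₁) (L₁ X) - flatForm c₂ (q • D₂ Y + q' Y • η₂) (L₂ X)

namespace Frame

variable {p₁ η₁ : Ambient c₁ m₁} {p₂ η₂ : Ambient c₂ m₂} {p q : ℝ}
  {L₁ D₁ : E →L[ℝ] Ambient c₁ m₁} {L₂ D₂ : E →L[ℝ] Ambient c₂ m₂} {p' q' : E →L[ℝ] ℝ}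

theorem swap (F : Frame p₁ η₁ p₂ η₂ p q L₁ D₁ L₂ D₂ p' q') :
    Frame p₂ η₂ p₁ η₁ q p L₂ D₂ L₁ D₁ q' p' where
  mem₁ := F.mem₂
  mem₂ := F.mem₁
  tangent₁ := F.tangent₂
  tangent₂ := F.tangent₁
  unit₁ := F.unit₂
  unit₂ := F.unit₁
  p_pos := F.q_pos
  q_pos := F.p_pos
  sq_add := (add_comm _ _).trans F.sq_add
  normal X := (F.normal X).symm
  diff_mem₁ := F.diff_mem₂
  diff_mem₂ := F.diff_mem₁
  inj X h1 h2 := F.inj X h2 h1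
  onto w₁ h₁ w₂ h₂ h := by
    obtain ⟨X, h3, h4⟩ := F.onto w₂ h₂ w₁ h₁ h.symm
    exact ⟨X, h4, h3⟩
  unit_diff₁ := F.unit_diff₂
  unit_diff₂ := F.unit_diff₁
  tangent_diff₁ := F.tangent_diff₂
  tangent_diff₂ := F.tangent_diff₁
  sq_diff X := (add_comm _ _).trans (F.sq_diff X)
  const₁ := F.const₂
  const₂ := F.const₁
  symm X Y := by linarith [F.symm X Y]

variable (F : Frame p₁ η₁ p₂ η₂ p q L₁ D₁ L₂ D₂ p' q')

include F

/-- The component of a tangent vector along the distinguished direction. -/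
theorem alpha_eq (X : E) : flatForm c₁ η₁ (L₁ X) =
    q * (q * flatForm c₁ η₁ (L₁ X) + p * flatForm c₂ η₂ (L₂ X)) := by
  linear_combination (-flatForm c₁ η₁ (L₁ X)) * F.sq_add + p * F.normal X

theorem beta_eq (X : E) : flatForm c₂ η₂ (L₂ X) =
    p * (q * flatForm c₁ η₁ (L₁ X) + p * flatForm c₂ η₂ (L₂ X)) := by
  linear_combination (-flatForm c₂ η₂ (L₂ X)) * F.sq_add - q * F.normal X

/-- The pair `(q η₁, p η₂)` is orthogonal to the normal `(-p η₁, q η₂)`, so it is tangent to `f`. -/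
theorem exists_direction : ∃ Z, L₁ Z = q • η₁ ∧ L₂ Z = p • η₂ :=
  F.onto _ ((tangentSub c₁ p₁).smul_mem _ F.tangent₁) _
    ((tangentSub c₂ p₂).smul_mem _ F.tangent₂) (by
      rw [flatForm_smul_right, flatForm_smul_right, F.unit₁, F.unit₂]
      ring)

/-- Once the multiple of `Z` is subtracted, each component is orthogonal to its own `η`, so each
component by itself is tangent to `f`. -/
theorem exists_decomposition {Z : E} (hZ₁ : L₁ Z = q • η₁) (hZ₂ : L₂ Z = p • η₂) (X : E) :
    ∃ X₁ X₂, L₂ X₁ = 0 ∧ L₁ X₂ = 0 ∧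
      X = X₁ + X₂ + (q * flatForm c₁ η₁ (L₁ X) + p * flatForm c₂ η₂ (L₂ X)) • Z := by
  set r := q * flatForm c₁ η₁ (L₁ X) + p * flatForm c₂ η₂ (L₂ X) with hr
  have hα := F.alpha_eq X
  have hβ := F.beta_eq X
  rw [← hr] at hα hβ
  obtain ⟨X₁, h11, h12⟩ := F.onto (L₁ X - (r * q) • η₁)
    ((tangentSub c₁ p₁).sub_mem (F.diff_mem₁ X) ((tangentSub c₁ p₁).smul_mem _ F.tangent₁)) 0
    (tangentSub c₂ p₂).zero_mem (by
      rw [flatForm_sub_right, flatForm_smul_right, F.unit₁, flatForm_zero_right, hα]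
      ring)
  obtain ⟨X₂, h21, h22⟩ := F.onto 0 (tangentSub c₁ p₁).zero_mem (L₂ X - (r * p) • η₂)
    ((tangentSub c₂ p₂).sub_mem (F.diff_mem₂ X) ((tangentSub c₂ p₂).smul_mem _ F.tangent₂)) (by
      rw [flatForm_sub_right, flatForm_smul_right, F.unit₂, flatForm_zero_right, hβ]
      ring)
  refine ⟨X₁, X₂, h12, h21, sub_eq_zero.1 (F.inj _ ?_ ?_)⟩
  · rw [map_sub, map_add, map_add, map_smul, h11, h21, hZ₁]
    module
  · rw [map_sub, map_add, map_add, map_smul, h12, h22, hZ₂]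
    module

theorem alpha_eq_zero {X : E} (hX : L₂ X = 0) : flatForm c₁ η₁ (L₁ X) = 0 := by
  have := F.normal X
  rw [hX, flatForm_zero_right, mul_zero] at this
  exact (mul_eq_zero.1 this).resolve_left F.p_pos.ne'

/-- From `p² + q² = 1`, constancy of `p` along `ker L₁` is also constancy of `q`, so both lengths
are constant along both kernels. -/
theorem diff_q_eq_zero {X : E} (hX : L₁ X = 0) : q' X = 0 := by
  have := F.sq_diff X
  rw [(F.const₁ X hX).2, mul_zero, zero_add] at this
  exact (mul_eq_zero.1 this).resolve_left F.q_pos.ne'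

theorem diff_p_eq_zero {X : E} (hX : L₂ X = 0) : p' X = 0 :=
  F.swap.diff_q_eq_zero hX

/-- In the symmetry of the second fundamental form for `Z` and `X ∈ ker L₂`, the constancy of `q η₂`
and of `p` along `X` leaves only the term `p ⟨D₁ Z, L₁ X⟩`. -/
theorem shape_direction_left {Z : E} (hZ₁ : L₁ Z = q • η₁) (hZ₂ : L₂ Z = p • η₂) {X : E}
    (hX : L₂ X = 0) : flatForm c₁ (D₁ Z) (L₁ X) = 0 := by
  have h := F.symm Z X
  rw [hX, hZ₁, hZ₂, (F.const₂ X hX).1, (F.const₂ X hX).2, F.diff_p_eq_zero hX] at h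
  simp only [flatForm_add_left, flatForm_smul_left, flatForm_smul_right, flatForm_zero_right,
    F.alpha_eq_zero hX, flatForm_comm c₁ (D₁ X), F.unit_diff₁, smul_zero, zero_smul, add_zero,
    flatForm_zero_left, mul_zero, sub_zero] at h
  exact (mul_eq_zero.1 h).resolve_left F.p_pos.ne'

theorem shape_direction {Z : E} (hZ₁ : L₁ Z = q • η₁) (hZ₂ : L₂ Z = p • η₂) (X : E) :
    flatForm c₁ (D₁ Z) (L₁ X) = 0 := by
  obtain ⟨X₁, X₂, h1, h2, hX⟩ := F.exists_decomposition hZ₁ hZ₂ X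
  rw [hX, map_add, map_add, map_smul, h2, hZ₁]
  simp only [flatForm_add_right, flatForm_smul_right, flatForm_zero_right,
    F.shape_direction_left hZ₁ hZ₂ h1, flatForm_comm c₁ (D₁ Z) η₁, F.unit_diff₁]
  ring

theorem exists_diff_eq {w : Ambient c₁ m₁} (hw : w ∈ spaceFormTangent c₁ p₁) : ∃ X, L₁ X = w := by
  obtain ⟨X, hX, -⟩ := F.onto w hw ((p / q * flatForm c₁ η₁ w) • η₂)
    ((tangentSub c₂ p₂).smul_mem _ F.tangent₂) (by
      rw [flatForm_smul_right, F.unit₂]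
      have := F.q_pos.ne'
      field_simp)
  exact ⟨X, hX⟩

/-- The integral curves of `η₁` are geodesics. -/
theorem diff_direction {Z : E} (hZ₁ : L₁ Z = q • η₁) (hZ₂ : L₂ Z = p • η₂) :
    D₁ Z = (-(c₁ * q)) • p₁ := by
  -- Adding `c₁ q p₁` removes the component of `D₁ Z` normal to the space form.
  have hT : D₁ Z + (c₁ * q) • p₁ ∈ spaceFormTangent c₁ p₁ := by
    intro hc
    have := F.tangent_diff₁ hc Z
    rw [hZ₁, flatForm_smul_left, F.unit₁] at this
    rw [flatForm_add_right, flatForm_smul_right, F.mem₁.1 hc]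
    field_simp
    linarith
  have h0 : D₁ Z + (c₁ * q) • p₁ = 0 := by
    by_contra hne
    refine (flatForm_pos c₁ F.mem₁ hT hne).ne' ?_
    -- Every tangent vector of the first factor has the form `L₁ X`, and `D₁ Z` is orthogonal to all
    -- of these.
    obtain ⟨X, hX⟩ := F.exists_diff_eq hT
    nth_rewrite 2 [← hX]
    rw [flatForm_add_left, flatForm_smul_left, F.shape_direction hZ₁ hZ₂ X]
    have := mul_flatForm_eq_zero (F.diff_mem₁ X)
    linear_combination q * this
  rw [neg_smul]
  exact eq_neg_of_add_eq_zero_left h0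

/-- The one-form `⟨η₁, df₁⟩` is closed. -/
theorem alpha_symm (X Y : E) : flatForm c₁ (D₁ X) (L₁ Y) = flatForm c₁ (D₁ Y) (L₁ X) := by
  obtain ⟨Z, hZ₁, hZ₂⟩ := F.exists_direction
  -- Only the components in `ker L₂` count: `D₁` kills `ker L₁`, `D₁ Z` is orthogonal to the image
  -- of `L₁`, and `L₁ Z` is a multiple of `η₁`, to which the image of `D₁` is orthogonal.
  have key : ∀ X Y X₁ X₂ Y₁ Y₂ : E, ∀ r t : ℝ, L₁ X₂ = 0 → L₂ X₁ = 0 → L₁ Y₂ = 0 → L₂ Y₁ = 0 →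
      X = X₁ + X₂ + r • Z → Y = Y₁ + Y₂ + t • Z →
      flatForm c₁ (D₁ X) (L₁ Y) = flatForm c₁ (D₁ X₁) (L₁ Y₁) := by
    intro X Y X₁ X₂ Y₁ Y₂ r t hX₂ hX₁ hY₂ hY₁ hX hY
    have e1 : D₁ X = D₁ X₁ + r • D₁ Z := by
      rw [hX, map_add, map_add, map_smul, (F.const₁ X₂ hX₂).1, add_zero]
    have e2 : L₁ Y = L₁ Y₁ + (t * q) • η₁ := by
      rw [hY, map_add, map_add, map_smul, hY₂, add_zero, hZ₁, smul_smul]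
    rw [e1, e2]
    simp only [flatForm_add_left, flatForm_add_right, flatForm_smul_left, flatForm_smul_right,
      flatForm_comm c₁ (D₁ _) η₁, F.unit_diff₁, F.shape_direction hZ₁ hZ₂]
    ring
  obtain ⟨X₁, X₂, hX₁, hX₂, hX⟩ := F.exists_decomposition hZ₁ hZ₂ X
  obtain ⟨Y₁, Y₂, hY₁, hY₂, hY⟩ := F.exists_decomposition hZ₁ hZ₂ Y
  rw [key X Y X₁ X₂ Y₁ Y₂ _ _ hX₂ hX₁ hY₂ hY₁ hX hY,
    key Y X Y₁ Y₂ X₁ X₂ _ _ hY₂ hY₁ hX₂ hX₁ hY hX]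
  have h := F.symm X₁ Y₁
  rw [hX₁, hY₁, F.diff_p_eq_zero hX₁, F.diff_p_eq_zero hY₁] at h
  simp only [zero_smul, add_zero, flatForm_zero_right, sub_zero, flatForm_smul_left] at h
  exact mul_left_cancel₀ F.p_pos.ne' h

/-- As `p` is constant along both kernels, its differential is a multiple of the form `ω` dual to
`Z`. -/
theorem diff_p_eq {Z : E} (hZ₁ : L₁ Z = q • η₁) (hZ₂ : L₂ Z = p • η₂) (X : E) :
    p' X = (q * flatForm c₁ η₁ (L₁ X) + p * flatForm c₂ η₂ (L₂ X)) * p' Z := by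
  obtain ⟨X₁, X₂, h1, h2, hX⟩ := F.exists_decomposition hZ₁ hZ₂ X
  have := congrArg p' hX
  rw [map_add, map_add, map_smul, F.diff_p_eq_zero h1, (F.const₁ X₂ h2).2, smul_eq_mul] at this
  linarith

theorem diff_q_eq {Z : E} (hZ₁ : L₁ Z = q • η₁) (hZ₂ : L₂ Z = p • η₂) (X : E) :
    q' X = (q * flatForm c₁ η₁ (L₁ X) + p * flatForm c₂ η₂ (L₂ X)) * q' Z := by
  rw [add_comm]
  exact F.swap.diff_p_eq hZ₂ hZ₁ X

/-- The part of the differential of the one-form dual to the distinguished direction that comes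
from the coefficients is symmetric. -/
theorem omega_symm (X Y : E) :
    q' X * flatForm c₁ η₁ (L₁ Y) + p' X * flatForm c₂ η₂ (L₂ Y) =
      q' Y * flatForm c₁ η₁ (L₁ X) + p' Y * flatForm c₂ η₂ (L₂ X) := by
  obtain ⟨Z, hZ₁, hZ₂⟩ := F.exists_direction
  have a := F.diff_p_eq hZ₁ hZ₂ X
  have b := F.diff_p_eq hZ₁ hZ₂ Y
  have c := F.diff_q_eq hZ₁ hZ₂ X
  have d := F.diff_q_eq hZ₁ hZ₂ Y
  have e := F.alpha_eq X
  have e' := F.alpha_eq Y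
  have g := F.beta_eq X
  have g' := F.beta_eq Y
  -- Both sides equal `r * t * (q * q' Z + p * p' Z)`.
  set r := q * flatForm c₁ η₁ (L₁ X) + p * flatForm c₂ η₂ (L₂ X)
  set t := q * flatForm c₁ η₁ (L₁ Y) + p * flatForm c₂ η₂ (L₂ Y)
  rw [a, b, c, d, e, e', g, g']
  ring

end Frame

end Frame


/-! ### Hypersurfaces in a chart -/

section ChartHypersurface

variable {E : Type*} [NormedAddCommGroup E] [NormedSpace ℝ E]
  {c₁ c₂ : ℝ} {m₁ m₂ : ℕ}

/-- `f` is on the open set `O` of the vector space `E` a hypersurface of a product of space forms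
with unit normal field `N`. -/
structure ChartHypersurface (O : Set E) (f N : E → Ambient c₁ m₁ × Ambient c₂ m₂) : Prop where
  isOpen : IsOpen O
  smooth : ContDiffOn ℝ ∞ f O
  smooth_normal : ContDiffOn ℝ ∞ N O
  mem : ∀ x ∈ O, f x ∈ spaceForm c₁ m₁ ×ˢ spaceForm c₂ m₂
  tangent : ∀ x ∈ O, N x ∈ prodTangent c₁ c₂ (f x)
  unit : ∀ x ∈ O, prodForm c₁ c₂ (N x) (N x) = 1
  normal : ∀ x ∈ O, ∀ X, prodForm c₁ c₂ (N x) (fderiv ℝ f x X) = 0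
  inj : ∀ x ∈ O, Function.Injective (fderiv ℝ f x)

variable {O : Set E} {f N : E → Ambient c₁ m₁ × Ambient c₂ m₂}

namespace ChartHypersurface

theorem mono (h : ChartHypersurface O f N) {O' : Set E} (hO' : IsOpen O') (hsub : O' ⊆ O) :
    ChartHypersurface O' f N where
  isOpen := hO'
  smooth := h.smooth.mono hsub
  smooth_normal := h.smooth_normal.mono hsub
  mem x hx := h.mem x (hsub hx)
  tangent x hx := h.tangent x (hsub hx)
  unit x hx := h.unit x (hsub hx)
  normal x hx := h.normal x (hsub hx)
  inj x hx := h.inj x (hsub hx)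

variable (h : ChartHypersurface O f N)

include h

theorem hasFDerivAt {x : E} (hx : x ∈ O) : HasFDerivAt f (fderiv ℝ f x) x :=
  ((h.smooth.contDiffAt (h.isOpen.mem_nhds hx)).differentiableAt (by simp)).hasFDerivAt

theorem hasFDerivAt_normal {x : E} (hx : x ∈ O) : HasFDerivAt N (fderiv ℝ N x) x :=
  ((h.smooth_normal.contDiffAt (h.isOpen.mem_nhds hx)).differentiableAt (by simp)).hasFDerivAt

theorem pointData [FiniteDimensional ℝ E] (hdim : m₁ + m₂ = Module.finrank ℝ E + 1) {x : E}
    (hx : x ∈ O) :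
    PointData (f x).1 (N x).1 (f x).2 (N x).2
      ((ContinuousLinearMap.fst ℝ _ _).comp (fderiv ℝ f x))
      ((ContinuousLinearMap.fst ℝ _ _).comp (fderiv ℝ N x))
      ((ContinuousLinearMap.snd ℝ _ _).comp (fderiv ℝ f x))
      ((ContinuousLinearMap.snd ℝ _ _).comp (fderiv ℝ N x)) :=
  pointData_of_hasDiff (J := 𝓘(ℝ, E)) (M := E)
    (hasMFDerivAt_iff_hasFDerivAt.2 (h.hasFDerivAt hx))
    (hasMFDerivAt_iff_hasFDerivAt.2 (h.hasFDerivAt_normal hx))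
    (Filter.mem_of_superset (h.isOpen.mem_nhds hx) h.mem)
    (Filter.mem_of_superset (h.isOpen.mem_nhds hx) h.tangent)
    (Filter.mem_of_superset (h.isOpen.mem_nhds hx) h.unit)
    (h.normal x hx) (h.inj x hx) hdim

/-- The second fundamental form is symmetric. -/
theorem secondForm_symm {x : E} (hx : x ∈ O) (X Y : E) :
    prodForm c₁ c₂ (fderiv ℝ N x X) (fderiv ℝ f x Y) =
      prodForm c₁ c₂ (fderiv ℝ N x Y) (fderiv ℝ f x X) := by
  have hc := h.smooth.contDiffAt (h.isOpen.mem_nhds hx)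
  have hsymm : IsSymmSndFDerivAt ℝ f x := hc.isSymmSndFDerivAt (by simpa using ENat.LEInfty.out)
  have hd : HasFDerivAt (fderiv ℝ f) (fderiv ℝ (fderiv ℝ f) x) x :=
    ((hc.fderiv_right (m := ∞) (by simp)).differentiableAt (by simp)).hasFDerivAt
  -- Differentiating `⟨N, df Y⟩ = 0` reduces the claim to the symmetry of the second derivative of
  -- `f`.
  have key : ∀ X Y : E, prodForm c₁ c₂ (fderiv ℝ N x X) (fderiv ℝ f x Y) =
      -prodForm c₁ c₂ (N x) (fderiv ℝ (fderiv ℝ f) x X Y) := by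
    intro X Y
    have h1 : HasFDerivAt (fun y => fderiv ℝ f y Y) _ x :=
      hd.clm_apply (hasFDerivAt_const Y x)
    have h2 := HasDiff.bilin_eq_zero (J := 𝓘(ℝ, E)) (M := E) (prodFormL c₁ c₂ m₁ m₂)
      (hasMFDerivAt_iff_hasFDerivAt.2 (h.hasFDerivAt_normal hx))
      (hasMFDerivAt_iff_hasFDerivAt.2 h1) (r := 0)
      (Filter.mem_of_superset (h.isOpen.mem_nhds hx) fun y hy => h.normal y hy Y) X
    have h3 : prodForm c₁ c₂ (N x) (fderiv ℝ f x 0 + fderiv ℝ (fderiv ℝ f) x X Y) +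
      prodForm c₁ c₂ (fderiv ℝ N x X) (fderiv ℝ f x Y) = 0 := h2
    rw [map_zero, zero_add] at h3
    linarith
  rw [key, key, hsymm X Y]

end ChartHypersurface

/-- In addition, no component of the unit normal vanishes, and each of them is constant along the
kernel of the differential of the corresponding component of `f`. -/
structure AdaptedHypersurface (O : Set E) (f N : E → Ambient c₁ m₁ × Ambient c₂ m₂) : Prop
    extends ChartHypersurface O f N where
  ne₁ : ∀ x ∈ O, (N x).1 ≠ 0
  ne₂ : ∀ x ∈ O, (N x).2 ≠ 0
  const₁ : ∀ x ∈ O, ∀ X, (fderiv ℝ f x X).1 = 0 → (fderiv ℝ N x X).1 = 0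
  const₂ : ∀ x ∈ O, ∀ X, (fderiv ℝ f x X).2 = 0 → (fderiv ℝ N x X).2 = 0

/-- The length of the first component of a normal field. -/
noncomputable def len₁ (N : E → Ambient c₁ m₁ × Ambient c₂ m₂) (x : E) : ℝ :=
  √(flatForm c₁ (N x).1 (N x).1)

/-- The length of the second component of a normal field. -/
noncomputable def len₂ (N : E → Ambient c₁ m₁ × Ambient c₂ m₂) (x : E) : ℝ :=
  √(flatForm c₂ (N x).2 (N x).2)

/-- The normalized first component of a normal field, with the opposite sign. -/
noncomputable def dir₁ (N : E → Ambient c₁ m₁ × Ambient c₂ m₂) (x : E) : Ambient c₁ m₁ :=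
  (-(len₁ N x)⁻¹) • (N x).1

/-- The normalized second component of a normal field. -/
noncomputable def dir₂ (N : E → Ambient c₁ m₁ × Ambient c₂ m₂) (x : E) : Ambient c₂ m₂ :=
  (len₂ N x)⁻¹ • (N x).2

namespace AdaptedHypersurface

theorem mono (h : AdaptedHypersurface O f N) {O' : Set E} (hO' : IsOpen O') (hsub : O' ⊆ O) :
    AdaptedHypersurface O' f N where
  toChartHypersurface := h.toChartHypersurface.mono hO' hsub
  ne₁ x hx := h.ne₁ x (hsub hx)
  ne₂ x hx := h.ne₂ x (hsub hx)
  const₁ x hx := h.const₁ x (hsub hx)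
  const₂ x hx := h.const₂ x (hsub hx)

variable (h : AdaptedHypersurface O f N)

include h

theorem form₁_pos {x : E} (hx : x ∈ O) : 0 < flatForm c₁ (N x).1 (N x).1 :=
  flatForm_pos c₁ (h.mem x hx).1 (h.tangent x hx).1 (h.ne₁ x hx)

theorem form₂_pos {x : E} (hx : x ∈ O) : 0 < flatForm c₂ (N x).2 (N x).2 :=
  flatForm_pos c₂ (h.mem x hx).2 (h.tangent x hx).2 (h.ne₂ x hx)

theorem len₁_pos {x : E} (hx : x ∈ O) : 0 < len₁ N x := Real.sqrt_pos.2 (h.form₁_pos hx)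

theorem len₂_pos {x : E} (hx : x ∈ O) : 0 < len₂ N x := Real.sqrt_pos.2 (h.form₂_pos hx)

theorem len₁_sq {x : E} (hx : x ∈ O) : len₁ N x ^ 2 = flatForm c₁ (N x).1 (N x).1 :=
  Real.sq_sqrt (h.form₁_pos hx).le

theorem len₂_sq {x : E} (hx : x ∈ O) : len₂ N x ^ 2 = flatForm c₂ (N x).2 (N x).2 :=
  Real.sq_sqrt (h.form₂_pos hx).le

theorem sq_add {x : E} (hx : x ∈ O) : len₁ N x ^ 2 + len₂ N x ^ 2 = 1 := by
  rw [h.len₁_sq hx, h.len₂_sq hx]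
  exact h.unit x hx

theorem contDiffOn_len₁ : ContDiffOn ℝ ∞ (len₁ N) O := by
  have h1 : ContDiffOn ℝ ∞ (fun x => (N x).1) O := h.smooth_normal.fst
  exact (((flatFormL c₁ m₁).contDiff.comp_contDiffOn h1).clm_apply h1).sqrt
    fun _ hx => (h.form₁_pos hx).ne'

theorem contDiffOn_len₂ : ContDiffOn ℝ ∞ (len₂ N) O := by
  have h1 : ContDiffOn ℝ ∞ (fun x => (N x).2) O := h.smooth_normal.snd
  exact (((flatFormL c₂ m₂).contDiff.comp_contDiffOn h1).clm_apply h1).sqrt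
    fun _ hx => (h.form₂_pos hx).ne'

theorem contDiffOn_dir₁ : ContDiffOn ℝ ∞ (dir₁ N) O :=
  (h.contDiffOn_len₁.inv fun _ hx => (h.len₁_pos hx).ne').neg.smul h.smooth_normal.fst

theorem contDiffOn_dir₂ : ContDiffOn ℝ ∞ (dir₂ N) O :=
  (h.contDiffOn_len₂.inv fun _ hx => (h.len₂_pos hx).ne').smul h.smooth_normal.snd

theorem normal_fst_eq {x : E} (hx : x ∈ O) : (N x).1 = (-len₁ N x) • dir₁ N x := by
  rw [dir₁, smul_smul, neg_mul_neg, mul_inv_cancel₀ (h.len₁_pos hx).ne', one_smul]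

theorem normal_snd_eq {x : E} (hx : x ∈ O) : (N x).2 = len₂ N x • dir₂ N x := by
  rw [dir₂, smul_smul, mul_inv_cancel₀ (h.len₂_pos hx).ne', one_smul]

theorem dir₁_unit {x : E} (hx : x ∈ O) : flatForm c₁ (dir₁ N x) (dir₁ N x) = 1 := by
  have := (h.len₁_pos hx).ne'
  rw [dir₁, flatForm_smul_left, flatForm_smul_right, ← h.len₁_sq hx]
  field_simp

theorem dir₂_unit {x : E} (hx : x ∈ O) : flatForm c₂ (dir₂ N x) (dir₂ N x) = 1 := by
  have := (h.len₂_pos hx).ne'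
  rw [dir₂, flatForm_smul_left, flatForm_smul_right, ← h.len₂_sq hx]
  field_simp

theorem dir₁_mem {x : E} (hx : x ∈ O) : dir₁ N x ∈ spaceFormTangent c₁ (f x).1 :=
  (tangentSub c₁ _).smul_mem _ (h.tangent x hx).1

theorem dir₂_mem {x : E} (hx : x ∈ O) : dir₂ N x ∈ spaceFormTangent c₂ (f x).2 :=
  (tangentSub c₂ _).smul_mem _ (h.tangent x hx).2

theorem hasFDerivAt_of_contDiffOn {V : Type*} [NormedAddCommGroup V] [NormedSpace ℝ V]
    {G : E → V} (hG : ContDiffOn ℝ ∞ G O) {x : E} (hx : x ∈ O) :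
    HasFDerivAt G (fderiv ℝ G x) x :=
  ((hG.contDiffAt (h.isOpen.mem_nhds hx)).differentiableAt (by simp)).hasFDerivAt

/-- The differentials of the directions and lengths are read off from `N = (-p η₁, q η₂)`. Since
`η₁` has unit length, pairing `dN₁ X` with `η₁` isolates `dp X`; hence `dN₁ X = 0` makes both `dp X`
and `dη₁ X` vanish. -/
theorem frame [FiniteDimensional ℝ E] (hdim : m₁ + m₂ = Module.finrank ℝ E + 1) {x : E}
    (hx : x ∈ O) :
    Frame (f x).1 (dir₁ N x) (f x).2 (dir₂ N x) (len₁ N x) (len₂ N x)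
      ((ContinuousLinearMap.fst ℝ _ _).comp (fderiv ℝ f x)) (fderiv ℝ (dir₁ N) x)
      ((ContinuousLinearMap.snd ℝ _ _).comp (fderiv ℝ f x)) (fderiv ℝ (dir₂ N) x)
      (fderiv ℝ (len₁ N) x) (fderiv ℝ (len₂ N) x) := by
  have P := h.pointData hdim hx
  have hO := h.isOpen.mem_nhds hx
  have dN := h.hasFDerivAt_normal hx
  have df := h.hasFDerivAt hx
  have dp := h.hasFDerivAt_of_contDiffOn h.contDiffOn_len₁ hx
  have dq := h.hasFDerivAt_of_contDiffOn h.contDiffOn_len₂ hx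
  have d1 := h.hasFDerivAt_of_contDiffOn h.contDiffOn_dir₁ hx
  have d2 := h.hasFDerivAt_of_contDiffOn h.contDiffOn_dir₂ hx
  have hp := h.len₁_pos hx
  have hq := h.len₂_pos hx
  have n1 := h.normal_fst_eq hx
  have n2 := h.normal_snd_eq hx
  have k1 : ∀ X, (fderiv ℝ N x X).1 =
      -(len₁ N x • fderiv ℝ (dir₁ N) x X + fderiv ℝ (len₁ N) x X • dir₁ N x) := by
    intro X
    have e1 : HasFDerivAt (fun y => (N y).1) _ x := dN.fst
    have e2 := (dp.neg.smul d1).congr_of_eventuallyEq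
      (Filter.mem_of_superset hO fun y hy => h.normal_fst_eq hy)
    have e3 := DFunLike.congr_fun (e1.unique e2) X
    refine e3.trans ?_
    change (-len₁ N x) • fderiv ℝ (dir₁ N) x X + (-fderiv ℝ (len₁ N) x X) • dir₁ N x = _
    module
  have k2 : ∀ X, (fderiv ℝ N x X).2 =
      len₂ N x • fderiv ℝ (dir₂ N) x X + fderiv ℝ (len₂ N) x X • dir₂ N x := by
    intro X
    have e1 : HasFDerivAt (fun y => (N y).2) _ x := dN.snd
    have e2 := (dq.smul d2).congr_of_eventuallyEq
      (Filter.mem_of_superset hO fun y hy => h.normal_snd_eq hy)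
    exact DFunLike.congr_fun (e1.unique e2) X
  have u1 : ∀ X, flatForm c₁ (dir₁ N x) (fderiv ℝ (dir₁ N) x X) = 0 := by
    intro X
    have := HasDiff.bilin_eq_zero (J := 𝓘(ℝ, E)) (M := E) (flatFormL c₁ m₁)
      (hasMFDerivAt_iff_hasFDerivAt.2 d1) (hasMFDerivAt_iff_hasFDerivAt.2 d1) (r := 1)
      (Filter.mem_of_superset hO fun y hy => h.dir₁_unit hy) X
    simp only [flatFormL_apply] at this
    rw [flatForm_comm c₁ _ (dir₁ N x)] at this
    have e : flatForm c₁ (dir₁ N x) (fderiv ℝ (dir₁ N) x X) +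
      flatForm c₁ (dir₁ N x) (fderiv ℝ (dir₁ N) x X) = 0 := this
    linarith
  have u2 : ∀ X, flatForm c₂ (dir₂ N x) (fderiv ℝ (dir₂ N) x X) = 0 := by
    intro X
    have := HasDiff.bilin_eq_zero (J := 𝓘(ℝ, E)) (M := E) (flatFormL c₂ m₂)
      (hasMFDerivAt_iff_hasFDerivAt.2 d2) (hasMFDerivAt_iff_hasFDerivAt.2 d2) (r := 1)
      (Filter.mem_of_superset hO fun y hy => h.dir₂_unit hy) X
    simp only [flatFormL_apply] at this
    rw [flatForm_comm c₂ _ (dir₂ N x)] at this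
    have e : flatForm c₂ (dir₂ N x) (fderiv ℝ (dir₂ N) x X) +
      flatForm c₂ (dir₂ N x) (fderiv ℝ (dir₂ N) x X) = 0 := this
    linarith
  have z1 : ∀ X, (fderiv ℝ N x X).1 = 0 →
      fderiv ℝ (dir₁ N) x X = 0 ∧ fderiv ℝ (len₁ N) x X = 0 := by
    intro X hX
    have e := k1 X
    rw [hX] at e
    have e' := congrArg (flatForm c₁ (dir₁ N x)) e
    rw [flatForm_zero_right, flatForm_neg_right, flatForm_add_right, flatForm_smul_right,
      flatForm_smul_right, u1, h.dir₁_unit hx] at e'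
    have e'' : fderiv ℝ (len₁ N) x X = 0 := by linarith
    rw [e'', zero_smul, add_zero, zero_eq_neg] at e
    exact ⟨(smul_eq_zero.1 e).resolve_left hp.ne', e''⟩
  have z2 : ∀ X, (fderiv ℝ N x X).2 = 0 →
      fderiv ℝ (dir₂ N) x X = 0 ∧ fderiv ℝ (len₂ N) x X = 0 := by
    intro X hX
    have e := k2 X
    rw [hX] at e
    have e' := congrArg (flatForm c₂ (dir₂ N x)) e
    rw [flatForm_zero_right, flatForm_add_right, flatForm_smul_right,
      flatForm_smul_right, u2, h.dir₂_unit hx] at e'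
    have e'' : fderiv ℝ (len₂ N) x X = 0 := by linarith
    rw [e'', zero_smul, add_zero] at e
    exact ⟨(smul_eq_zero.1 e.symm).resolve_left hq.ne', e''⟩
  have hw : ∀ w₁ w₂, flatForm c₁ (N x).1 w₁ + flatForm c₂ (N x).2 w₂ =
      -(len₁ N x * flatForm c₁ (dir₁ N x) w₁) + len₂ N x * flatForm c₂ (dir₂ N x) w₂ := by
    intro w₁ w₂
    rw [n1, n2, flatForm_smul_left, flatForm_smul_left]
    ring
  refine ⟨P.mem₁, P.mem₂, h.dir₁_mem hx, h.dir₂_mem hx, h.dir₁_unit hx, h.dir₂_unit hx, hp, hq,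
    h.sq_add hx, ?_, P.diff_mem₁, P.diff_mem₂, P.inj, ?_, u1, u2, ?_, ?_, ?_, ?_, ?_, ?_⟩
  · intro X
    have := P.normal X
    rw [hw] at this
    linarith
  · intro w₁ h₁ w₂ h₂ h12
    exact P.onto w₁ h₁ w₂ h₂ (by rw [hw]; linarith)
  · intro hc X
    exact HasDiff.bilin_eq_zero (J := 𝓘(ℝ, E)) (M := E) (flatFormL c₁ m₁)
      (hasMFDerivAt_iff_hasFDerivAt.2 df.fst) (hasMFDerivAt_iff_hasFDerivAt.2 d1) (r := 0)
      (Filter.mem_of_superset hO fun y hy => h.dir₁_mem hy hc) X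
  · intro hc X
    exact HasDiff.bilin_eq_zero (J := 𝓘(ℝ, E)) (M := E) (flatFormL c₂ m₂)
      (hasMFDerivAt_iff_hasFDerivAt.2 df.snd) (hasMFDerivAt_iff_hasFDerivAt.2 d2) (r := 0)
      (Filter.mem_of_superset hO fun y hy => h.dir₂_mem hy hc) X
  · intro X
    have e := ((dp.mul dp).add (dq.mul dq)).unique
        ((hasFDerivAt_const (1 : ℝ) x).congr_of_eventuallyEq
      (Filter.mem_of_superset hO fun y hy => by
        have := h.sq_add hy
        simp only [Pi.add_apply, Pi.mul_apply, Set.mem_ofPred_eq]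
        linarith))
    have e' := DFunLike.congr_fun e X
    have e'' : (len₁ N x * fderiv ℝ (len₁ N) x X + len₁ N x * fderiv ℝ (len₁ N) x X) +
      (len₂ N x * fderiv ℝ (len₂ N) x X + len₂ N x * fderiv ℝ (len₂ N) x X) = 0 := e'
    linarith
  · exact fun X hX => z1 X (h.const₁ x hx X hX)
  · exact fun X hX => z2 X (h.const₂ x hx X hX)
  · intro X Y
    have e := h.secondForm_symm hx X Y
    simp only [prodForm, k1, k2, flatForm_neg_left] at e
    simp only [ContinuousLinearMap.comp_apply, ContinuousLinearMap.coe_fst',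
      ContinuousLinearMap.coe_snd']
    linarith

end AdaptedHypersurface

end ChartHypersurface


/-! ### Potentials, local inverses, and functions constant along a subspace -/

section Calculus

variable {E F V V' : Type*} [NormedAddCommGroup E] [NormedSpace ℝ E]
  [NormedAddCommGroup F] [NormedSpace ℝ F]
  [NormedAddCommGroup V] [NormedSpace ℝ V] [NormedAddCommGroup V'] [NormedSpace ℝ V']

/-- A one-form `β (η, dg)` with `β (dη, dg)` symmetric has a primitive on a convex open set. -/
theorem exists_potential (β : V →L[ℝ] V' →L[ℝ] ℝ) {O : Set E} (hO : IsOpen O) (hconv : Convex ℝ O)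
    {η : E → V} {g : E → V'} (hη : ContDiffOn ℝ ∞ η O) (hg : ContDiffOn ℝ ∞ g O)
    (hsymm : ∀ x ∈ O, ∀ X Y, β (fderiv ℝ η x X) (fderiv ℝ g x Y) =
      β (fderiv ℝ η x Y) (fderiv ℝ g x X)) (x₀ : E) :
    ∃ a : E → ℝ, ContDiffOn ℝ ∞ a O ∧ a x₀ = 0 ∧
      ∀ x ∈ O, HasFDerivAt a ((β (η x)).comp (fderiv ℝ g x)) x := by
  have hg' : ContDiffOn ℝ ∞ (fderiv ℝ g) O := hg.fderiv_of_isOpen hO (by simp)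
  have hω : ContDiffOn ℝ ∞ (fun x => (β (η x)).comp (fderiv ℝ g x)) O :=
    (β.contDiff.comp_contDiffOn hη).clm_comp hg'
  -- Poincaré lemma: the derivative of the form consists of the second derivative of `g`, which is
  -- symmetric, and of the part covered by `hsymm`.
  obtain ⟨a, ha⟩ := Convex.exists_forall_hasFDerivAt_of_fderiv_symmetric (𝕜 := ℝ) hconv hO
    (hω.differentiableOn (by simp)) (by
      intro x hx X Y
      have hc := hg.contDiffAt (hO.mem_nhds hx)
      have hs : IsSymmSndFDerivAt ℝ g x :=
        hc.isSymmSndFDerivAt (by simpa using ENat.LEInfty.out)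
      have dη : HasFDerivAt η (fderiv ℝ η x) x :=
        ((hη.contDiffAt (hO.mem_nhds hx)).differentiableAt (by simp)).hasFDerivAt
      have dg : HasFDerivAt (fderiv ℝ g) (fderiv ℝ (fderiv ℝ g) x) x :=
        ((hg'.contDiffAt (hO.mem_nhds hx)).differentiableAt (by simp)).hasFDerivAt
      have d := (β.hasFDerivAt.comp x dη).clm_comp dg
      simp only [Function.comp_apply] at d
      rw [HasFDerivAt.fderiv d]
      change β (η x) (fderiv ℝ (fderiv ℝ g) x X Y) + β (fderiv ℝ η x X) (fderiv ℝ g x Y) =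
        β (η x) (fderiv ℝ (fderiv ℝ g) x Y X) + β (fderiv ℝ η x Y) (fderiv ℝ g x X)
      rw [hs X Y, hsymm x hx X Y])
  have ha' : ∀ x ∈ O, HasFDerivAt (fun y => a y - a x₀) ((β (η x)).comp (fderiv ℝ g x)) x :=
    fun x hx => (ha x hx).sub_const _
  refine ⟨fun y => a y - a x₀, ?_, sub_self _, ha'⟩
  rw [contDiffOn_infty_iff_fderiv_of_isOpen hO]
  exact ⟨fun x hx => (ha' x hx).differentiableAt.differentiableWithinAt,
    hω.congr fun x hx => (ha' x hx).fderiv⟩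

/-- The inverse function theorem, for maps between spaces of the same dimension. -/
theorem exists_smooth_localInverse [FiniteDimensional ℝ E] [FiniteDimensional ℝ F]
    (hdim : Module.finrank ℝ E = Module.finrank ℝ F) {O : Set E} (hO : IsOpen O) {Ψ : E → F}
    (hΨ : ContDiffOn ℝ ∞ Ψ O) {x₀ : E} (hx₀ : x₀ ∈ O)
    (hinj : ∀ X, fderiv ℝ Ψ x₀ X = 0 → X = 0) :
    ∃ (W : Set F) (Φ : F → E), IsOpen W ∧ Ψ x₀ ∈ W ∧ ContDiffOn ℝ ∞ Φ W ∧ Φ (Ψ x₀) = x₀ ∧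
      (∀ y ∈ W, Φ y ∈ O) ∧ (∀ y ∈ W, Ψ (Φ y) = y) := by
  have : CompleteSpace E := FiniteDimensional.complete ℝ E
  let e : E ≃L[ℝ] F := (LinearEquiv.ofInjectiveOfFinrankEq (fderiv ℝ Ψ x₀).toLinearMap
    ((injective_iff_map_eq_zero _).2 hinj) hdim).toContinuousLinearEquiv
  have he : (e : E →L[ℝ] F) = fderiv ℝ Ψ x₀ := by
    ext X
    rfl
  have hc : ∀ x ∈ O, ContDiffAt ℝ ∞ Ψ x := fun x hx => hΨ.contDiffAt (hO.mem_nhds hx)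
  have hd : HasFDerivAt Ψ (e : E →L[ℝ] F) x₀ := by
    rw [he]
    exact ((hc x₀ hx₀).differentiableAt (by simp)).hasFDerivAt
  set φ := (hc x₀ hx₀).toOpenPartialHomeomorph Ψ hd (by simp)
  have hφ : ∀ x, φ x = Ψ x := fun x => rfl
  have hmem : x₀ ∈ φ.source := (hc x₀ hx₀).mem_toOpenPartialHomeomorph_source hd (by simp)
  -- Restricting to the open set where the derivative of `Ψ` is invertible makes the inverse smooth
  -- at every point, not only at `Ψ x₀`.
  set S := O ∩ fderiv ℝ Ψ ⁻¹' Set.range ((↑) : (E ≃L[ℝ] F) → E →L[ℝ] F)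
  have hS : IsOpen S := (hΨ.continuousOn_fderiv_of_isOpen hO (by simp)).isOpen_inter_preimage hO
    (ContinuousLinearEquiv.isOpen (𝕜 := ℝ))
  have hback : φ.symm (Ψ x₀) = x₀ := φ.left_inv hmem
  refine ⟨φ.target ∩ φ.symm ⁻¹' S, φ.symm, φ.isOpen_inter_preimage_symm hS,
    ⟨φ.map_source hmem, ?_⟩, ?_, hback, fun y hy => hy.2.1, fun y hy => φ.right_inv hy.1⟩
  · rw [Set.mem_preimage, hback]
    exact ⟨hx₀, e, he⟩
  · intro y hy
    obtain ⟨e', he'⟩ := hy.2.2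
    refine (φ.contDiffAt_symm (f₀' := e') hy.1 ?_ (hc _ hy.2.1)).contDiffWithinAt
    rw [he']
    exact ((hc _ hy.2.1).differentiableAt (by simp)).hasFDerivAt

/-- A function on a convex open set whose differential vanishes on the kernel of a linear map
depends only on the value of that linear map. -/
theorem eq_of_fderiv_ker_eq_zero {W : Set F} (hW : Convex ℝ W) {G : F → V} {G' : F → F →L[ℝ] V}
    (hG : ∀ w ∈ W, HasFDerivAt G (G' w) w) (π : F →ₗ[ℝ] V')
    (hker : ∀ w ∈ W, ∀ v, π v = 0 → G' w v = 0) {w w' : F} (hw : w ∈ W) (hw' : w' ∈ W)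
    (h : π w = π w') : G w = G w' := by
  have hmem : ∀ t ∈ Set.Icc (0 : ℝ) 1, w' + t • (w - w') ∈ W := fun t ht =>
    hW.add_smul_sub_mem hw' hw ht
  have hd : ∀ t ∈ Set.Icc (0 : ℝ) 1, HasDerivAt (fun t : ℝ => G (w' + t • (w - w'))) 0 t := by
    intro t ht
    have h1 : HasDerivAt (fun t : ℝ => w' + t • (w - w')) (w - w') t := by
      simpa using ((hasDerivAt_id t).smul_const (w - w')).const_add w'
    have := (hG _ (hmem t ht)).comp_hasDerivAt t h1
    rwa [hker _ (hmem t ht) _ (by rw [map_sub, h, sub_self])] at this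
  have := constant_of_has_deriv_right_zero (a := 0) (b := 1)
    (fun t ht => (hd t ht).continuousAt.continuousWithinAt)
    (fun t ht => (hd t ⟨ht.1, ht.2.le⟩).hasDerivWithinAt) 1 (by simp)
  simpa using this

/-- A linear projection that is injective on the range of a given linear map. -/
theorem exists_clm_injective_on_range [FiniteDimensional ℝ E] [FiniteDimensional ℝ V]
    [FiniteDimensional ℝ F] (T : E →L[ℝ] V)
    (hT : Module.finrank ℝ (LinearMap.range T.toLinearMap) ≤ Module.finrank ℝ F) :
    ∃ ℓ : V →L[ℝ] F, ∀ X, ℓ (T X) = 0 → T X = 0 := by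
  set R := LinearMap.range T.toLinearMap
  obtain ⟨j, hj⟩ := finrank_le_iff_exists_linearMap.1 hT
  obtain ⟨l, hl⟩ := LinearMap.exists_extend j
  refine ⟨LinearMap.toContinuousLinearMap l, fun X hX => ?_⟩
  have h1 : j ⟨T X, X, rfl⟩ = 0 := by
    rw [← hl]
    exact hX
  exact congrArg Subtype.val ((injective_iff_map_eq_zero j).1 hj _ h1)

end Calculus


/-! ### Foot points of parallel families -/

section FootPoint

theorem cosC_neg (c s : ℝ) : cosC c (-s) = cosC c s := by
  simp [cosC]

theorem sinC_neg (c s : ℝ) : sinC c (-s) = -sinC c s := by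
  unfold sinC
  split_ifs <;> simp [neg_div]

variable {E : Type*} [NormedAddCommGroup E] [NormedSpace ℝ E] {c : ℝ} {m : ℕ}

/-- The point reached from `p` by going back along the geodesic with direction `η` for the time
`a`, together with the direction of the geodesic there. -/
noncomputable def footPoint {E : Type*} (c : ℝ) {m : ℕ} (p η : E → Ambient c m) (a : E → ℝ)
    (x : E) :
    Ambient c m × Ambient c m :=
  (parallelMap c p η (-(a x)) x, parallelNormal c p η (-(a x)) x)

/-- The differential of `footPoint`. -/
noncomputable def footDiff (c : ℝ) {m : ℕ} (p η : Ambient c m) (a : ℝ) (L D : E →L[ℝ] Ambient c m)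
    (α : E →L[ℝ] ℝ) : E →L[ℝ] Ambient c m × Ambient c m :=
  (cosC c (-a) • L + sinC c (-a) • D +
      (-α).smulRight ((-(c * sinC c (-a))) • p + cosC c (-a) • η)).prod
    ((-(c * sinC c (-a))) • L + cosC c (-a) • D -
      (-α).smulRight (c • (cosC c (-a) • p + sinC c (-a) • η)))

theorem hasFDerivAt_footPoint {p η : E → Ambient c m} {a : E → ℝ} {x : E}
    {L D : E →L[ℝ] Ambient c m} {α : E →L[ℝ] ℝ} (hp : HasFDerivAt p L x)
    (hη : HasFDerivAt η D x) (ha : HasFDerivAt a α x) :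
    HasFDerivAt (footPoint c p η a) (footDiff c (p x) (η x) (a x) L D α) x := by
  have hp' : HasDiff 𝓘(ℝ, E) p x L := hasMFDerivAt_iff_hasFDerivAt.2 hp
  have hη' : HasDiff 𝓘(ℝ, E) η x D := hasMFDerivAt_iff_hasFDerivAt.2 hη
  have ha' : HasDiff 𝓘(ℝ, E) (fun y => -(a y)) x (-α) := hasMFDerivAt_iff_hasFDerivAt.2 ha.neg
  exact hasMFDerivAt_iff_hasFDerivAt.1
    ((hasDiff_rotated ha' hp' hη').prodMk (hasDiff_rotatedNormal ha' hp' hη'))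

theorem contDiffOn_footPoint {p η : E → Ambient c m} {a : E → ℝ} {O : Set E}
    (hp : ContDiffOn ℝ ∞ p O) (hη : ContDiffOn ℝ ∞ η O) (ha : ContDiffOn ℝ ∞ a O) :
    ContDiffOn ℝ ∞ (footPoint c p η a) O := by
  have hC := (contDiff_cosC c).comp_contDiffOn ha.neg
  have hS := (contDiff_sinC c).comp_contDiffOn ha.neg
  exact ((hC.smul hp).add (hS.smul hη)).prodMk
    (((contDiffOn_const.mul hS).neg.smul hp).add (hC.smul hη))

/-- The point can be recovered from the foot point. -/
theorem footPoint_rotate_fst {E : Type*} (p η : E → Ambient c m) (a : E → ℝ) (x : E) :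
    cosC c (a x) • (footPoint c p η a x).1 + sinC c (a x) • (footPoint c p η a x).2 = p x := by
  have h := cosC_sq_add c (a x)
  simp only [footPoint, parallelMap, parallelNormal, cosC_neg, sinC_neg]
  calc _ = (cosC c (a x) ^ 2 + c * sinC c (a x) ^ 2) • p x := by module
    _ = p x := by rw [h, one_smul]

theorem footPoint_rotate_snd {E : Type*} (p η : E → Ambient c m) (a : E → ℝ) (x : E) :
    (-(c * sinC c (a x))) • (footPoint c p η a x).1 + cosC c (a x) • (footPoint c p η a x).2 =
      η x := by
  have h := cosC_sq_add c (a x)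
  simp only [footPoint, parallelMap, parallelNormal, cosC_neg, sinC_neg]
  calc _ = (cosC c (a x) ^ 2 + c * sinC c (a x) ^ 2) • η x := by module
    _ = η x := by rw [h, one_smul]

theorem footDiff_apply_eq_zero {p η : Ambient c m} {a : ℝ} {L D : E →L[ℝ] Ambient c m}
    {α : E →L[ℝ] ℝ} {X : E} (hL : L X = 0) (hD : D X = 0) (hα : α X = 0) :
    footDiff c p η a L D α X = 0 := by
  simp [footDiff, hL, hD, hα]

/-- Along `Z` the point advances on its geodesic by exactly the amount by which the backward time
grows, so the foot point stays put. -/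
theorem footDiff_direction {p η : Ambient c m} {a q : ℝ} {L D : E →L[ℝ] Ambient c m}
    {α : E →L[ℝ] ℝ} {Z : E} (hL : L Z = q • η) (hD : D Z = (-(c * q)) • p) (hα : α Z = q) :
    footDiff c p η a L D α Z = 0 := by
  refine Prod.ext ?_ ?_
  · simp only [footDiff, ContinuousLinearMap.prod_apply, add_apply,
      smul_apply, ContinuousLinearMap.smulRight_apply,
      neg_apply, hL, hD, hα, Prod.fst_zero]
    module
  · simp only [footDiff, ContinuousLinearMap.prod_apply, add_apply,
      smul_apply, ContinuousLinearMap.smulRight_apply,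
      sub_apply,
      neg_apply, hL, hD, hα, Prod.snd_zero]
    module

/-- With the time frozen, the differential of the foot point is the rotation of the pair `(L X, D
X)`, which is invertible by `cosC_sq_add`. -/
theorem eq_zero_of_footDiff_eq_zero {p η : Ambient c m} {a : ℝ} {L D : E →L[ℝ] Ambient c m}
    {α : E →L[ℝ] ℝ} {X : E} (h : footDiff c p η a L D α X = 0) (hα : α X = 0) : L X = 0 := by
  have h1 : cosC c (-a) • L X + sinC c (-a) • D X = 0 := by
    simpa [footDiff, hα] using congrArg Prod.fst h
  have h2 : (-(c * sinC c (-a))) • L X + cosC c (-a) • D X = 0 := by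
    simpa [footDiff, hα] using congrArg Prod.snd h
  calc L X = (cosC c (-a) ^ 2 + c * sinC c (-a) ^ 2) • L X := by rw [cosC_sq_add, one_smul]
    _ = cosC c (-a) • (cosC c (-a) • L X + sinC c (-a) • D X) -
        sinC c (-a) • ((-(c * sinC c (-a))) • L X + cosC c (-a) • D X) := by module
    _ = 0 := by rw [h1, h2, smul_zero, smul_zero, sub_zero]

end FootPoint

namespace Frame

variable {E : Type*} [NormedAddCommGroup E] [NormedSpace ℝ E]
  {c₁ c₂ : ℝ} {m₁ m₂ : ℕ} {p₁ η₁ : Ambient c₁ m₁} {p₂ η₂ : Ambient c₂ m₂} {p q : ℝ}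
  {L₁ D₁ : E →L[ℝ] Ambient c₁ m₁} {L₂ D₂ : E →L[ℝ] Ambient c₂ m₂} {p' q' : E →L[ℝ] ℝ}
  (F : Frame p₁ η₁ p₂ η₂ p q L₁ D₁ L₂ D₂ p' q')

include F

theorem footDiff_of_ker (a : ℝ) {X : E} (hX : L₁ X = 0) :
    footDiff c₁ p₁ η₁ a L₁ D₁ ((flatFormL c₁ m₁ η₁).comp L₁) X = 0 :=
  footDiff_apply_eq_zero hX (F.const₁ X hX).1 (by simp [hX])

theorem footDiff_of_direction (a : ℝ) {Z : E} (hZ₁ : L₁ Z = q • η₁) (hZ₂ : L₂ Z = p • η₂) :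
    footDiff c₁ p₁ η₁ a L₁ D₁ ((flatFormL c₁ m₁ η₁).comp L₁) Z = 0 :=
  footDiff_direction hZ₁ (F.diff_direction hZ₁ hZ₂) (by
    rw [ContinuousLinearMap.comp_apply, flatFormL_apply, hZ₁, flatForm_smul_right, F.unit₁,
      mul_one])

/-- The kernel contains `ker L₁` and in addition `Z`, while `L₁` has rank `m₁`; so the rank drops by
at least one. -/
theorem finrank_range_footDiff [FiniteDimensional ℝ E] (a : ℝ) :
    Module.finrank ℝ (LinearMap.range
      (footDiff c₁ p₁ η₁ a L₁ D₁ ((flatFormL c₁ m₁ η₁).comp L₁)).toLinearMap) + 1 ≤ m₁ := by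
  set T := footDiff c₁ p₁ η₁ a L₁ D₁ ((flatFormL c₁ m₁ η₁).comp L₁)
  obtain ⟨Z, hZ₁, hZ₂⟩ := F.exists_direction
  have hη : η₁ ≠ 0 := by
    rintro rfl
    have := F.unit₁
    rw [flatForm_zero_left] at this
    exact zero_ne_one this
  have hlt : LinearMap.ker L₁.toLinearMap < LinearMap.ker T.toLinearMap := by
    refine SetLike.lt_iff_le_and_exists.2 ⟨fun X hX => F.footDiff_of_ker a hX, Z,
      F.footDiff_of_direction a hZ₁ hZ₂, fun hZ => ?_⟩
    have h0 : L₁ Z = 0 := hZ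
    rw [hZ₁] at h0
    exact (smul_eq_zero.1 h0).elim F.q_pos.ne' hη
  have h1 := Submodule.finrank_lt_finrank_of_lt hlt
  have h2 := L₁.toLinearMap.finrank_range_add_finrank_ker
  have h3 := T.toLinearMap.finrank_range_add_finrank_ker
  have h4 : LinearMap.range L₁.toLinearMap = tangentSub c₁ p₁ := by
    refine le_antisymm ?_ fun w hw => F.exists_diff_eq hw
    rintro _ ⟨X, rfl⟩
    exact F.diff_mem₁ X
  rw [h4, finrank_tangentSub c₁ F.mem₁] at h2
  omega

/-- If `ω`, `ℓ₁ T₁` and `ℓ₂ T₂` have no common zero, where `T₁` and `T₂` are the differentials of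
the two foot points, then `ℓ₁` is injective on the range of `T₁`. -/
theorem footDiff_eq_zero {W₁ W₂ : Type*} [AddCommGroup W₁] [Module ℝ W₁]
    [AddCommGroup W₂] [Module ℝ W₂] {a b : ℝ}
    (ℓ₁ : Ambient c₁ m₁ × Ambient c₁ m₁ →ₗ[ℝ] W₁) (ℓ₂ : Ambient c₂ m₂ × Ambient c₂ m₂ →ₗ[ℝ] W₂)
    (hinj : ∀ X, q * flatForm c₁ η₁ (L₁ X) + p * flatForm c₂ η₂ (L₂ X) = 0 →
      ℓ₁ (footDiff c₁ p₁ η₁ a L₁ D₁ ((flatFormL c₁ m₁ η₁).comp L₁) X) = 0 →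
      ℓ₂ (footDiff c₂ p₂ η₂ b L₂ D₂ ((flatFormL c₂ m₂ η₂).comp L₂) X) = 0 → X = 0) {X : E}
    (hX : ℓ₁ (footDiff c₁ p₁ η₁ a L₁ D₁ ((flatFormL c₁ m₁ η₁).comp L₁) X) = 0) :
    footDiff c₁ p₁ η₁ a L₁ D₁ ((flatFormL c₁ m₁ η₁).comp L₁) X = 0 := by
  obtain ⟨Z, hZ₁, hZ₂⟩ := F.exists_direction
  -- Only the component `X₁ ∈ ker L₂` contributes to the first foot point, and `X₁` is invisible to
  -- `ω` and to the second foot point.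
  obtain ⟨X₁, X₂, h1, h2, hdec⟩ := F.exists_decomposition hZ₁ hZ₂ X
  have e : footDiff c₁ p₁ η₁ a L₁ D₁ ((flatFormL c₁ m₁ η₁).comp L₁) X =
      footDiff c₁ p₁ η₁ a L₁ D₁ ((flatFormL c₁ m₁ η₁).comp L₁) X₁ := by
    rw [hdec, map_add, map_add, map_smul, F.footDiff_of_ker a h2,
      F.footDiff_of_direction a hZ₁ hZ₂, smul_zero, add_zero, add_zero]
  have hX₁ : X₁ = 0 := by
    refine hinj X₁ ?_ (by rw [← e, hX]) (by rw [F.swap.footDiff_of_ker b h1, map_zero])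
    rw [h1, F.alpha_eq_zero h1, flatForm_zero_right]
    ring
  rw [e, hX₁, map_zero]

end Frame


/-! ### Adapted coordinates -/

section AdaptedCoordinates

variable {E : Type*} [NormedAddCommGroup E] [NormedSpace ℝ E]
  {F₁ : Type*} [NormedAddCommGroup F₁] [NormedSpace ℝ F₁]
  {F₂ : Type*} [NormedAddCommGroup F₂] [NormedSpace ℝ F₂]
  {c₁ c₂ : ℝ} {m₁ m₂ : ℕ} {O : Set E} {f N : E → Ambient c₁ m₁ × Ambient c₂ m₂}

/-- Coordinates `(s, u₁, u₂)` such that `s` is the arc length along the distinguished direction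
and the foot points of the two components of `f` depend only on `u₁` and `u₂`, respectively. -/
structure AdaptedCoordinates (O : Set E) (f N : E → Ambient c₁ m₁ × Ambient c₂ m₂)
    (a b : E → ℝ) (Φ : ℝ × F₁ × F₂ → E) (r : ℝ) : Prop where
  smooth : ContDiffOn ℝ ∞ Φ (Metric.ball 0 r)
  mapsTo : ∀ w ∈ Metric.ball 0 r, Φ w ∈ O
  injOn : Set.InjOn Φ (Metric.ball 0 r)
  bijective : ∀ w ∈ Metric.ball 0 r, Function.Bijective (fderiv ℝ Φ w)
  smooth_a : ContDiffOn ℝ ∞ a O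
  smooth_b : ContDiffOn ℝ ∞ b O
  a_zero : a (Φ 0) = 0
  b_zero : b (Φ 0) = 0
  diff_a : ∀ w ∈ Metric.ball 0 r, ∀ v, fderiv ℝ a (Φ w) (fderiv ℝ Φ w v) = v.1 * len₂ N (Φ w)
  diff_b : ∀ w ∈ Metric.ball 0 r, ∀ v, fderiv ℝ b (Φ w) (fderiv ℝ Φ w v) = v.1 * len₁ N (Φ w)
  diff_len₁ : ∀ w ∈ Metric.ball 0 r, ∀ v, v.1 = 0 →
    fderiv ℝ (len₁ N) (Φ w) (fderiv ℝ Φ w v) = 0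
  diff_len₂ : ∀ w ∈ Metric.ball 0 r, ∀ v, v.1 = 0 →
    fderiv ℝ (len₂ N) (Φ w) (fderiv ℝ Φ w v) = 0
  diff_foot₁ : ∀ w ∈ Metric.ball 0 r, ∀ v, v.2.1 = 0 →
    fderiv ℝ (footPoint c₁ (fun x => (f x).1) (dir₁ N) a) (Φ w) (fderiv ℝ Φ w v) = 0
  diff_foot₂ : ∀ w ∈ Metric.ball 0 r, ∀ v, v.2.2 = 0 →
    fderiv ℝ (footPoint c₂ (fun x => (f x).2) (dir₂ N) b) (Φ w) (fderiv ℝ Φ w v) = 0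
  normal₁ : ∀ w ∈ Metric.ball 0 r, ∀ v, v.1 = 0 →
    flatForm c₁ (dir₁ N (Φ w)) (fderiv ℝ f (Φ w) (fderiv ℝ Φ w v)).1 = 0
  normal₂ : ∀ w ∈ Metric.ball 0 r, ∀ v, v.1 = 0 →
    flatForm c₂ (dir₂ N (Φ w)) (fderiv ℝ f (Φ w) (fderiv ℝ Φ w v)).2 = 0
  inj₁ : ∀ w ∈ Metric.ball 0 r, ∀ v, (fderiv ℝ f (Φ w) (fderiv ℝ Φ w v)).1 = 0 → v.2.1 = 0
  inj₂ : ∀ w ∈ Metric.ball 0 r, ∀ v, (fderiv ℝ f (Φ w) (fderiv ℝ Φ w v)).2 = 0 → v.2.2 = 0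

/-- The coordinate map consists of a primitive of `ω` and linear images of the two foot points. The
projections `ℓ₁`, `ℓ₂` are chosen at `x₀`; wherever the coordinate map is a local diffeomorphism
they are automatically injective on the ranges of the foot point differentials
(`Frame.footDiff_eq_zero`), so no constant rank theorem is needed. -/
theorem AdaptedHypersurface.exists_adaptedCoordinates [FiniteDimensional ℝ E]
    [FiniteDimensional ℝ F₁] [FiniteDimensional ℝ F₂] (h : AdaptedHypersurface O f N)
    (hdim : m₁ + m₂ = Module.finrank ℝ E + 1) (h₁ : Module.finrank ℝ F₁ + 1 = m₁)
    (h₂ : Module.finrank ℝ F₂ + 1 = m₂) (hconv : Convex ℝ O) {x₀ : E} (hx₀ : x₀ ∈ O) :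
    ∃ (a b : E → ℝ) (Φ : ℝ × F₁ × F₂ → E) (r : ℝ), 0 < r ∧ Φ 0 = x₀ ∧
      AdaptedCoordinates O f N a b Φ r := by
  have hO := h.isOpen
  have hf₁ : ContDiffOn ℝ ∞ (fun x => (f x).1) O := h.smooth.fst
  have hf₂ : ContDiffOn ℝ ∞ (fun x => (f x).2) O := h.smooth.snd
  have df₁ : ∀ x ∈ O, HasFDerivAt (fun x => (f x).1)
    ((ContinuousLinearMap.fst ℝ _ _).comp (fderiv ℝ f x)) x := fun x hx => (h.hasFDerivAt hx).fst
  have df₂ : ∀ x ∈ O, HasFDerivAt (fun x => (f x).2)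
    ((ContinuousLinearMap.snd ℝ _ _).comp (fderiv ℝ f x)) x := fun x hx => (h.hasFDerivAt hx).snd
  have dη₁ := fun x (hx : x ∈ O) => h.hasFDerivAt_of_contDiffOn h.contDiffOn_dir₁ hx
  have dη₂ := fun x (hx : x ∈ O) => h.hasFDerivAt_of_contDiffOn h.contDiffOn_dir₂ hx
  have hF := fun x (hx : x ∈ O) => h.frame hdim hx
  obtain ⟨a, ha, ha0, da⟩ := exists_potential (flatFormL c₁ m₁) hO hconv h.contDiffOn_dir₁ hf₁
    (fun x hx X Y => by
      rw [(df₁ x hx).fderiv]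
      exact (hF x hx).alpha_symm X Y) x₀
  obtain ⟨b, hb, hb0, db⟩ := exists_potential (flatFormL c₂ m₂) hO hconv h.contDiffOn_dir₂ hf₂
    (fun x hx X Y => by
      rw [(df₂ x hx).fderiv]
      exact (hF x hx).swap.alpha_symm X Y) x₀
  -- This vector field is `df Z`, and pairing it with `df` gives `ω`.
  have hη : ContDiffOn ℝ ∞ (fun x => (len₂ N x • dir₁ N x, len₁ N x • dir₂ N x)) O :=
    (h.contDiffOn_len₂.smul h.contDiffOn_dir₁).prodMk (h.contDiffOn_len₁.smul h.contDiffOn_dir₂)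
  obtain ⟨σ, hσ, hσ0, dσ⟩ := exists_potential (prodFormL c₁ c₂ m₁ m₂) hO hconv hη h.smooth
    (fun x hx X Y => by
      have dη := ((h.hasFDerivAt_of_contDiffOn h.contDiffOn_len₂ hx).smul (dη₁ x hx)).prodMk
        ((h.hasFDerivAt_of_contDiffOn h.contDiffOn_len₁ hx).smul (dη₂ x hx))
      have e : ∀ X, fderiv ℝ (fun x => (len₂ N x • dir₁ N x, len₁ N x • dir₂ N x)) x X =
        (len₂ N x • fderiv ℝ (dir₁ N) x X + fderiv ℝ (len₂ N) x X • dir₁ N x,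
          len₁ N x • fderiv ℝ (dir₂ N) x X + fderiv ℝ (len₁ N) x X • dir₂ N x) :=
        fun X => DFunLike.congr_fun (HasFDerivAt.fderiv dη) X
      have e1 : flatForm c₁ (fderiv ℝ (dir₁ N) x X) (fderiv ℝ f x Y).1 =
        flatForm c₁ (fderiv ℝ (dir₁ N) x Y) (fderiv ℝ f x X).1 := (hF x hx).alpha_symm X Y
      have e2 : flatForm c₂ (fderiv ℝ (dir₂ N) x X) (fderiv ℝ f x Y).2 =
        flatForm c₂ (fderiv ℝ (dir₂ N) x Y) (fderiv ℝ f x X).2 := (hF x hx).swap.alpha_symm X Y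
      have e3 : fderiv ℝ (len₂ N) x X * flatForm c₁ (dir₁ N x) (fderiv ℝ f x Y).1 +
          fderiv ℝ (len₁ N) x X * flatForm c₂ (dir₂ N x) (fderiv ℝ f x Y).2 =
        fderiv ℝ (len₂ N) x Y * flatForm c₁ (dir₁ N x) (fderiv ℝ f x X).1 +
          fderiv ℝ (len₁ N) x Y * flatForm c₂ (dir₂ N x) (fderiv ℝ f x X).2 :=
        (hF x hx).omega_symm X Y
      simp only [e, prodFormL_apply, prodForm, flatForm_add_left, flatForm_smul_left]
      linear_combination len₂ N x * e1 + len₁ N x * e2 + e3) x₀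
  have dσ' : ∀ x ∈ O, ∀ X, fderiv ℝ σ x X = len₂ N x * flatForm c₁ (dir₁ N x) (fderiv ℝ f x X).1 +
      len₁ N x * flatForm c₂ (dir₂ N x) (fderiv ℝ f x X).2 := by
    intro x hx X
    rw [(dσ x hx).fderiv]
    simp only [ContinuousLinearMap.comp_apply, prodFormL_apply, prodForm, flatForm_smul_left]
  have da' : ∀ x ∈ O, HasFDerivAt a ((flatFormL c₁ m₁ (dir₁ N x)).comp
      ((ContinuousLinearMap.fst ℝ _ _).comp (fderiv ℝ f x))) x := fun x hx => by
    rw [← (df₁ x hx).fderiv]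
    exact da x hx
  have db' : ∀ x ∈ O, HasFDerivAt b ((flatFormL c₂ m₂ (dir₂ N x)).comp
      ((ContinuousLinearMap.snd ℝ _ _).comp (fderiv ℝ f x))) x := fun x hx => by
    rw [← (df₂ x hx).fderiv]
    exact db x hx
  have dG₁ := fun x (hx : x ∈ O) => hasFDerivAt_footPoint (df₁ x hx) (dη₁ x hx) (da' x hx)
  have dG₂ := fun x (hx : x ∈ O) => hasFDerivAt_footPoint (df₂ x hx) (dη₂ x hx) (db' x hx)
  have hG₁ := contDiffOn_footPoint hf₁ h.contDiffOn_dir₁ ha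
  have hG₂ := contDiffOn_footPoint hf₂ h.contDiffOn_dir₂ hb
  set G₁ := footPoint c₁ (fun x => (f x).1) (dir₁ N) a
  set G₂ := footPoint c₂ (fun x => (f x).2) (dir₂ N) b
  -- The ranks of the foot point differentials at `x₀` are at most the dimensions of `F₁` and `F₂`.
  obtain ⟨ℓ₁, hℓ₁⟩ := exists_clm_injective_on_range (F := F₁) _
    (Nat.le_of_succ_le_succ (((hF x₀ hx₀).finrank_range_footDiff (a x₀)).trans h₁.ge))
  obtain ⟨ℓ₂, hℓ₂⟩ := exists_clm_injective_on_range (F := F₂) _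
    (Nat.le_of_succ_le_succ (((hF x₀ hx₀).swap.finrank_range_footDiff (b x₀)).trans h₂.ge))
  set Ψ : E → ℝ × F₁ × F₂ := fun x => (σ x, ℓ₁ (G₁ x) - ℓ₁ (G₁ x₀), ℓ₂ (G₂ x) - ℓ₂ (G₂ x₀))
  have hΨ : ContDiffOn ℝ ∞ Ψ O := hσ.prodMk
    (((ℓ₁.contDiff.comp_contDiffOn hG₁).sub contDiffOn_const).prodMk
      ((ℓ₂.contDiff.comp_contDiffOn hG₂).sub contDiffOn_const))
  have dΨ : ∀ x ∈ O, ∀ X, fderiv ℝ Ψ x X =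
      (fderiv ℝ σ x X, ℓ₁ (fderiv ℝ G₁ x X), ℓ₂ (fderiv ℝ G₂ x X)) := by
    intro x hx X
    have d : HasFDerivAt Ψ _ x := (dσ x hx).prodMk
      (((ℓ₁.hasFDerivAt.comp x (dG₁ x hx)).sub_const _).prodMk
        ((ℓ₂.hasFDerivAt.comp x (dG₂ x hx)).sub_const _))
    rw [d.fderiv, (dσ x hx).fderiv, (dG₁ x hx).fderiv, (dG₂ x hx).fderiv]
    rfl
  have hΨ0 : Ψ x₀ = 0 := by simp [Ψ, hσ0]
  have hfin : Module.finrank ℝ E = Module.finrank ℝ (ℝ × F₁ × F₂) := by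
    rw [Module.finrank_prod, Module.finrank_prod, Module.finrank_self]
    omega
  obtain ⟨W, Φ, hW, hW0, hΦ, hΦ0, hΦO, hΨΦ⟩ := exists_smooth_localInverse hfin hO hΨ hx₀ (by
    intro X hX
    rw [dΨ x₀ hx₀, dσ' x₀ hx₀, (dG₁ x₀ hx₀).fderiv, (dG₂ x₀ hx₀).fderiv] at hX
    have e0 := congrArg Prod.fst hX
    have e1 := hℓ₁ X (congrArg (fun w => w.2.1) hX)
    have e2 := hℓ₂ X (congrArg (fun w => w.2.2) hX)
    -- Vanishing of `ω X` forces `α X = β X = 0`; the times are then frozen and the foot point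
    -- differentials detect `df₁ X` and `df₂ X`.
    have e3 := (hF x₀ hx₀).alpha_eq X
    have e4 := (hF x₀ hx₀).beta_eq X
    simp only [ContinuousLinearMap.comp_apply, ContinuousLinearMap.coe_fst',
      ContinuousLinearMap.coe_snd'] at e0 e3 e4
    rw [e0, Prod.fst_zero, mul_zero] at e3 e4
    exact (hF x₀ hx₀).inj X (eq_zero_of_footDiff_eq_zero e1 e3)
      (eq_zero_of_footDiff_eq_zero e2 e4))
  rw [hΨ0] at hW0 hΦ0
  obtain ⟨r, hr, hrW⟩ := Metric.isOpen_iff.1 hW 0 hW0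
  have hdΦ : ∀ w ∈ Metric.ball 0 r, HasFDerivAt Φ (fderiv ℝ Φ w) w := fun w hw =>
    ((hΦ.contDiffAt (hW.mem_nhds (hrW hw))).differentiableAt (by simp)).hasFDerivAt
  have hcomp : ∀ w ∈ Metric.ball 0 r, ∀ v, fderiv ℝ Ψ (Φ w) (fderiv ℝ Φ w v) = v := by
    intro w hw v
    have hd : HasFDerivAt Ψ (fderiv ℝ Ψ (Φ w)) (Φ w) :=
      h.hasFDerivAt_of_contDiffOn hΨ (hΦO w (hrW hw))
    have h1 := (hd.comp w (hdΦ w hw)).unique ((hasFDerivAt_id w).congr_of_eventuallyEq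
      (Filter.mem_of_superset (hW.mem_nhds (hrW hw)) fun y hy => hΨΦ y hy))
    exact DFunLike.congr_fun h1 v
  have hbij : ∀ w ∈ Metric.ball 0 r, Function.Bijective (fderiv ℝ Φ w) := by
    intro w hw
    have hi : Function.Injective (fderiv ℝ Φ w).toLinearMap :=
      (Function.LeftInverse.injective (g := fderiv ℝ Ψ (Φ w)) (hcomp w hw) :)
    exact ⟨hi, (LinearMap.injective_iff_surjective_of_finrank_eq_finrank hfin.symm).1 hi⟩
  have hinj : ∀ w ∈ Metric.ball 0 r, ∀ X, fderiv ℝ Ψ (Φ w) X = 0 → X = 0 := by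
    intro w hw X hX
    obtain ⟨v, rfl⟩ := (hbij w hw).2 X
    rw [hcomp w hw] at hX
    rw [hX, map_zero]
  have hv : ∀ w ∈ Metric.ball 0 r, ∀ v, fderiv ℝ σ (Φ w) (fderiv ℝ Φ w v) = v.1 ∧
      ℓ₁ (fderiv ℝ G₁ (Φ w) (fderiv ℝ Φ w v)) = v.2.1 ∧
      ℓ₂ (fderiv ℝ G₂ (Φ w) (fderiv ℝ Φ w v)) = v.2.2 := by
    intro w hw v
    have := hcomp w hw v
    rw [dΨ _ (hΦO w (hrW hw))] at this
    exact ⟨congrArg Prod.fst this, congrArg (fun w => w.2.1) this,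
      congrArg (fun w => w.2.2) this⟩
  -- The hypothesis of `Frame.footDiff_eq_zero`, now available on the whole ball.
  have hinj' : ∀ w ∈ Metric.ball 0 r, ∀ X, fderiv ℝ σ (Φ w) X = 0 →
      ℓ₁ (fderiv ℝ G₁ (Φ w) X) = 0 → ℓ₂ (fderiv ℝ G₂ (Φ w) X) = 0 → X = 0 := by
    intro w hw X e0 e1 e2
    refine hinj w hw X ?_
    rw [dΨ _ (hΦO w (hrW hw)), e0, e1, e2]
    rfl
  have hmem : ∀ w ∈ Metric.ball (0 : ℝ × F₁ × F₂) r, Φ w ∈ O := fun w hw => hΦO w (hrW hw)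
  refine ⟨a, b, Φ, r, hr, hΦ0, hΦ.mono hrW, hmem, ?_, hbij, ha, hb, by rw [hΦ0, ha0],
    by rw [hΦ0, hb0], ?_, ?_, ?_, ?_, ?_, ?_, ?_, ?_, ?_, ?_⟩
  · intro w hw w' hw' e
    rw [← hΨΦ w (hrW hw), e, hΨΦ w' (hrW hw')]
  · intro w hw v
    rw [← (hv w hw v).1, dσ' _ (hmem w hw), (da' _ (hmem w hw)).fderiv, mul_comm]
    exact (hF _ (hmem w hw)).alpha_eq _
  · intro w hw v
    rw [← (hv w hw v).1, dσ' _ (hmem w hw), (db' _ (hmem w hw)).fderiv, mul_comm]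
    exact (hF _ (hmem w hw)).beta_eq _
  · intro w hw v h0
    obtain ⟨Z, hZ₁, hZ₂⟩ := (hF _ (hmem w hw)).exists_direction
    have e := (hv w hw v).1
    rw [h0, dσ' _ (hmem w hw)] at e
    refine ((hF _ (hmem w hw)).diff_p_eq hZ₁ hZ₂ _).trans ?_
    exact (congrArg (· * _) e).trans (zero_mul _)
  · intro w hw v h0
    obtain ⟨Z, hZ₁, hZ₂⟩ := (hF _ (hmem w hw)).exists_direction
    have e := (hv w hw v).1
    rw [h0, dσ' _ (hmem w hw)] at e
    refine ((hF _ (hmem w hw)).diff_q_eq hZ₁ hZ₂ _).trans ?_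
    exact (congrArg (· * _) e).trans (zero_mul _)
  · intro w hw v h0
    have hx := hmem w hw
    have e := (hv w hw v).2.1
    have hi := hinj' w hw
    simp only [dσ' _ hx] at hi
    rw [h0] at e
    rw [(dG₁ _ hx).fderiv] at e hi ⊢
    rw [(dG₂ _ hx).fderiv] at hi
    exact (hF _ hx).footDiff_eq_zero ℓ₁.toLinearMap ℓ₂.toLinearMap hi e
  · intro w hw v h0
    have hx := hmem w hw
    have e := (hv w hw v).2.2
    have hi := hinj' w hw
    simp only [dσ' _ hx] at hi
    rw [h0] at e
    rw [(dG₂ _ hx).fderiv] at e hi ⊢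
    rw [(dG₁ _ hx).fderiv] at hi
    exact (hF _ hx).swap.footDiff_eq_zero ℓ₂.toLinearMap ℓ₁.toLinearMap
      (fun X e0 e1 e2 => hi X ((add_comm _ _).trans e0) e2 e1) e
  · intro w hw v h0
    have e := (hv w hw v).1
    rw [h0, dσ' _ (hmem w hw)] at e
    exact ((hF _ (hmem w hw)).alpha_eq _).trans ((congrArg (_ * ·) e).trans (mul_zero _))
  · intro w hw v h0
    have e := (hv w hw v).1
    rw [h0, dσ' _ (hmem w hw)] at e
    exact ((hF _ (hmem w hw)).beta_eq _).trans ((congrArg (_ * ·) e).trans (mul_zero _))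
  · intro w hw v h0
    have hx := hmem w hw
    rw [← (hv w hw v).2.1, (dG₁ _ hx).fderiv, (hF _ hx).footDiff_of_ker (a _) h0, map_zero]
  · intro w hw v h0
    have hx := hmem w hw
    rw [← (hv w hw v).2.2, (dG₂ _ hx).fderiv, (hF _ hx).swap.footDiff_of_ker (b _) h0, map_zero]

end AdaptedCoordinates


/-! ### The angle and the profiles in adapted coordinates -/

section Ball

variable {F₁ F₂ : Type*} [NormedAddCommGroup F₁] [NormedAddCommGroup F₂] {r : ℝ}

theorem mem_ball_prod_iff {w : ℝ × F₁ × F₂} :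
    w ∈ Metric.ball (0 : ℝ × F₁ × F₂) r ↔ w.1 ∈ Set.Ioo (-r) r ∧ w.2.1 ∈ Metric.ball (0 : F₁) r ∧
      w.2.2 ∈ Metric.ball (0 : F₂) r := by
  simp [Prod.norm_def, abs_lt]

theorem line_mem_ball {s : ℝ} (hs : s ∈ Set.Ioo (-r) r) :
    ((s, 0, 0) : ℝ × F₁ × F₂) ∈ Metric.ball 0 r := by
  have hr : 0 < r := by linarith [hs.1, hs.2]
  rw [mem_ball_prod_iff]
  simp [hs.1, hs.2, hr]

theorem slice₁_mem_ball {s : ℝ} {u : F₁} (hs : s ∈ Set.Ioo (-r) r) (hu : u ∈ Metric.ball 0 r) :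
    ((s, u, 0) : ℝ × F₁ × F₂) ∈ Metric.ball 0 r :=
  mem_ball_prod_iff.2 ⟨hs, hu, Metric.mem_ball_self (Metric.pos_of_mem_ball hu)⟩

theorem slice₂_mem_ball {s : ℝ} {u : F₂} (hs : s ∈ Set.Ioo (-r) r) (hu : u ∈ Metric.ball 0 r) :
    ((s, 0, u) : ℝ × F₁ × F₂) ∈ Metric.ball 0 r :=
  mem_ball_prod_iff.2 ⟨hs, Metric.mem_ball_self (Metric.pos_of_mem_ball hu), hu⟩

theorem sqrt_one_add_div_sq {p q : ℝ} (hp : 0 < q) (h1 : p ^ 2 + q ^ 2 = 1) :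
    √(1 + (p / q) ^ 2) = q⁻¹ := by
  have : 1 + (p / q) ^ 2 = q⁻¹ ^ 2 := by
    field_simp
    linarith
  rw [this, Real.sqrt_sq (by positivity)]

end Ball

section Profiles

variable {E : Type*} [NormedAddCommGroup E] [NormedSpace ℝ E]
  {F₁ : Type*} [NormedAddCommGroup F₁] [NormedSpace ℝ F₁]
  {F₂ : Type*} [NormedAddCommGroup F₂] [NormedSpace ℝ F₂]
  {c₁ c₂ : ℝ} {m₁ m₂ : ℕ} {O : Set E} {f N : E → Ambient c₁ m₁ × Ambient c₂ m₂}
  {a b : E → ℝ} {Φ : ℝ × F₁ × F₂ → E} {r : ℝ}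

/-- The slice `u₁ ↦ (f (0, u₁, 0)).1`. -/
def profile₁ (f : E → Ambient c₁ m₁ × Ambient c₂ m₂) (Φ : ℝ × F₁ × F₂ → E) (u : F₁) :
    Ambient c₁ m₁ :=
  (f (Φ (0, u, 0))).1

/-- The slice `u₂ ↦ (f (0, 0, u₂)).2`. -/
def profile₂ (f : E → Ambient c₁ m₁ × Ambient c₂ m₂) (Φ : ℝ × F₁ × F₂ → E) (u : F₂) :
    Ambient c₂ m₂ :=
  (f (Φ (0, 0, u))).2

/-- The unit normal field of `profile₁`. -/
noncomputable def profileNormal₁ (N : E → Ambient c₁ m₁ × Ambient c₂ m₂) (Φ : ℝ × F₁ × F₂ → E)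
    (u : F₁) : Ambient c₁ m₁ :=
  dir₁ N (Φ (0, u, 0))

/-- The unit normal field of `profile₂`. -/
noncomputable def profileNormal₂ (N : E → Ambient c₁ m₁ × Ambient c₂ m₂) (Φ : ℝ × F₁ × F₂ → E)
    (u : F₂) : Ambient c₂ m₂ :=
  dir₂ N (Φ (0, 0, u))

/-- The angle between the unit normal and the second factor. -/
noncomputable def angle (N : E → Ambient c₁ m₁ × Ambient c₂ m₂) (Φ : ℝ × F₁ × F₂ → E)
    (s : ℝ) : ℝ :=
  Real.arctan (len₁ N (Φ (s, 0, 0)) / len₂ N (Φ (s, 0, 0)))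

namespace AdaptedCoordinates

variable (C : AdaptedCoordinates O f N a b Φ r) (h : AdaptedHypersurface O f N)

include C

theorem hasFDerivAt {w : ℝ × F₁ × F₂} (hw : w ∈ Metric.ball 0 r) :
    HasFDerivAt Φ (fderiv ℝ Φ w) w :=
  ((C.smooth.contDiffAt (Metric.isOpen_ball.mem_nhds hw)).differentiableAt (by simp)).hasFDerivAt

theorem contDiffOn_comp {V : Type*} [NormedAddCommGroup V] [NormedSpace ℝ V] {G : E → V}
    (hG : ContDiffOn ℝ ∞ G O) {F : Type*} [NormedAddCommGroup F] [NormedSpace ℝ F]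
    (ι : F →L[ℝ] ℝ × F₁ × F₂) {U : Set F} (hU : ∀ u ∈ U, ι u ∈ Metric.ball 0 r) :
    ContDiffOn ℝ ∞ (fun u => G (Φ (ι u))) U :=
  hG.comp (C.smooth.comp ι.contDiff.contDiffOn hU) fun u hu => C.mapsTo _ (hU u hu)

include h

theorem hasFDerivAt_comp {V : Type*} [NormedAddCommGroup V] [NormedSpace ℝ V] {G : E → V}
    (hG : ContDiffOn ℝ ∞ G O) {w : ℝ × F₁ × F₂} (hw : w ∈ Metric.ball 0 r) :
    HasFDerivAt (fun w => G (Φ w)) ((fderiv ℝ G (Φ w)).comp (fderiv ℝ Φ w)) w :=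
  (h.hasFDerivAt_of_contDiffOn hG (C.mapsTo w hw)).comp w (C.hasFDerivAt hw)

theorem comp_eq {V W : Type*} [NormedAddCommGroup V] [NormedSpace ℝ V] [NormedAddCommGroup W]
    [NormedSpace ℝ W] {G : E → V}
    (hG : ContDiffOn ℝ ∞ G O) (π : ℝ × F₁ × F₂ →ₗ[ℝ] W)
    (hker : ∀ w ∈ Metric.ball 0 r, ∀ v, π v = 0 → fderiv ℝ G (Φ w) (fderiv ℝ Φ w v) = 0)
    {w w' : ℝ × F₁ × F₂} (hw : w ∈ Metric.ball 0 r) (hw' : w' ∈ Metric.ball 0 r)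
    (hπ : π w = π w') : G (Φ w) = G (Φ w') :=
  eq_of_fderiv_ker_eq_zero (convex_ball 0 r) (G := fun w => G (Φ w))
    (fun _ hw => C.hasFDerivAt_comp h hG hw) π hker hw hw' hπ

theorem len₁_comp {w w' : ℝ × F₁ × F₂} (hw : w ∈ Metric.ball 0 r) (hw' : w' ∈ Metric.ball 0 r)
    (e : w.1 = w'.1) : len₁ N (Φ w) = len₁ N (Φ w') :=
  C.comp_eq h h.contDiffOn_len₁ (LinearMap.fst ℝ ℝ (F₁ × F₂)) C.diff_len₁ hw hw' e

theorem len₂_comp {w w' : ℝ × F₁ × F₂} (hw : w ∈ Metric.ball 0 r) (hw' : w' ∈ Metric.ball 0 r)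
    (e : w.1 = w'.1) : len₂ N (Φ w) = len₂ N (Φ w') :=
  C.comp_eq h h.contDiffOn_len₂ (LinearMap.fst ℝ ℝ (F₁ × F₂)) C.diff_len₂ hw hw' e

/-- The angle is defined on the axis `u₁ = u₂ = 0`, but the lengths of the components of the normal
depend only on `s`. -/
theorem sin_angle {w : ℝ × F₁ × F₂} (hw : w ∈ Metric.ball 0 r) :
    Real.sin (angle N Φ w.1) = len₁ N (Φ w) := by
  have hl : (w.1, 0, 0) ∈ Metric.ball (0 : ℝ × F₁ × F₂) r :=
    line_mem_ball (mem_ball_prod_iff.1 hw).1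
  have hx := C.mapsTo _ hl
  rw [angle, Real.sin_arctan, sqrt_one_add_div_sq (h.len₂_pos hx) (h.sq_add hx), div_inv_eq_mul,
    div_mul_cancel₀ _ (h.len₂_pos hx).ne', C.len₁_comp h hw hl rfl]

theorem cos_angle {w : ℝ × F₁ × F₂} (hw : w ∈ Metric.ball 0 r) :
    Real.cos (angle N Φ w.1) = len₂ N (Φ w) := by
  have hl : (w.1, 0, 0) ∈ Metric.ball (0 : ℝ × F₁ × F₂) r :=
    line_mem_ball (mem_ball_prod_iff.1 hw).1
  have hx := C.mapsTo _ hl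
  rw [angle, Real.cos_arctan, sqrt_one_add_div_sq (h.len₂_pos hx) (h.sq_add hx), one_div, inv_inv,
    C.len₂_comp h hw hl rfl]

theorem angle_mem {s : ℝ} (hs : s ∈ Set.Ioo (-r) r) :
    angle N Φ s ∈ Set.Ioo 0 (Real.pi / 2) := by
  have hx := C.mapsTo _ (line_mem_ball hs)
  exact ⟨Real.arctan_pos.2 (div_pos (h.len₁_pos hx) (h.len₂_pos hx)),
    Real.arctan_lt_pi_div_two _⟩

theorem contDiffOn_angle : ContDiffOn ℝ ∞ (angle N Φ) (Set.Ioo (-r) r) := by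
  have hp := C.contDiffOn_comp h.contDiffOn_len₁ (ContinuousLinearMap.inl ℝ ℝ (F₁ × F₂))
    (U := Set.Ioo (-r) r) fun s hs => line_mem_ball hs
  have hq := C.contDiffOn_comp h.contDiffOn_len₂ (ContinuousLinearMap.inl ℝ ℝ (F₁ × F₂))
    (U := Set.Ioo (-r) r) fun s hs => line_mem_ball hs
  exact Real.contDiff_arctan.comp_contDiffOn
    (hp.div hq fun s hs => (h.len₂_pos (C.mapsTo _ (line_mem_ball hs))).ne')

theorem hasDerivAt_line {G : E → ℝ} (hG : ContDiffOn ℝ ∞ G O) {s : ℝ}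
    (hs : s ∈ Set.Ioo (-r) r) :
    HasDerivAt (fun s => G (Φ (s, 0, 0)))
      (fderiv ℝ G (Φ (s, 0, 0)) (fderiv ℝ Φ (s, 0, 0) (1, 0, 0))) s := by
  have h1 : HasDerivAt (fun s : ℝ => ((s, 0, 0) : ℝ × F₁ × F₂)) (1, 0, 0) s :=
    (hasDerivAt_id s).prodMk (hasDerivAt_const s 0)
  exact HasFDerivAt.comp_hasDerivAt (f := fun s : ℝ => ((s, 0, 0) : ℝ × F₁ × F₂)) s
    (C.hasFDerivAt_comp h hG (line_mem_ball hs)) h1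

/-- On the axis `a` vanishes at `0` and has derivative `q = cos θ`; off the axis its value depends
only on `s`. -/
theorem intCos_angle {w : ℝ × F₁ × F₂} (hw : w ∈ Metric.ball 0 r) :
    intCos (angle N Φ) w.1 = a (Φ w) := by
  have hs := (mem_ball_prod_iff.1 hw).1
  have hsub := uIcc_zero_subset hs
  have e := intervalIntegral.integral_eq_sub_of_hasDerivAt (a := 0) (b := w.1)
    (f := fun s => a (Φ (s, 0, 0))) (f' := fun s => Real.cos (angle N Φ s))
    (fun s hs' => by
      have := C.hasDerivAt_line h C.smooth_a (hsub hs')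
      rwa [C.diff_a _ (line_mem_ball (hsub hs')), one_mul,
        ← C.cos_angle h (line_mem_ball (hsub hs'))] at this)
    ((Real.continuous_cos.comp_continuousOn
      (C.contDiffOn_angle h).continuousOn).mono hsub).intervalIntegrable
  have e0 : a (Φ (0, 0, 0)) = 0 := C.a_zero
  rw [intCos, e, e0, sub_zero]
  exact C.comp_eq h C.smooth_a (LinearMap.fst ℝ ℝ (F₁ × F₂))
    (fun w hw v hv => by
      have hv' : v.1 = 0 := hv
      rw [C.diff_a w hw, hv', zero_mul]) (line_mem_ball hs) hw rfl

theorem intSin_angle {w : ℝ × F₁ × F₂} (hw : w ∈ Metric.ball 0 r) :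
    intSin (angle N Φ) w.1 = b (Φ w) := by
  have hs := (mem_ball_prod_iff.1 hw).1
  have hsub := uIcc_zero_subset hs
  have e := intervalIntegral.integral_eq_sub_of_hasDerivAt (a := 0) (b := w.1)
    (f := fun s => b (Φ (s, 0, 0))) (f' := fun s => Real.sin (angle N Φ s))
    (fun s hs' => by
      have := C.hasDerivAt_line h C.smooth_b (hsub hs')
      rwa [C.diff_b _ (line_mem_ball (hsub hs')), one_mul,
        ← C.sin_angle h (line_mem_ball (hsub hs'))] at this)
    ((Real.continuous_sin.comp_continuousOn
      (C.contDiffOn_angle h).continuousOn).mono hsub).intervalIntegrable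
  have e0 : b (Φ (0, 0, 0)) = 0 := C.b_zero
  rw [intSin, e, e0, sub_zero]
  exact C.comp_eq h C.smooth_b (LinearMap.fst ℝ ℝ (F₁ × F₂))
    (fun w hw v hv => by
      have hv' : v.1 = 0 := hv
      rw [C.diff_b w hw, hv', zero_mul]) (line_mem_ball hs) hw rfl

/-- The foot point depends only on `u₁`, and on the slice `s = 0` the time `a` is zero, so there it
is the profile with its normal. -/
theorem foot₁_eq {w : ℝ × F₁ × F₂} (hw : w ∈ Metric.ball 0 r) :
    footPoint c₁ (fun x => (f x).1) (dir₁ N) a (Φ w) =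
      (profile₁ f Φ w.2.1, profileNormal₁ N Φ w.2.1) := by
  have hr := Metric.pos_of_mem_ball hw
  have hw0 : (0, w.2.1, 0) ∈ Metric.ball (0 : ℝ × F₁ × F₂) r :=
    slice₁_mem_ball ⟨by linarith, hr⟩ (mem_ball_prod_iff.1 hw).2.1
  rw [C.comp_eq h (contDiffOn_footPoint h.smooth.fst h.contDiffOn_dir₁ C.smooth_a)
    (LinearMap.fst ℝ F₁ F₂ ∘ₗ LinearMap.snd ℝ ℝ (F₁ × F₂)) C.diff_foot₁ hw hw0 rfl]
  have e : a (Φ (0, w.2.1, 0)) = 0 := by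
    rw [← C.intCos_angle h hw0, intCos, intervalIntegral.integral_same]
  simp [footPoint, parallelMap, parallelNormal, e, profile₁, profileNormal₁, cosC_zero, sinC_zero]

theorem foot₂_eq {w : ℝ × F₁ × F₂} (hw : w ∈ Metric.ball 0 r) :
    footPoint c₂ (fun x => (f x).2) (dir₂ N) b (Φ w) =
      (profile₂ f Φ w.2.2, profileNormal₂ N Φ w.2.2) := by
  have hr := Metric.pos_of_mem_ball hw
  have hw0 : (0, 0, w.2.2) ∈ Metric.ball (0 : ℝ × F₁ × F₂) r :=
    slice₂_mem_ball ⟨by linarith, hr⟩ (mem_ball_prod_iff.1 hw).2.2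
  rw [C.comp_eq h (contDiffOn_footPoint h.smooth.snd h.contDiffOn_dir₂ C.smooth_b)
    (LinearMap.snd ℝ F₁ F₂ ∘ₗ LinearMap.snd ℝ ℝ (F₁ × F₂)) C.diff_foot₂ hw hw0 rfl]
  have e : b (Φ (0, 0, w.2.2)) = 0 := by
    rw [← C.intSin_angle h hw0, intSin, intervalIntegral.integral_same]
  simp [footPoint, parallelMap, parallelNormal, e, profile₂, profileNormal₂, cosC_zero, sinC_zero]

/-- Going forward from the foot point for the time `a` recovers the point. -/
theorem fst_eq {w : ℝ × F₁ × F₂} (hw : w ∈ Metric.ball 0 r) : (f (Φ w)).1 =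
    parallelMap c₁ (profile₁ f Φ) (profileNormal₁ N Φ) (intCos (angle N Φ) w.1) w.2.1 := by
  have e := footPoint_rotate_fst (c := c₁) (fun x => (f x).1) (dir₁ N) a (Φ w)
  rw [C.foot₁_eq h hw, ← C.intCos_angle h hw] at e
  exact e.symm

theorem dir₁_eq {w : ℝ × F₁ × F₂} (hw : w ∈ Metric.ball 0 r) : dir₁ N (Φ w) =
    parallelNormal c₁ (profile₁ f Φ) (profileNormal₁ N Φ) (intCos (angle N Φ) w.1) w.2.1 := by
  have e := footPoint_rotate_snd (c := c₁) (fun x => (f x).1) (dir₁ N) a (Φ w)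
  rw [C.foot₁_eq h hw, ← C.intCos_angle h hw] at e
  exact e.symm

theorem snd_eq {w : ℝ × F₁ × F₂} (hw : w ∈ Metric.ball 0 r) : (f (Φ w)).2 =
    parallelMap c₂ (profile₂ f Φ) (profileNormal₂ N Φ) (intSin (angle N Φ) w.1) w.2.2 := by
  have e := footPoint_rotate_fst (c := c₂) (fun x => (f x).2) (dir₂ N) b (Φ w)
  rw [C.foot₂_eq h hw, ← C.intSin_angle h hw] at e
  exact e.symm

theorem dir₂_eq {w : ℝ × F₁ × F₂} (hw : w ∈ Metric.ball 0 r) : dir₂ N (Φ w) =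
    parallelNormal c₂ (profile₂ f Φ) (profileNormal₂ N Φ) (intSin (angle N Φ) w.1) w.2.2 := by
  have e := footPoint_rotate_snd (c := c₂) (fun x => (f x).2) (dir₂ N) b (Φ w)
  rw [C.foot₂_eq h hw, ← C.intSin_angle h hw] at e
  exact e.symm

end AdaptedCoordinates

end Profiles


/-! ### From adapted coordinates to the angle construction -/

section OpensHypersurface

variable {F : Type*} [NormedAddCommGroup F] [NormedSpace ℝ F] {U : Opens F}
  {V : Type*} [NormedAddCommGroup V] [NormedSpace ℝ V] {S : Set V} {h N : F → V}

theorem ContDiffOn.diffMap_opens (hs : ContDiffOn ℝ ∞ h U) (u : U) :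
    diffMap 𝓘(ℝ, F) (fun u : U => h u) u = fderiv ℝ h u :=
  (HasFDerivAt.hasDiff_opens ((hs.contDiffAt (U.2.mem_nhds u.2)).differentiableAt
    (by simp)).hasFDerivAt).diffMap_eq

theorem isImmersionInto_opens (hs : ContDiffOn ℝ ∞ h U) (hmem : ∀ u ∈ U, h u ∈ S)
    (hinj : ∀ u ∈ U, ∀ v, fderiv ℝ h u v = 0 → v = 0) :
    IsImmersionInto 𝓘(ℝ, F) S (fun u : U => h u) where
  smooth := hs.contMDiff_opens
  mem u := hmem u u.2
  injective_diff u := by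
    rw [hs.diffMap_opens]
    exact (injective_iff_map_eq_zero (fderiv ℝ h u)).2 (hinj u u.2)

theorem isUnitNormalOn_opens {B : V → V → ℝ} {T : V → Set V} (hs : ContDiffOn ℝ ∞ h U)
    (hN : ContDiffOn ℝ ∞ N U) (htan : ∀ u ∈ U, N u ∈ T (h u)) (hunit : ∀ u ∈ U, B (N u) (N u) = 1)
    (hnor : ∀ u ∈ U, ∀ v, B (N u) (fderiv ℝ h u v) = 0) :
    IsUnitNormalOn 𝓘(ℝ, F) B T (fun u : U => h u) (fun u : U => N u) Set.univ where
  smooth := contMDiffOn_univ.2 hN.contMDiff_opens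
  tangent u _ := htan u u.2
  unit u _ := hunit u u.2
  normal u _ v := by
    rw [hs.diffMap_opens]
    exact hnor u u.2 v

end OpensHypersurface

/-! ### The ranges of the functions `a` and `b`. -/

section Surjectivity

theorem image_Ioo_mem_nhds {A A' : ℝ → ℝ} {r : ℝ} (hr : 0 < r)
    (hA : ContDiffOn ℝ ∞ A (Set.Ioo (-r) r)) (hd : HasDerivAt A (A' 0) 0) (h0 : A 0 = 0)
    (hA' : A' 0 ≠ 0) : A '' Set.Ioo (-r) r ∈ nhds 0 := by
  have hm : Set.Ioo (-r) r ∈ nhds (0 : ℝ) := Ioo_mem_nhds (by linarith) hr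
  have h1 := ((hA.contDiffAt hm).hasStrictDerivAt' hd (by simp)).map_nhds_eq hA'
  rw [h0] at h1
  rw [← h1]
  exact Filter.image_mem_map hm

/-- At `0` the derivatives `cos θ` and `sin θ` of `a` and `b` are nonzero, so both functions attain
all small values. This is needed because the parallel hypersurfaces of the profiles are visible in
`f` only at the times `a(s)` and `b(s)`. -/
theorem exists_Ioo_subset_intCos_intSin {θ : ℝ → ℝ} {r : ℝ} (hr : 0 < r)
    (hθ : ContDiffOn ℝ ∞ θ (Set.Ioo (-r) r)) (h0 : θ 0 ∈ Set.Ioo 0 (Real.pi / 2)) :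
    ∃ δ, 0 < δ ∧ δ ≤ r ∧ ∀ t ∈ Set.Ioo (-δ) δ, (∃ s ∈ Set.Ioo (-r) r, intCos θ s = t) ∧
      ∃ s ∈ Set.Ioo (-r) r, intSin θ s = t := by
  have hm : (0 : ℝ) ∈ Set.Ioo (-r) r := ⟨by linarith, hr⟩
  have hc := image_Ioo_mem_nhds (A' := fun s => Real.cos (θ s)) hr (contDiffOn_intCos hθ)
    (hasDerivAt_intCos hθ.continuousOn hm) (by simp [intCos])
    (Real.cos_pos_of_mem_Ioo ⟨by linarith [h0.1, Real.pi_pos], h0.2⟩).ne'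
  have hs := image_Ioo_mem_nhds (A' := fun s => Real.sin (θ s)) hr (contDiffOn_intSin hθ)
    (hasDerivAt_intSin hθ.continuousOn hm) (by simp [intSin])
    (Real.sin_pos_of_pos_of_lt_pi h0.1 (by linarith [h0.2, Real.pi_pos])).ne'
  obtain ⟨ε, hε, hsub⟩ := Metric.mem_nhds_iff.1 (Filter.inter_mem hc hs)
  refine ⟨min ε r, lt_min hε hr, min_le_right _ _, fun t ht => ?_⟩
  have : t ∈ Metric.ball (0 : ℝ) ε := by
    rw [Metric.mem_ball, Real.dist_eq, sub_zero, abs_lt]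
    constructor <;> linarith [ht.1, ht.2, min_le_left ε r]
  exact hsub this

end Surjectivity

section AngleData

variable {E : Type*} [NormedAddCommGroup E] [NormedSpace ℝ E]
  {F₁ : Type*} [NormedAddCommGroup F₁] [NormedSpace ℝ F₁]
  {F₂ : Type*} [NormedAddCommGroup F₂] [NormedSpace ℝ F₂]
  {c₁ c₂ : ℝ} {m₁ m₂ : ℕ} {O : Set E} {f N : E → Ambient c₁ m₁ × Ambient c₂ m₂}
  {a b : E → ℝ} {Φ : ℝ × F₁ × F₂ → E} {r : ℝ}

namespace AdaptedCoordinates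

variable (C : AdaptedCoordinates O f N a b Φ r) (h : AdaptedHypersurface O f N)

include C

theorem contDiffOn_slice₁ {V : Type*} [NormedAddCommGroup V] [NormedSpace ℝ V] {G : E → V}
    (hG : ContDiffOn ℝ ∞ G O) :
    ContDiffOn ℝ ∞ (fun u : F₁ => G (Φ (0, u, 0))) (Metric.ball 0 r) :=
  C.contDiffOn_comp hG ((0 : F₁ →L[ℝ] ℝ).prod
    ((ContinuousLinearMap.id ℝ F₁).prod (0 : F₁ →L[ℝ] F₂))) fun _ hu =>
      slice₁_mem_ball ⟨neg_lt_zero.2 (Metric.pos_of_mem_ball hu), Metric.pos_of_mem_ball hu⟩ hu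

theorem contDiffOn_slice₂ {V : Type*} [NormedAddCommGroup V] [NormedSpace ℝ V] {G : E → V}
    (hG : ContDiffOn ℝ ∞ G O) :
    ContDiffOn ℝ ∞ (fun u : F₂ => G (Φ (0, 0, u))) (Metric.ball 0 r) :=
  C.contDiffOn_comp hG ((0 : F₂ →L[ℝ] ℝ).prod
    ((0 : F₂ →L[ℝ] F₁).prod (ContinuousLinearMap.id ℝ F₂))) fun _ hu =>
      slice₂_mem_ball ⟨neg_lt_zero.2 (Metric.pos_of_mem_ball hu), Metric.pos_of_mem_ball hu⟩ hu

include h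

theorem hasFDerivAt_slice₁ {s : ℝ} {u : F₁} (hs : s ∈ Set.Ioo (-r) r)
    (hu : u ∈ Metric.ball 0 r) :
    HasFDerivAt (fun u : F₁ => (f (Φ (s, u, 0))).1)
      ((ContinuousLinearMap.fst ℝ _ _).comp (((fderiv ℝ f (Φ (s, u, 0))).comp
        (fderiv ℝ Φ (s, u, 0))).comp ((0 : F₁ →L[ℝ] ℝ).prod
          ((ContinuousLinearMap.id ℝ F₁).prod (0 : F₁ →L[ℝ] F₂))))) u := by
  have hid : HasFDerivAt (fun u : F₁ => u) (ContinuousLinearMap.id ℝ F₁) u := hasFDerivAt_id u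
  have h1 : HasFDerivAt (fun u : F₁ => ((s, u, 0) : ℝ × F₁ × F₂)) _ u :=
    (hasFDerivAt_const s u).prodMk (hid.prodMk (hasFDerivAt_const (0 : F₂) u))
  exact (HasFDerivAt.comp (f := fun u : F₁ => ((s, u, 0) : ℝ × F₁ × F₂)) u
    (C.hasFDerivAt_comp h h.smooth (slice₁_mem_ball hs hu)) h1).fst

theorem hasFDerivAt_slice₂ {s : ℝ} {u : F₂} (hs : s ∈ Set.Ioo (-r) r)
    (hu : u ∈ Metric.ball 0 r) :
    HasFDerivAt (fun u : F₂ => (f (Φ (s, 0, u))).2)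
      ((ContinuousLinearMap.snd ℝ _ _).comp (((fderiv ℝ f (Φ (s, 0, u))).comp
        (fderiv ℝ Φ (s, 0, u))).comp ((0 : F₂ →L[ℝ] ℝ).prod
          ((0 : F₂ →L[ℝ] F₁).prod (ContinuousLinearMap.id ℝ F₂))))) u := by
  have hid : HasFDerivAt (fun u : F₂ => u) (ContinuousLinearMap.id ℝ F₂) u := hasFDerivAt_id u
  have h1 : HasFDerivAt (fun u : F₂ => ((s, 0, u) : ℝ × F₁ × F₂)) _ u :=
    (hasFDerivAt_const s u).prodMk ((hasFDerivAt_const (0 : F₁) u).prodMk hid)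
  exact (HasFDerivAt.comp (f := fun u : F₂ => ((s, 0, u) : ℝ × F₁ × F₂)) u
    (C.hasFDerivAt_comp h h.smooth (slice₂_mem_ball hs hu)) h1).snd

/-- The parallel map of the profile at time `a(s)` is the slice `u₁ ↦ f₁(s, u₁, 0)`, whose
differential is injective in the coordinate `u₁`. -/
theorem parallel₁_inj {s : ℝ} {u : F₁} (hs : s ∈ Set.Ioo (-r) r) (hu : u ∈ Metric.ball 0 r)
    (v : F₁) (hv : fderiv ℝ (parallelMap c₁ (profile₁ f Φ) (profileNormal₁ N Φ)
      (intCos (angle N Φ) s)) u v = 0) : v = 0 := by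
  have h1 := (C.hasFDerivAt_slice₁ h hs hu).congr_of_eventuallyEq
    (f₁ := parallelMap c₁ (profile₁ f Φ) (profileNormal₁ N Φ) (intCos (angle N Φ) s))
    (Filter.mem_of_superset (Metric.isOpen_ball.mem_nhds hu) fun u' hu' =>
      (C.fst_eq h (slice₁_mem_ball hs hu')).symm)
  rw [h1.fderiv] at hv
  exact C.inj₁ _ (slice₁_mem_ball hs hu) (0, v, 0) hv

theorem parallel₂_inj {s : ℝ} {u : F₂} (hs : s ∈ Set.Ioo (-r) r) (hu : u ∈ Metric.ball 0 r)
    (v : F₂) (hv : fderiv ℝ (parallelMap c₂ (profile₂ f Φ) (profileNormal₂ N Φ)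
      (intSin (angle N Φ) s)) u v = 0) : v = 0 := by
  have h1 := (C.hasFDerivAt_slice₂ h hs hu).congr_of_eventuallyEq
    (f₁ := parallelMap c₂ (profile₂ f Φ) (profileNormal₂ N Φ) (intSin (angle N Φ) s))
    (Filter.mem_of_superset (Metric.isOpen_ball.mem_nhds hu) fun u' hu' =>
      (C.snd_eq h (slice₂_mem_ball hs hu')).symm)
  rw [h1.fderiv] at hv
  exact C.inj₂ _ (slice₂_mem_ball hs hu) (0, 0, v) hv

/-- In adapted coordinates a hypersurface is given by the angle construction. -/
theorem angleData {δ : ℝ} (hr : 0 < r) (hδr : δ ≤ r)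
    (hδ : ∀ t ∈ Set.Ioo (-δ) δ, (∃ s ∈ Set.Ioo (-r) r, intCos (angle N Φ) s = t) ∧
      ∃ s ∈ Set.Ioo (-r) r, intSin (angle N Φ) s = t) :
    AngleData (M₁ := (⟨Metric.ball 0 r, Metric.isOpen_ball⟩ : Opens F₁))
      (M₂ := (⟨Metric.ball 0 r, Metric.isOpen_ball⟩ : Opens F₂)) 𝓘(ℝ, F₁) 𝓘(ℝ, F₂) c₁ c₂
      (fun u => profile₁ f Φ u) (fun u => profileNormal₁ N Φ u)
      (fun u => profile₂ f Φ u) (fun u => profileNormal₂ N Φ u) δ (angle N Φ) := by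
  have h0 : (0 : ℝ) ∈ Set.Ioo (-r) r := ⟨by linarith, hr⟩
  have s₁ : ContDiffOn ℝ ∞ (profile₁ f Φ) (Metric.ball 0 r) := C.contDiffOn_slice₁ h.smooth.fst
  have n₁ : ContDiffOn ℝ ∞ (profileNormal₁ N Φ) (Metric.ball 0 r) :=
    C.contDiffOn_slice₁ h.contDiffOn_dir₁
  have s₂ : ContDiffOn ℝ ∞ (profile₂ f Φ) (Metric.ball 0 r) := C.contDiffOn_slice₂ h.smooth.snd
  have n₂ : ContDiffOn ℝ ∞ (profileNormal₂ N Φ) (Metric.ball 0 r) :=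
    C.contDiffOn_slice₂ h.contDiffOn_dir₂
  refine ⟨isImmersionInto_opens s₁ ?_ ?_, isUnitNormalOn_opens s₁ n₁ ?_ ?_ ?_,
    isImmersionInto_opens s₂ ?_ ?_, isUnitNormalOn_opens s₂ n₂ ?_ ?_ ?_, ?_, ?_,
    (C.contDiffOn_angle h).mono (Set.Ioo_subset_Ioo (neg_le_neg hδr) hδr)⟩
  · exact fun u hu => (h.mem _ (C.mapsTo _ (slice₁_mem_ball h0 hu))).1
  · intro u hu v hv
    have : fderiv ℝ (profile₁ f Φ) u = _ := (C.hasFDerivAt_slice₁ h h0 hu).fderiv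
    rw [this] at hv
    exact C.inj₁ _ (slice₁_mem_ball h0 hu) (0, v, 0) hv
  · exact fun u hu => h.dir₁_mem (C.mapsTo _ (slice₁_mem_ball h0 hu))
  · exact fun u hu => h.dir₁_unit (C.mapsTo _ (slice₁_mem_ball h0 hu))
  · intro u hu v
    have : fderiv ℝ (profile₁ f Φ) u = _ := (C.hasFDerivAt_slice₁ h h0 hu).fderiv
    rw [this]
    exact C.normal₁ _ (slice₁_mem_ball h0 hu) (0, v, 0) rfl
  · exact fun u hu => (h.mem _ (C.mapsTo _ (slice₂_mem_ball h0 hu))).2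
  · intro u hu v hv
    have : fderiv ℝ (profile₂ f Φ) u = _ := (C.hasFDerivAt_slice₂ h h0 hu).fderiv
    rw [this] at hv
    exact C.inj₂ _ (slice₂_mem_ball h0 hu) (0, 0, v) hv
  · exact fun u hu => h.dir₂_mem (C.mapsTo _ (slice₂_mem_ball h0 hu))
  · exact fun u hu => h.dir₂_unit (C.mapsTo _ (slice₂_mem_ball h0 hu))
  · intro u hu v
    have : fderiv ℝ (profile₂ f Φ) u = _ := (C.hasFDerivAt_slice₂ h h0 hu).fderiv
    rw [this]
    exact C.normal₂ _ (slice₂_mem_ball h0 hu) (0, 0, v) rfl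
  · intro t ht u
    -- Every admissible time is attained as `a(s)`, possibly with `s` outside `(-δ, δ)` but inside
    -- `(-r, r)`.
    obtain ⟨s, hs, rfl⟩ := (hδ t ht).1
    have hc : ContDiffOn ℝ ∞ (parallelMap c₁ (profile₁ f Φ) (profileNormal₁ N Φ)
      (intCos (angle N Φ) s)) (Metric.ball 0 r) := (s₁.const_smul _).add (n₁.const_smul _)
    have e := ContDiffOn.diffMap_opens
      (U := (⟨Metric.ball 0 r, Metric.isOpen_ball⟩ : Opens F₁)) hc u
    exact e ▸ (injective_iff_map_eq_zero (fderiv ℝ (parallelMap c₁ (profile₁ f Φ)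
      (profileNormal₁ N Φ) (intCos (angle N Φ) s)) u)).2 (C.parallel₁_inj h hs u.2)
  · intro t ht u
    obtain ⟨s, hs, rfl⟩ := (hδ t ht).2
    have hc : ContDiffOn ℝ ∞ (parallelMap c₂ (profile₂ f Φ) (profileNormal₂ N Φ)
      (intSin (angle N Φ) s)) (Metric.ball 0 r) := (s₂.const_smul _).add (n₂.const_smul _)
    have e := ContDiffOn.diffMap_opens
      (U := (⟨Metric.ball 0 r, Metric.isOpen_ball⟩ : Opens F₂)) hc u
    exact e ▸ (injective_iff_map_eq_zero (fderiv ℝ (parallelMap c₂ (profile₂ f Φ)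
      (profileNormal₂ N Φ) (intSin (angle N Φ) s)) u)).2 (C.parallel₂_inj h hs u.2)

end AdaptedCoordinates

end AngleData


/-! ### Constant mean curvature forces the profiles to be isoparametric -/

section ConstantMeanCurvature

variable {E₁ : Type*} [NormedAddCommGroup E₁] [NormedSpace ℝ E₁] [FiniteDimensional ℝ E₁]
  {H₁ : Type*} [TopologicalSpace H₁] {J₁ : ModelWithCorners ℝ E₁ H₁}
  {M₁ : Type*} [TopologicalSpace M₁] [ChartedSpace H₁ M₁]
  {E₂ : Type*} [NormedAddCommGroup E₂] [NormedSpace ℝ E₂] [FiniteDimensional ℝ E₂]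
  {H₂ : Type*} [TopologicalSpace H₂] {J₂ : ModelWithCorners ℝ E₂ H₂}
  {M₂ : Type*} [TopologicalSpace M₂] [ChartedSpace H₂ M₂]
  {c₁ c₂ : ℝ} {m₁ m₂ : ℕ} {h Nh : M₁ → Ambient c₁ m₁} {g Ng : M₂ → Ambient c₂ m₂}
  {δ : ℝ} {θ : ℝ → ℝ}

namespace AngleData

/-- Separation of variables: for fixed `s` and fixed point of `M₂`, only one term of the mean
curvature formula depends on the point of `M₁`, and its coefficient contains `sin θ ≠ 0`. So the
parallel hypersurface at time `a(s)` has constant mean curvature, and `a(s)` runs through a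
neighbourhood of `0`. The second factor works likewise with `cos θ ≠ 0`. -/
theorem isIsoparametric (D : AngleData J₁ J₂ c₁ c₂ h Nh g Ng δ θ)
    (hd₁ : Module.finrank ℝ E₁ + 1 = m₁) (hd₂ : Module.finrank ℝ E₂ + 1 = m₂)
    (hE₁ : 0 < Module.finrank ℝ E₁) (hE₂ : 0 < Module.finrank ℝ E₂) (hδ : 0 < δ)
    (hθ : ∀ s ∈ Set.Ioo (-δ) δ, θ s ∈ Set.Ioo 0 (Real.pi / 2)) [Nonempty M₁] [Nonempty M₂] {𝓗 : ℝ}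
    (hmean : ∀ p, meanCurvature (𝓘(ℝ, ℝ).prod (J₁.prod J₂)) (prodForm c₁ c₂)
      (angleMap c₁ c₂ h Nh g Ng δ θ) (angleNormal c₁ c₂ h Nh g Ng δ θ) p = 𝓗) :
    IsIsoparametric J₁ c₁ h Nh ∧ IsIsoparametric J₂ c₂ g Ng := by
  obtain ⟨ε, hε, hεδ, hsurj⟩ := exists_Ioo_subset_intCos_intSin hδ D.smooth
    (hθ 0 ⟨by linarith, hδ⟩)
  have hsub : Set.Ioo (-ε) ε ⊆ Set.Ioo (-δ) δ := Set.Ioo_subset_Ioo (neg_le_neg hεδ) hεδ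
  obtain ⟨z₁⟩ := ‹Nonempty M₁›
  obtain ⟨z₂⟩ := ‹Nonempty M₂›
  have hE₁' : (Module.finrank ℝ E₁ : ℝ) ≠ 0 := by positivity
  have hE₂' : (Module.finrank ℝ E₂ : ℝ) ≠ 0 := by positivity
  have key := fun p => (congrArg _ (hmean p)).symm.trans (D.meanCurvature_eq hd₁ hd₂ hE₁ hE₂ p)
  constructor
  · refine isIsoparametric_of_meanCurvature hd₁ hE₁ D.immersion₁ D.normal₁ hε
      (fun s hs => D.parallel₁ s (hsub hs)) fun t ht x y => ?_
    obtain ⟨s, hs, rfl⟩ := (hsurj t ht).1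
    have hsin : Real.sin (θ s) ≠ 0 :=
      (Real.sin_pos_of_pos_of_lt_pi (hθ s hs).1 (by linarith [(hθ s hs).2, Real.pi_pos])).ne'
    have e := (key (⟨s, hs⟩, x, z₂)).symm.trans (key (⟨s, hs⟩, y, z₂))
    refine mul_left_cancel₀ (mul_ne_zero hE₁' hsin) ?_
    linarith
  · refine isIsoparametric_of_meanCurvature hd₂ hE₂ D.immersion₂ D.normal₂ hε
      (fun s hs => D.parallel₂ s (hsub hs)) fun t ht x y => ?_
    obtain ⟨s, hs, rfl⟩ := (hsurj t ht).2
    have hcos : Real.cos (θ s) ≠ 0 :=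
      (Real.cos_pos_of_mem_Ioo ⟨by linarith [(hθ s hs).1, Real.pi_pos], (hθ s hs).2⟩).ne'
    have e := (key (⟨s, hs⟩, z₁, x)).symm.trans (key (⟨s, hs⟩, z₁, y))
    refine mul_left_cancel₀ (mul_ne_zero hE₂' hcos) ?_
    linarith

theorem interior_angle_eq_empty (hθ : ∀ s ∈ Set.Ioo (-δ) δ, θ s ∈ Set.Ioo 0 (Real.pi / 2)) :
    interior {s | s ∈ Set.Ioo (-δ) δ ∧ ∃ j : ℤ, θ s = j * (Real.pi / 2)} = ∅ := by
  have : {s | s ∈ Set.Ioo (-δ) δ ∧ ∃ j : ℤ, θ s = j * (Real.pi / 2)} = ∅ := by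
    refine Set.eq_empty_of_forall_notMem fun s hs => ?_
    obtain ⟨hs, j, hj⟩ := hs
    have h := hθ s hs
    rw [hj] at h
    have hpi : 0 < Real.pi / 2 := by positivity
    have h0 : (0 : ℝ) < j := pos_of_mul_pos_left h.1 hpi.le
    have h1 : (j : ℝ) < 1 := by
      by_contra hge
      have := mul_le_mul_of_nonneg_right (not_lt.1 hge) hpi.le
      linarith [h.2]
    have h0' : 0 < j := by exact_mod_cast h0
    have h1' : j < 1 := by exact_mod_cast h1
    omega
  rw [this, interior_empty]

/-- Once the profiles are isoparametric, the mean curvature formula at any one point over `s` is the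
differential equation. -/
theorem exists_isAngleSolution (D : AngleData J₁ J₂ c₁ c₂ h Nh g Ng δ θ)
    (hd₁ : Module.finrank ℝ E₁ + 1 = m₁) (hd₂ : Module.finrank ℝ E₂ + 1 = m₂)
    (hE₁ : 0 < Module.finrank ℝ E₁) (hE₂ : 0 < Module.finrank ℝ E₂) (hδ : 0 < δ)
    (hθ : ∀ s ∈ Set.Ioo (-δ) δ, θ s ∈ Set.Ioo 0 (Real.pi / 2)) [Nonempty M₁] [Nonempty M₂] {𝓗 : ℝ}
    (hmean : ∀ p, meanCurvature (𝓘(ℝ, ℝ).prod (J₁.prod J₂)) (prodForm c₁ c₂)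
      (angleMap c₁ c₂ h Nh g Ng δ θ) (angleNormal c₁ c₂ h Nh g Ng δ θ) p = 𝓗)
    {n k : ℕ} (hk : Module.finrank ℝ E₁ + 1 = k) (hn : k + Module.finrank ℝ E₂ = n) :
    ∃ Hh Hg, ParallelMeanCurvature J₁ c₁ h Nh δ Hh ∧ ParallelMeanCurvature J₂ c₂ g Ng δ Hg ∧
      IsAngleSolution n k 𝓗 δ Hh Hg θ := by
  obtain ⟨i₁, i₂⟩ := D.isIsoparametric hd₁ hd₂ hE₁ hE₂ hδ hθ hmean
  obtain ⟨Hh, hHh⟩ := exists_parallelMeanCurvature hd₁ hE₁ i₁ D.parallel₁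
  obtain ⟨Hg, hHg⟩ := exists_parallelMeanCurvature hd₂ hE₂ i₂ D.parallel₂
  refine ⟨Hh, Hg, hHh, hHg, D.smooth, interior_angle_eq_empty hθ, fun s hs => ?_⟩
  obtain ⟨z₁⟩ := ‹Nonempty M₁›
  obtain ⟨z₂⟩ := ‹Nonempty M₂›
  have e := D.meanCurvature_eq hd₁ hd₂ hE₁ hE₂ (⟨s, hs⟩, z₁, z₂)
  rw [hmean, hHh _ (intCos_mem hs), hHg _ (intSin_mem hs)] at e
  have hk' : (Module.finrank ℝ E₁ : ℝ) + 1 = k := by exact_mod_cast hk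
  have hn' : (k : ℝ) + Module.finrank ℝ E₂ = n := by exact_mod_cast hn
  rw [← hn', ← hk']
  linear_combination -e

end AngleData

end ConstantMeanCurvature

/-! ### Invariance of the mean curvature under diffeomorphisms -/

section Invariance

variable {E : Type*} [NormedAddCommGroup E] [NormedSpace ℝ E] [FiniteDimensional ℝ E]
  {H : Type*} [TopologicalSpace H] {J : ModelWithCorners ℝ E H}
  {M : Type*} [TopologicalSpace M] [ChartedSpace H M]
  {E' : Type*} [NormedAddCommGroup E'] [NormedSpace ℝ E']
  {H' : Type*} [TopologicalSpace H'] {J' : ModelWithCorners ℝ E' H'}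
  {P : Type*} [TopologicalSpace P] [ChartedSpace H' P]
  {V : Type*} [NormedAddCommGroup V] [NormedSpace ℝ V]

/-- The shape operator of the composite is conjugate to the original one by the differential of `Φ`,
so the traces agree. -/
theorem meanCurvature_comp (β : V →L[ℝ] V →L[ℝ] ℝ) {B : V → V → ℝ} (hB : ∀ v w, B v w = β v w)
    {f N : M → V} {Φ : P → M} {y : P} {Φ' : TangentSpace J' y →L[ℝ] TangentSpace J (Φ y)}
    (hΦ : HasMFDerivAt J' J Φ y Φ') (hbij : Function.Bijective Φ')
    (hf : HasDiff J f (Φ y) (diffMap J f (Φ y))) (hN : HasDiff J N (Φ y) (diffMap J N (Φ y)))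
    (hpos : ∀ X : TangentSpace J (Φ y), X ≠ 0 →
      0 < B (diffMap J f (Φ y) X) (diffMap J f (Φ y) X)) :
    meanCurvature J' B (fun z => f (Φ z)) (fun z => N (Φ z)) y = meanCurvature J B f N (Φ y) := by
  let e : TangentSpace J' y ≃ₗ[ℝ] TangentSpace J (Φ y) :=
    LinearEquiv.ofBijective Φ'.toLinearMap hbij
  have he : ∀ X, Φ' (e.symm X) = X := fun X => e.apply_symm_apply X
  have df := (hf.comp_mfderiv hΦ).diffMap_apply
  have dN := (hN.comp_mfderiv hΦ).diffMap_apply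
  have hA := isShapeOperator_shapeOperator (J := J) β hB (N := N) hpos
  set A := shapeOperator J B f N (Φ y)
  have hA' : IsShapeOperator J' B (fun z => f (Φ z)) (fun z => N (Φ z)) y (e.symm.conj A) := by
    intro X Y
    rw [df, df, dN]
    simp only [ContinuousLinearMap.comp_apply, LinearEquiv.conj_apply, LinearMap.comp_apply,
      LinearEquiv.coe_coe, he, LinearEquiv.symm_symm]
    exact hA (Φ' X) (Φ' Y)
  have hpos' : ∀ X : TangentSpace J' y, X ≠ 0 →
      0 < B (diffMap J' (fun z => f (Φ z)) y X) (diffMap J' (fun z => f (Φ z)) y X) := by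
    intro X hX
    rw [df]
    exact hpos _ fun h0 => hX (hbij.1 (h0.trans (map_zero Φ').symm))
  have hfin : Module.finrank ℝ E' = Module.finrank ℝ E := e.finrank_eq
  rw [meanCurvature, meanCurvature, hA'.eq β hB hpos', LinearMap.trace_conj', hfin]

end Invariance


/-! ### Charts -/

section Chart

variable {E : Type*} [NormedAddCommGroup E] [NormedSpace ℝ E]
  {M : Type*} [TopologicalSpace M] [ChartedSpace E M] [IsManifold 𝓘(ℝ, E) ∞ M]

theorem hasMFDerivAt_chart_symm (x₀ : M) {y : E} (hy : y ∈ (chartAt E x₀).target) :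
    HasMFDerivAt 𝓘(ℝ, E) 𝓘(ℝ, E) (chartAt E x₀).symm y
      (mfderiv 𝓘(ℝ, E) 𝓘(ℝ, E) (chartAt E x₀).symm y) :=
  (((contMDiffOn_chart_symm (n := ∞) (I := 𝓘(ℝ, E))).contMDiffAt
    ((chartAt E x₀).open_target.mem_nhds hy)).mdifferentiableAt (by simp)).hasMFDerivAt

theorem bijective_mfderiv_chart_symm (x₀ : M) {y : E} (hy : y ∈ (chartAt E x₀).target) :
    Function.Bijective (mfderiv 𝓘(ℝ, E) 𝓘(ℝ, E) (chartAt E x₀).symm y) := by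
  have : IsManifold 𝓘(ℝ, E) 1 M := IsManifold.of_le (n := ∞) ENat.LEInfty.out
  exact (mdifferentiable_chart (I := 𝓘(ℝ, E)) x₀).symm.mfderiv_bijective hy

variable {V : Type*} [NormedAddCommGroup V] [NormedSpace ℝ V]

theorem fderiv_comp_chart_symm {G : M → V} {x₀ : M} {y : E} (hy : y ∈ (chartAt E x₀).target)
    (hG : HasDiff 𝓘(ℝ, E) G ((chartAt E x₀).symm y)
      (diffMap 𝓘(ℝ, E) G ((chartAt E x₀).symm y))) (Y : E) :
    fderiv ℝ (fun z => G ((chartAt E x₀).symm z)) y Y =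
      diffMap 𝓘(ℝ, E) G ((chartAt E x₀).symm y)
        (mfderiv 𝓘(ℝ, E) 𝓘(ℝ, E) (chartAt E x₀).symm y Y) := by
  rw [← mfderiv_eq_fderiv]
  exact HasDiff.diffMap_apply (hG.comp_mfderiv (hasMFDerivAt_chart_symm x₀ hy)) Y

theorem ContMDiffOn.comp_chart_symm {G : M → V} {U : Set M} (hG : ContMDiffOn 𝓘(ℝ, E) 𝓘(ℝ, V) ∞ G U)
    (x₀ : M) : ContDiffOn ℝ ∞ (fun z => G ((chartAt E x₀).symm z))
      ((chartAt E x₀).target ∩ (chartAt E x₀).symm ⁻¹' U) :=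
  contMDiffOn_iff_contDiffOn.1 (hG.comp
    (contMDiffOn_chart_symm.mono Set.inter_subset_left) fun _ hy => hy.2)

theorem IsUnitNormalOn.chartHypersurface {c₁ c₂ : ℝ} {m₁ m₂ : ℕ}
    {f N : M → Ambient c₁ m₁ × Ambient c₂ m₂} {U : Set M} (hf : IsProductImmersion 𝓘(ℝ, E) c₁ c₂ f)
    (hN : IsUnitNormalOn 𝓘(ℝ, E) (prodForm c₁ c₂) (prodTangent c₁ c₂) f N U) (hU : IsOpen U)
    (x₀ : M) :
    ChartHypersurface ((chartAt E x₀).target ∩ (chartAt E x₀).symm ⁻¹' U)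
      (fun y => f ((chartAt E x₀).symm y)) (fun y => N ((chartAt E x₀).symm y)) where
  isOpen := (chartAt E x₀).isOpen_inter_preimage_symm hU
  smooth := hf.smooth.contMDiffOn.comp_chart_symm x₀
  smooth_normal := hN.smooth.comp_chart_symm x₀
  mem y _ := hf.mem _
  tangent y hy := hN.tangent _ hy.2
  unit y hy := hN.unit _ hy.2
  normal y hy X := by
    rw [fderiv_comp_chart_symm hy.1 (hf.hasDiff _)]
    exact hN.normal _ hy.2 _
  inj y hy := by
    refine (injective_iff_map_eq_zero _).2 fun X hX => ?_
    rw [fderiv_comp_chart_symm hy.1 (hf.hasDiff _)] at hX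
    have h1 := hf.injective_diff _ (hX.trans (map_zero _).symm)
    exact (bijective_mfderiv_chart_symm x₀ hy.1).1 (h1.trans (map_zero _).symm)

theorem InClassA.adaptedHypersurface [FiniteDimensional ℝ E] {c₁ c₂ : ℝ} {m₁ m₂ : ℕ}
    {f N : M → Ambient c₁ m₁ × Ambient c₂ m₂} {U : Set M} (hA : InClassA 𝓘(ℝ, E) c₁ c₂ f)
    (hf : IsProductImmersion 𝓘(ℝ, E) c₁ c₂ f) (hdim : m₁ + m₂ = Module.finrank ℝ E + 1)
    (hN : IsUnitNormalOn 𝓘(ℝ, E) (prodForm c₁ c₂) (prodTangent c₁ c₂) f N U) (hU : IsOpen U)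
    (h₁ : ∀ x ∈ U, (N x).1 ≠ 0) (h₂ : ∀ x ∈ U, (N x).2 ≠ 0) (x₀ : M) :
    AdaptedHypersurface ((chartAt E x₀).target ∩ (chartAt E x₀).symm ⁻¹' U)
      (fun y => f ((chartAt E x₀).symm y)) (fun y => N ((chartAt E x₀).symm y)) where
  toChartHypersurface := hN.chartHypersurface hf hU x₀
  ne₁ y hy := h₁ _ hy.2
  ne₂ y hy := h₂ _ hy.2
  const₁ y hy X hX := by
    rw [fderiv_comp_chart_symm hy.1 (hf.hasDiff _)] at hX
    rw [fderiv_comp_chart_symm hy.1 (hN.hasDiff (hU.mem_nhds hy.2))]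
    exact (hA.normal_diff_eq_zero hf hdim hN hU hy.2 (h₁ _ hy.2) (h₂ _ hy.2) _).2 hX
  const₂ y hy X hX := by
    rw [fderiv_comp_chart_symm hy.1 (hf.hasDiff _)] at hX
    rw [fderiv_comp_chart_symm hy.1 (hN.hasDiff (hU.mem_nhds hy.2))]
    exact (hA.normal_diff_eq_zero hf hdim hN hU hy.2 (h₁ _ hy.2) (h₂ _ hy.2) _).1 hX

variable {F : Type*} [NormedAddCommGroup F] [NormedSpace ℝ F]
  {E' : Type*} [NormedAddCommGroup E'] [NormedSpace ℝ E']
  {H' : Type*} [TopologicalSpace H'] {J' : ModelWithCorners ℝ E' H'}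
  {P : Type*} [TopologicalSpace P] [ChartedSpace H' P]

theorem hasMFDerivAt_comp_chart_symm {x₀ : M} {j : P → F} {Φ : F → E} {p : P}
    {j' : TangentSpace J' p →L[ℝ] F} (hj : HasDiff J' j p j') {Φ' : F →L[ℝ] E}
    (hΦ : HasFDerivAt Φ Φ' (j p)) (hmem : Φ (j p) ∈ (chartAt E x₀).target) :
    HasMFDerivAt J' 𝓘(ℝ, E) (fun p => (chartAt E x₀).symm (Φ (j p))) p
      ((mfderiv 𝓘(ℝ, E) 𝓘(ℝ, E) (chartAt E x₀).symm (Φ (j p))).comp (Φ'.comp j')) :=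
  HasMFDerivAt.comp p (hasMFDerivAt_chart_symm x₀ hmem) (hΦ.comp_hasDiff hj)

/-- Composing an open embedding into a vector space, a local diffeomorphism of vector spaces and
the inverse of a chart gives a diffeomorphism onto an open set. -/
theorem isDiffeoOntoOpen_comp_chart_symm [CompleteSpace F] (x₀ : M) {j : P → F} {Φ : F → E}
    {W : Set F} (hW : IsOpen W) (hj : ContMDiff J' 𝓘(ℝ, F) ∞ j) (hje : Topology.IsOpenEmbedding j)
    (hjb : ∀ p, ∃ j', HasDiff J' j p j' ∧ Function.Bijective j') (hjW : ∀ p, j p ∈ W)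
    (hΦ : ContDiffOn ℝ ∞ Φ W) (hinj : Set.InjOn Φ W)
    (hbij : ∀ w ∈ W, Function.Bijective (fderiv ℝ Φ w))
    (hmem : ∀ w ∈ W, Φ w ∈ (chartAt E x₀).target) [FiniteDimensional ℝ E] :
    IsDiffeoOntoOpen J' 𝓘(ℝ, E) (fun p => (chartAt E x₀).symm (Φ (j p))) where
  smooth := (contMDiffOn_chart_symm (n := ∞) (I := 𝓘(ℝ, E))).comp_contMDiff
    (hΦ.contMDiffOn.comp_contMDiff hj hjW) fun p => hmem _ (hjW p)
  openEmbedding := by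
    have : CompleteSpace E := FiniteDimensional.complete ℝ E
    refine .of_continuous_injective_isOpenMap ?_ ?_ (isOpenMap_iff_nhds_le.2 fun p => ?_)
    · exact ((chartAt E x₀).symm.continuousOn.comp hΦ.continuousOn hmem).comp_continuous
        hje.continuous hjW
    · intro p p' hp
      exact hje.injective (hinj (hjW p) (hjW p')
        ((chartAt E x₀).symm.injOn (hmem _ (hjW p)) (hmem _ (hjW p')) hp))
    · have h1 : Filter.map Φ (nhds (j p)) = nhds (Φ (j p)) :=
        HasStrictFDerivAt.map_nhds_eq_of_equiv
          (f' := ContinuousLinearEquiv.ofBijective (fderiv ℝ Φ (j p))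
            (LinearMap.ker_eq_bot.2 (hbij _ (hjW p)).1)
            (LinearMap.range_eq_top.2 (hbij _ (hjW p)).2))
          ((hΦ.contDiffAt (hW.mem_nhds (hjW p))).hasStrictFDerivAt (by simp))
      have h2 := (chartAt E x₀).symm.map_nhds_eq (x := Φ (j p)) (hmem _ (hjW p))
      rw [← h2, ← h1, ← hje.map_nhds_eq, Filter.map_map, Filter.map_map]
      rfl
  bijective_diff p := by
    obtain ⟨j', hj', hb⟩ := hjb p
    have hd := ((hΦ.contDiffAt (hW.mem_nhds (hjW p))).differentiableAt (by simp)).hasFDerivAt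
    rw [(hasMFDerivAt_comp_chart_symm hj' hd (hmem _ (hjW p))).mfderiv]
    exact (bijective_mfderiv_chart_symm x₀ (hmem _ (hjW p))).comp ((hbij _ (hjW p)).comp hb)

end Chart

/-! ### Boxes -/

section Box

variable {F₁ : Type*} [NormedAddCommGroup F₁] [NormedSpace ℝ F₁]
  {F₂ : Type*} [NormedAddCommGroup F₂] [NormedSpace ℝ F₂]
  (U₁ : Opens F₁) (U₂ : Opens F₂)

/-- The inclusion of a product of open sets. -/
def boxIncl {F₁ F₂ : Type*} [TopologicalSpace F₁] [TopologicalSpace F₂]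
    (U₁ : Opens F₁) (U₂ : Opens F₂) (p : U₁ × U₂) : F₁ × F₂ := (p.1, p.2)

theorem hasDiff_boxIncl (p : U₁ × U₂) :
    HasDiff (𝓘(ℝ, F₁).prod 𝓘(ℝ, F₂)) (boxIncl U₁ U₂) p (ContinuousLinearMap.id ℝ (F₁ × F₂)) := by
  have h1 := HasDiff.comp_mfderiv (J := 𝓘(ℝ, F₁)) (f := (Subtype.val : U₁ → F₁))
    (hasMFDerivAt_opens_val U₁ p.1) (hasMFDerivAt_fst (I := 𝓘(ℝ, F₁)) (I' := 𝓘(ℝ, F₂)) p)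
  have h2 := HasDiff.comp_mfderiv (J := 𝓘(ℝ, F₂)) (f := (Subtype.val : U₂ → F₂))
    (hasMFDerivAt_opens_val U₂ p.2) (hasMFDerivAt_snd (I := 𝓘(ℝ, F₁)) (I' := 𝓘(ℝ, F₂)) p)
  exact h1.prodMk h2

theorem contMDiff_boxIncl :
    ContMDiff (𝓘(ℝ, F₁).prod 𝓘(ℝ, F₂)) 𝓘(ℝ, F₁ × F₂) ∞ (boxIncl U₁ U₂) :=
  (contMDiff_subtype_val.comp contMDiff_fst).prodMk_space
    (contMDiff_subtype_val.comp contMDiff_snd)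

theorem isOpenEmbedding_boxIncl {F₁ F₂ : Type*} [TopologicalSpace F₁] [TopologicalSpace F₂]
    (U₁ : Opens F₁) (U₂ : Opens F₂) : Topology.IsOpenEmbedding (boxIncl U₁ U₂) :=
  U₁.2.isOpenEmbedding_subtypeVal.prodMap U₂.2.isOpenEmbedding_subtypeVal

variable (δ : ℝ)

/-- The inclusion of a product of an interval and two open sets. -/
def intervalBoxIncl {F₁ F₂ : Type*} [TopologicalSpace F₁] [TopologicalSpace F₂]
    (U₁ : Opens F₁) (U₂ : Opens F₂) (δ : ℝ) (p : symmInterval δ × U₁ × U₂) : ℝ × F₁ × F₂ :=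
    (p.1, p.2.1, p.2.2)

theorem hasDiff_intervalBoxIncl (p : symmInterval δ × U₁ × U₂) :
    HasDiff (𝓘(ℝ, ℝ).prod (𝓘(ℝ, F₁).prod 𝓘(ℝ, F₂))) (intervalBoxIncl U₁ U₂ δ) p
      (ContinuousLinearMap.id ℝ (ℝ × F₁ × F₂)) := by
  have h1 := HasDiff.comp_mfderiv (J := 𝓘(ℝ, ℝ)) (f := (Subtype.val : symmInterval δ → ℝ))
    (hasMFDerivAt_opens_val (symmInterval δ) p.1)
    (hasMFDerivAt_fst (I := 𝓘(ℝ, ℝ)) (I' := 𝓘(ℝ, F₁).prod 𝓘(ℝ, F₂)) p)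
  have h2 := HasDiff.comp_mfderiv (J := 𝓘(ℝ, F₁).prod 𝓘(ℝ, F₂)) (f := boxIncl U₁ U₂)
    (hasDiff_boxIncl U₁ U₂ p.2)
    (hasMFDerivAt_snd (I := 𝓘(ℝ, ℝ)) (I' := 𝓘(ℝ, F₁).prod 𝓘(ℝ, F₂)) p)
  exact h1.prodMk h2

theorem contMDiff_intervalBoxIncl :
    ContMDiff (𝓘(ℝ, ℝ).prod (𝓘(ℝ, F₁).prod 𝓘(ℝ, F₂))) 𝓘(ℝ, ℝ × F₁ × F₂) ∞
      (intervalBoxIncl U₁ U₂ δ) :=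
  (contMDiff_subtype_val.comp contMDiff_fst).prodMk_space
    ((contMDiff_boxIncl U₁ U₂).comp contMDiff_snd)

theorem isOpenEmbedding_intervalBoxIncl {F₁ F₂ : Type*} [TopologicalSpace F₁] [TopologicalSpace F₂]
    (U₁ : Opens F₁) (U₂ : Opens F₂) (δ : ℝ) :
    Topology.IsOpenEmbedding (intervalBoxIncl U₁ U₂ δ) :=
  (symmInterval δ).2.isOpenEmbedding_subtypeVal.prodMap (isOpenEmbedding_boxIncl U₁ U₂)

end Box


/-! ### The local form of hypersurfaces in class `𝒜` with constant mean curvature -/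

section LocalForm

variable {E : Type*} [NormedAddCommGroup E] [NormedSpace ℝ E] [FiniteDimensional ℝ E]
  {M : Type*} [TopologicalSpace M] [ChartedSpace E M] [IsManifold 𝓘(ℝ, E) ∞ M]
  {F₁ : Type*} [NormedAddCommGroup F₁] [NormedSpace ℝ F₁] [FiniteDimensional ℝ F₁]
  {F₂ : Type*} [NormedAddCommGroup F₂] [NormedSpace ℝ F₂] [FiniteDimensional ℝ F₂]
  {c₁ c₂ : ℝ} {m₁ m₂ : ℕ} {f N : M → Ambient c₁ m₁ × Ambient c₂ m₂}

/-- A chart reduces the problem to a ball of a vector space, where adapted coordinates exist; the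
range of `s` is then shortened so that all parallel maps at times in `(-δ, δ)` are controlled. -/
theorem InClassA.exists_angle_construction (hA : InClassA 𝓘(ℝ, E) c₁ c₂ f)
    (hf : IsProductImmersion 𝓘(ℝ, E) c₁ c₂ f) (hdim : m₁ + m₂ = Module.finrank ℝ E + 1)
    (h₁ : Module.finrank ℝ F₁ + 1 = m₁) (h₂ : Module.finrank ℝ F₂ + 1 = m₂)
    (hF₁ : 0 < Module.finrank ℝ F₁) (hF₂ : 0 < Module.finrank ℝ F₂) {𝓗 : ℝ} {U : Set M}
    (hU : IsOpen U) (hN : IsUnitNormalOn 𝓘(ℝ, E) (prodForm c₁ c₂) (prodTangent c₁ c₂) f N U)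
    (hmean : ∀ x ∈ U, meanCurvature 𝓘(ℝ, E) (prodForm c₁ c₂) f N x = 𝓗)
    (hN₁ : ∀ x ∈ U, (N x).1 ≠ 0) (hN₂ : ∀ x ∈ U, (N x).2 ≠ 0) {x₀ : M} (hx₀ : x₀ ∈ U) :
    ∃ (M₁ : Opens F₁) (M₂ : Opens F₂) (h Nh : M₁ → Ambient c₁ m₁) (g Ng : M₂ → Ambient c₂ m₂)
      (δ : ℝ) (Hh Hg θ : ℝ → ℝ) (Φ : symmInterval δ × M₁ × M₂ → M),
      IsIsoparametric 𝓘(ℝ, F₁) c₁ h Nh ∧ IsIsoparametric 𝓘(ℝ, F₂) c₂ g Ng ∧ 0 < δ ∧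
      ParallelImmersions 𝓘(ℝ, F₁) c₁ h Nh δ ∧ ParallelImmersions 𝓘(ℝ, F₂) c₂ g Ng δ ∧
      ParallelMeanCurvature 𝓘(ℝ, F₁) c₁ h Nh δ Hh ∧
      ParallelMeanCurvature 𝓘(ℝ, F₂) c₂ g Ng δ Hg ∧
      IsAngleSolution (Module.finrank ℝ E) m₁ 𝓗 δ Hh Hg θ ∧
      IsDiffeoOntoOpen (𝓘(ℝ, ℝ).prod (𝓘(ℝ, F₁).prod 𝓘(ℝ, F₂))) 𝓘(ℝ, E) Φ ∧
      x₀ ∈ Set.range Φ ∧ ∀ p, f (Φ p) = angleMap c₁ c₂ h Nh g Ng δ θ p := by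
  set e := chartAt E x₀
  have hchart := hA.adaptedHypersurface hf hdim hN hU hN₁ hN₂ x₀
  have hy₀ : e x₀ ∈ e.target ∩ e.symm ⁻¹' U := by
    refine ⟨mem_chart_target E x₀, ?_⟩
    rw [Set.mem_preimage, e.left_inv (mem_chart_source E x₀)]
    exact hx₀
  obtain ⟨ρ, hρ, hsub⟩ := Metric.isOpen_iff.1 hchart.isOpen _ hy₀
  have H := hchart.mono Metric.isOpen_ball hsub
  obtain ⟨a, b, Φ, r, hr, hΦ0, C⟩ := H.exists_adaptedCoordinates (F₁ := F₁) (F₂ := F₂) hdim h₁ h₂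
    (convex_ball _ _) (Metric.mem_ball_self hρ)
  set fc := fun y => f (e.symm y)
  set Nc := fun y => N (e.symm y)
  have h0r : (0 : ℝ) ∈ Set.Ioo (-r) r := ⟨by linarith, hr⟩
  obtain ⟨δ, hδ, hδr, hsurj⟩ := exists_Ioo_subset_intCos_intSin hr (C.contDiffOn_angle H)
    (C.angle_mem H h0r)
  have D := C.angleData H hr hδr hsurj
  set M₁ : Opens F₁ := ⟨Metric.ball 0 r, Metric.isOpen_ball⟩
  set M₂ : Opens F₂ := ⟨Metric.ball 0 r, Metric.isOpen_ball⟩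
  have hIoo : Set.Ioo (-δ) δ ⊆ Set.Ioo (-r) r := Set.Ioo_subset_Ioo (neg_le_neg hδr) hδr
  have hj : ∀ p : symmInterval δ × M₁ × M₂,
      intervalBoxIncl M₁ M₂ δ p ∈ Metric.ball (0 : ℝ × F₁ × F₂) r := fun p =>
    mem_ball_prod_iff.2 ⟨hIoo p.1.2, p.2.1.2, p.2.2.2⟩
  have hjb : ∀ p : symmInterval δ × M₁ × M₂, ∃ j',
      HasDiff (𝓘(ℝ, ℝ).prod (𝓘(ℝ, F₁).prod 𝓘(ℝ, F₂))) (intervalBoxIncl M₁ M₂ δ) p j' ∧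
        Function.Bijective j' :=
    fun p => ⟨_, hasDiff_intervalBoxIncl M₁ M₂ δ p, Function.bijective_id⟩
  have hmem : ∀ w ∈ Metric.ball 0 r, Φ w ∈ e.target ∩ e.symm ⁻¹' U := fun w hw =>
    hsub (C.mapsTo w hw)
  have hdiffeo := isDiffeoOntoOpen_comp_chart_symm x₀ Metric.isOpen_ball
    (contMDiff_intervalBoxIncl M₁ M₂ δ) (isOpenEmbedding_intervalBoxIncl M₁ M₂ δ) hjb hj
    C.smooth C.injOn C.bijective fun w hw => (hmem w hw).1
  have hθ : ∀ s ∈ Set.Ioo (-δ) δ, angle Nc Φ s ∈ Set.Ioo 0 (Real.pi / 2) :=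
    fun s hs => C.angle_mem H (hIoo hs)
  have hfΦ : ∀ p : symmInterval δ × M₁ × M₂, f (e.symm (Φ (intervalBoxIncl M₁ M₂ δ p))) =
      angleMap c₁ c₂ (fun u : M₁ => profile₁ fc Φ u) (fun u : M₁ => profileNormal₁ Nc Φ u)
        (fun u : M₂ => profile₂ fc Φ u) (fun u : M₂ => profileNormal₂ Nc Φ u) δ (angle Nc Φ) p :=
    fun p => Prod.ext (C.fst_eq H (hj p)) (C.snd_eq H (hj p))
  -- The given normal, and not only its negative, corresponds to the normal of the angle map, so the
  -- mean curvature keeps its sign.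
  have hNΦ : ∀ p : symmInterval δ × M₁ × M₂, N (e.symm (Φ (intervalBoxIncl M₁ M₂ δ p))) =
      angleNormal c₁ c₂ (fun u : M₁ => profile₁ fc Φ u) (fun u : M₁ => profileNormal₁ Nc Φ u)
        (fun u : M₂ => profile₂ fc Φ u) (fun u : M₂ => profileNormal₂ Nc Φ u) δ
        (angle Nc Φ) p := by
    intro p
    refine Prod.ext ((H.normal_fst_eq (C.mapsTo _ (hj p))).trans ?_)
      ((H.normal_snd_eq (C.mapsTo _ (hj p))).trans ?_)
    · rw [C.dir₁_eq H (hj p), ← C.sin_angle H (hj p)]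
      rfl
    · rw [C.dir₂_eq H (hj p), ← C.cos_angle H (hj p)]
      rfl
  have hmean' : ∀ p, meanCurvature (𝓘(ℝ, ℝ).prod (𝓘(ℝ, F₁).prod 𝓘(ℝ, F₂))) (prodForm c₁ c₂)
      (angleMap c₁ c₂ (fun u : M₁ => profile₁ fc Φ u) (fun u : M₁ => profileNormal₁ Nc Φ u)
        (fun u : M₂ => profile₂ fc Φ u) (fun u : M₂ => profileNormal₂ Nc Φ u) δ (angle Nc Φ))
      (angleNormal c₁ c₂ (fun u : M₁ => profile₁ fc Φ u) (fun u : M₁ => profileNormal₁ Nc Φ u)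
        (fun u : M₂ => profile₂ fc Φ u) (fun u : M₂ => profileNormal₂ Nc Φ u) δ (angle Nc Φ)) p =
      𝓗 := by
    intro p
    rw [← funext hfΦ, ← funext hNΦ]
    have hp := (hmem _ (hj p)).2
    refine (meanCurvature_comp (J := 𝓘(ℝ, E)) (prodFormL c₁ c₂ m₁ m₂) (fun _ _ => rfl)
      (hdiffeo.smooth.mdifferentiableAt (by simp)).hasMFDerivAt (hdiffeo.bijective_diff p)
      (hf.hasDiff _) (hN.hasDiff (hU.mem_nhds hp)) fun X hX => ?_).trans (hmean _ hp)
    refine prodForm_pos c₁ c₂ (hf.mem (e.symm (Φ (intervalBoxIncl M₁ M₂ δ p)))) ⟨?_, ?_⟩ fun h0 =>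
      hX (hf.injective_diff _ (h0.trans (map_zero _).symm))
    · exact (hf.hasDiff _).fst.mem_spaceFormTangent
        (Filter.Eventually.of_forall fun y => (hf.mem y).1) X
    · exact (hf.hasDiff _).snd.mem_spaceFormTangent
        (Filter.Eventually.of_forall fun y => (hf.mem y).2) X
  have z₁ : Nonempty M₁ := ⟨⟨0, Metric.mem_ball_self hr⟩⟩
  have z₂ : Nonempty M₂ := ⟨⟨0, Metric.mem_ball_self hr⟩⟩
  obtain ⟨i₁, i₂⟩ := D.isIsoparametric h₁ h₂ hF₁ hF₂ hδ hθ hmean'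
  obtain ⟨Hh, Hg, hHh, hHg, hsol⟩ := D.exists_isAngleSolution h₁ h₂ hF₁ hF₂ hδ hθ hmean' h₁
    (n := Module.finrank ℝ E) (by omega)
  refine ⟨M₁, M₂, _, _, _, _, δ, Hh, Hg, angle Nc Φ, _, i₁, i₂, hδ, D.parallel₁, D.parallel₂,
    hHh, hHg, hsol, hdiffeo, ?_, hfΦ⟩
  refine ⟨(⟨0, ⟨by linarith, hδ⟩⟩, ⟨0, Metric.mem_ball_self hr⟩, ⟨0, Metric.mem_ball_self hr⟩), ?_⟩
  have : Φ (0, 0, 0) = e x₀ := hΦ0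
  change e.symm (Φ (0, 0, 0)) = x₀
  rw [this, e.left_inv (mem_chart_source E x₀)]

end LocalForm


/-! ### Splitting where one component of the unit normal vanishes -/

section ProductCoordinates

variable {E F₁ F₂ V₁ V₂ : Type*} [NormedAddCommGroup E] [NormedSpace ℝ E]
  [NormedAddCommGroup F₁] [NormedSpace ℝ F₁] [NormedAddCommGroup F₂] [NormedSpace ℝ F₂]
  [NormedAddCommGroup V₁] [NormedSpace ℝ V₁] [NormedAddCommGroup V₂] [NormedSpace ℝ V₂]

/-- The summand of `X` in `ker L₂` has the same image under `L₁` as `X` and is killed by both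
composites, so it is zero. -/
theorem eq_zero_of_decomposition {L₁ : E →L[ℝ] V₁} {L₂ : E →L[ℝ] V₂} {ℓ₁ : V₁ →L[ℝ] F₁}
    {ℓ₂ : V₂ →L[ℝ] F₂} (hdec : ∀ X, ∃ X₁ X₂, X = X₁ + X₂ ∧ L₂ X₁ = 0 ∧ L₁ X₂ = 0)
    (hinj : ∀ X, ℓ₁ (L₁ X) = 0 → ℓ₂ (L₂ X) = 0 → X = 0) {X : E} (hX : ℓ₁ (L₁ X) = 0) :
    L₁ X = 0 := by
  obtain ⟨X₁, X₂, rfl, h1, h2⟩ := hdec X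
  rw [map_add, h2, add_zero] at hX ⊢
  rw [hinj X₁ hX (by rw [h1, map_zero]), map_zero]

variable [FiniteDimensional ℝ E] [FiniteDimensional ℝ F₁] [FiniteDimensional ℝ F₂]
  [FiniteDimensional ℝ V₁] [FiniteDimensional ℝ V₂]

/-- Coordinates `(u₁, u₂)` in which two maps with complementary kernels depend only on `u₁` and
`u₂`, respectively. -/
theorem exists_product_coordinates {O : Set E} (hO : IsOpen O) {P : E → V₁} {Q : E → V₂}
    (hP : ContDiffOn ℝ ∞ P O) (hQ : ContDiffOn ℝ ∞ Q O)
    (hdec : ∀ x ∈ O, ∀ X, ∃ X₁ X₂, X = X₁ + X₂ ∧ fderiv ℝ Q x X₁ = 0 ∧ fderiv ℝ P x X₂ = 0)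
    (hPQ : ∀ x ∈ O, ∀ X, fderiv ℝ P x X = 0 → fderiv ℝ Q x X = 0 → X = 0) {x₀ : E} (hx₀ : x₀ ∈ O)
    (hdim : Module.finrank ℝ E = Module.finrank ℝ F₁ + Module.finrank ℝ F₂)
    (h₁ : Module.finrank ℝ (LinearMap.range (fderiv ℝ P x₀).toLinearMap) ≤ Module.finrank ℝ F₁)
    (h₂ : Module.finrank ℝ (LinearMap.range (fderiv ℝ Q x₀).toLinearMap) ≤ Module.finrank ℝ F₂) :
    ∃ (Φ : F₁ × F₂ → E) (r : ℝ), 0 < r ∧ Φ 0 = x₀ ∧ ContDiffOn ℝ ∞ Φ (Metric.ball 0 r) ∧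
      (∀ w ∈ Metric.ball 0 r, Φ w ∈ O) ∧ Set.InjOn Φ (Metric.ball 0 r) ∧
      (∀ w ∈ Metric.ball 0 r, Function.Bijective (fderiv ℝ Φ w)) ∧
      (∀ w ∈ Metric.ball 0 r, ∀ w' ∈ Metric.ball 0 r, (P (Φ w) = P (Φ w') ↔ w.1 = w'.1) ∧
        (Q (Φ w) = Q (Φ w') ↔ w.2 = w'.2)) ∧
      ∀ w ∈ Metric.ball 0 r, ∀ v, (fderiv ℝ P (Φ w) (fderiv ℝ Φ w v) = 0 → v.1 = 0) ∧
        (fderiv ℝ Q (Φ w) (fderiv ℝ Φ w v) = 0 → v.2 = 0) := by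
  have dP : ∀ x ∈ O, HasFDerivAt P (fderiv ℝ P x) x := fun x hx =>
    ((hP.contDiffAt (hO.mem_nhds hx)).differentiableAt (by simp)).hasFDerivAt
  have dQ : ∀ x ∈ O, HasFDerivAt Q (fderiv ℝ Q x) x := fun x hx =>
    ((hQ.contDiffAt (hO.mem_nhds hx)).differentiableAt (by simp)).hasFDerivAt
  obtain ⟨ℓ₁, hℓ₁⟩ := exists_clm_injective_on_range (F := F₁) _ h₁
  obtain ⟨ℓ₂, hℓ₂⟩ := exists_clm_injective_on_range (F := F₂) _ h₂
  set Ψ : E → F₁ × F₂ := fun x => (ℓ₁ (P x) - ℓ₁ (P x₀), ℓ₂ (Q x) - ℓ₂ (Q x₀))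
  have hΨ : ContDiffOn ℝ ∞ Ψ O := ((ℓ₁.contDiff.comp_contDiffOn hP).sub contDiffOn_const).prodMk
      ((ℓ₂.contDiff.comp_contDiffOn hQ).sub contDiffOn_const)
  have dΨ : ∀ x ∈ O, HasFDerivAt Ψ ((ℓ₁.comp (fderiv ℝ P x)).prod (ℓ₂.comp (fderiv ℝ Q x))) x :=
    fun x hx => ((ℓ₁.hasFDerivAt.comp x (dP x hx)).sub_const _).prodMk
      ((ℓ₂.hasFDerivAt.comp x (dQ x hx)).sub_const _)
  have hΨ0 : Ψ x₀ = 0 := by simp [Ψ]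
  have hfin : Module.finrank ℝ E = Module.finrank ℝ (F₁ × F₂) := by
    rw [Module.finrank_prod, hdim]
  obtain ⟨W, Φ, hW, hW0, hΦ, hΦ0, hΦO, hΨΦ⟩ := exists_smooth_localInverse hfin hO hΨ hx₀ (by
    intro X hX
    rw [(dΨ x₀ hx₀).fderiv] at hX
    exact hPQ x₀ hx₀ X (hℓ₁ X (congrArg Prod.fst hX)) (hℓ₂ X (congrArg Prod.snd hX)))
  rw [hΨ0] at hW0 hΦ0
  obtain ⟨r, hr, hrW⟩ := Metric.isOpen_iff.1 hW 0 hW0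
  have hmem : ∀ w ∈ Metric.ball (0 : F₁ × F₂) r, Φ w ∈ O := fun w hw => hΦO w (hrW hw)
  have hdΦ : ∀ w ∈ Metric.ball 0 r, HasFDerivAt Φ (fderiv ℝ Φ w) w := fun w hw =>
    ((hΦ.contDiffAt (hW.mem_nhds (hrW hw))).differentiableAt (by simp)).hasFDerivAt
  have hcomp : ∀ w ∈ Metric.ball 0 r, ∀ v, ((ℓ₁ (fderiv ℝ P (Φ w) (fderiv ℝ Φ w v)),
      ℓ₂ (fderiv ℝ Q (Φ w) (fderiv ℝ Φ w v))) : F₁ × F₂) = v := by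
    intro w hw v
    have h1 := ((dΨ _ (hmem w hw)).comp w (hdΦ w hw)).unique
      ((hasFDerivAt_id w).congr_of_eventuallyEq
        (Filter.mem_of_superset (hW.mem_nhds (hrW hw)) fun y hy => hΨΦ y hy))
    exact DFunLike.congr_fun h1 v
  have hbij : ∀ w ∈ Metric.ball 0 r, Function.Bijective (fderiv ℝ Φ w) := by
    intro w hw
    have hi : Function.Injective (fderiv ℝ Φ w).toLinearMap :=
      (Function.LeftInverse.injective
        (g := fun X => (ℓ₁ (fderiv ℝ P (Φ w) X), ℓ₂ (fderiv ℝ Q (Φ w) X))) (hcomp w hw) :)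
    exact ⟨hi, (LinearMap.injective_iff_surjective_of_finrank_eq_finrank hfin.symm).1 hi⟩
  have hinj : ∀ w ∈ Metric.ball 0 r, ∀ X, ℓ₁ (fderiv ℝ P (Φ w) X) = 0 →
      ℓ₂ (fderiv ℝ Q (Φ w) X) = 0 → X = 0 := by
    intro w hw X h1 h2
    obtain ⟨v, rfl⟩ := (hbij w hw).2 X
    rw [← hcomp w hw v, h1, h2]
    exact map_zero _
  refine ⟨Φ, r, hr, hΦ0, hΦ.mono hrW, hmem, ?_, hbij, ?_, ?_⟩
  · intro w hw w' hw' e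
    rw [← hΨΦ w (hrW hw), e, hΨΦ w' (hrW hw')]
  · intro w hw w' hw'
    have e := hΨΦ w (hrW hw)
    have e' := hΨΦ w' (hrW hw')
    refine ⟨⟨fun h => ?_, fun h => ?_⟩, fun h => ?_, fun h => ?_⟩
    · rw [← e, ← e']
      simp only [Ψ, h]
    -- Along the fibres of `w ↦ w.1` the projection of `dP` vanishes, hence `dP` itself does, at
    -- every point of the ball although `ℓ₁` was chosen at `x₀`.
    · refine eq_of_fderiv_ker_eq_zero (convex_ball 0 r) (G := fun w => P (Φ w))
        (fun w hw => (dP _ (hmem w hw)).comp w (hdΦ w hw)) (LinearMap.fst ℝ F₁ F₂)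
        (fun w hw v hv => ?_) hw hw' h
      refine eq_zero_of_decomposition (hdec _ (hmem w hw)) (hinj w hw) ?_
      exact (congrArg Prod.fst (hcomp w hw v)).trans hv
    · rw [← e, ← e']
      simp only [Ψ, h]
    · refine eq_of_fderiv_ker_eq_zero (convex_ball 0 r) (G := fun w => Q (Φ w))
        (fun w hw => (dQ _ (hmem w hw)).comp w (hdΦ w hw)) (LinearMap.snd ℝ F₁ F₂)
        (fun w hw v hv => ?_) hw hw' h
      refine eq_zero_of_decomposition (ℓ₁ := ℓ₂) (ℓ₂ := ℓ₁) (L₂ := fderiv ℝ P (Φ w))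
        (fun X => ?_) (fun X h1 h2 => hinj w hw X h2 h1) ?_
      · obtain ⟨X₁, X₂, hX, h1, h2⟩ := hdec _ (hmem w hw) X
        exact ⟨X₂, X₁, hX.trans (add_comm _ _), h2, h1⟩
      · exact (congrArg Prod.snd (hcomp w hw v)).trans hv
  · intro w hw v
    have e := hcomp w hw v
    refine ⟨fun h => ?_, fun h => ?_⟩
    · rw [← e, h]
      exact map_zero _
    · rw [← e, h]
      exact map_zero _

end ProductCoordinates

section PointData

variable {E : Type*} [NormedAddCommGroup E] [NormedSpace ℝ E]
  {c₁ c₂ : ℝ} {m₁ m₂ : ℕ}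

namespace PointData

variable {p₁ N₁ : Ambient c₁ m₁} {p₂ N₂ : Ambient c₂ m₂}
    {L₁ K₁ : E →L[ℝ] Ambient c₁ m₁} {L₂ K₂ : E →L[ℝ] Ambient c₂ m₂}
    (P : PointData p₁ N₁ p₂ N₂ L₁ K₁ L₂ K₂)

include P

theorem range_le : LinearMap.range L₁.toLinearMap ≤ tangentSub c₁ p₁ := by
  rintro _ ⟨X, rfl⟩
  exact P.diff_mem₁ X

theorem finrank_range_le : Module.finrank ℝ (LinearMap.range L₁.toLinearMap) ≤ m₁ :=
  (Submodule.finrank_mono P.range_le).trans (finrank_tangentSub c₁ P.mem₁).le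

/-- Here `N₁` is a unit tangent vector orthogonal to the range of `L₁`. -/
theorem finrank_range_lt (h : N₂ = 0) :
    Module.finrank ℝ (LinearMap.range L₁.toLinearMap) < m₁ := by
  have hu := P.unit
  rw [h, flatForm_zero_left, add_zero] at hu
  have hlt : LinearMap.range L₁.toLinearMap < tangentSub c₁ p₁ := by
    refine SetLike.lt_iff_le_and_exists.2 ⟨P.range_le, N₁, P.tangent₁, ?_⟩
    rintro ⟨X, hX⟩
    have hn := P.normal X
    have hX' : L₁ X = N₁ := hX
    rw [hX', h, flatForm_zero_left, add_zero, hu] at hn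
    exact one_ne_zero hn
  exact (Submodule.finrank_lt_finrank_of_lt hlt).trans_eq (finrank_tangentSub c₁ P.mem₁)

/-- Under this hypothesis `(L₁ X, 0)` is already orthogonal to the normal, so it is tangent to `f`.
-/
theorem exists_decomposition (h : ∀ X, flatForm c₁ N₁ (L₁ X) = 0) (X : E) :
    ∃ X₁ X₂, X = X₁ + X₂ ∧ L₂ X₁ = 0 ∧ L₁ X₂ = 0 := by
  obtain ⟨X₁, h1, h2⟩ := P.onto (L₁ X) (P.diff_mem₁ X) 0 (tangentSub c₂ p₂).zero_mem (by
    rw [h X, flatForm_zero_right, add_zero])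
  refine ⟨X₁, X - X₁, by abel, h2, ?_⟩
  rw [map_sub, h1, sub_self]

end PointData

end PointData

/-! ### Local splitting of a hypersurface. -/

section Splitting

variable {E : Type*} [NormedAddCommGroup E] [NormedSpace ℝ E] [FiniteDimensional ℝ E]
  {M : Type*} [TopologicalSpace M] [ChartedSpace E M] [IsManifold 𝓘(ℝ, E) ∞ M]
  {F₁ : Type*} [NormedAddCommGroup F₁] [NormedSpace ℝ F₁] [FiniteDimensional ℝ F₁]
  {F₂ : Type*} [NormedAddCommGroup F₂] [NormedSpace ℝ F₂] [FiniteDimensional ℝ F₂]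
  {c₁ c₂ : ℝ} {m₁ m₂ : ℕ} {f N : M → Ambient c₁ m₁ × Ambient c₂ m₂}

/-- If the differentials of the two components of a hypersurface have complementary kernels, then
the hypersurface is locally a product. -/
theorem IsUnitNormalOn.exists_product (hf : IsProductImmersion 𝓘(ℝ, E) c₁ c₂ f)
    (hdim : m₁ + m₂ = Module.finrank ℝ E + 1) {U : Set M} (hU : IsOpen U)
    (hN : IsUnitNormalOn 𝓘(ℝ, E) (prodForm c₁ c₂) (prodTangent c₁ c₂) f N U)
    (hperp : ∀ x ∈ U, (N x).1 = 0 ∨ (N x).2 = 0) {x₀ : M} (hx₀ : x₀ ∈ U)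
    (hfin : Module.finrank ℝ E = Module.finrank ℝ F₁ + Module.finrank ℝ F₂)
    (hF₁ : m₁ ≤ Module.finrank ℝ F₁ ∨ (N x₀).2 = 0 ∧ m₁ ≤ Module.finrank ℝ F₁ + 1)
    (hF₂ : m₂ ≤ Module.finrank ℝ F₂ ∨ (N x₀).1 = 0 ∧ m₂ ≤ Module.finrank ℝ F₂ + 1) :
    ∃ (U₁ : Opens F₁) (U₂ : Opens F₂) (Φ : U₁ × U₂ → M) (f₁ : U₁ → Ambient c₁ m₁)
      (f₂ : U₂ → Ambient c₂ m₂), IsDiffeoOntoOpen (𝓘(ℝ, F₁).prod 𝓘(ℝ, F₂)) 𝓘(ℝ, E) Φ ∧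
      (Set.range Φ).Nonempty ∧
      IsImmersionInto 𝓘(ℝ, F₁) (spaceForm c₁ m₁) f₁ ∧ Function.Injective f₁ ∧
      IsImmersionInto 𝓘(ℝ, F₂) (spaceForm c₂ m₂) f₂ ∧ Function.Injective f₂ ∧
      ∀ u, f (Φ u) = (f₁ u.1, f₂ u.2) := by
  set e := chartAt E x₀
  have H := hN.chartHypersurface hf hU x₀
  set O := e.target ∩ e.symm ⁻¹' U
  set fc := fun y => f (e.symm y)
  have hy₀ : e x₀ ∈ O := by
    refine ⟨mem_chart_target E x₀, ?_⟩
    rw [Set.mem_preimage, e.left_inv (mem_chart_source E x₀)]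
    exact hx₀
  have d₁ : ∀ y ∈ O, fderiv ℝ (fun y => (fc y).1) y =
    (ContinuousLinearMap.fst ℝ _ _).comp (fderiv ℝ fc y) :=
        fun y hy => (H.hasFDerivAt hy).fst.fderiv
  have d₂ : ∀ y ∈ O, fderiv ℝ (fun y => (fc y).2) y =
    (ContinuousLinearMap.snd ℝ _ _).comp (fderiv ℝ fc y) :=
        fun y hy => (H.hasFDerivAt hy).snd.fderiv
  have hP₀ := H.pointData hdim hy₀
  have hx : e.symm (e x₀) = x₀ := e.left_inv (mem_chart_source E x₀)
  obtain ⟨Φ, r, hr, -, hΦ, hΦO, hinj, hbij, hiff, hker⟩ := exists_product_coordinates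
    (F₁ := F₁) (F₂ := F₂) H.isOpen (P := fun y => (fc y).1) (Q := fun y => (fc y).2)
    H.smooth.fst H.smooth.snd
    (fun y hy X => by
      rw [d₁ y hy, d₂ y hy]
      refine (H.pointData hdim hy).exists_decomposition (fun Y => ?_) X
      have hn := (H.pointData hdim hy).normal Y
      -- In both cases `⟨N₁, df₁ Y⟩ = 0`, so it does not matter whether the same component of the
      -- normal vanishes throughout `U`.
      rcases hperp _ hy.2 with h0 | h0
      · rw [h0, flatForm_zero_left]
      · rwa [h0, flatForm_zero_left, add_zero] at hn)
    (fun y hy X h1 h2 => by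
      rw [d₁ y hy] at h1
      rw [d₂ y hy] at h2
      exact (H.pointData hdim hy).inj X h1 h2)
    hy₀ hfin
    (by
      rw [d₁ _ hy₀]
      -- The rank is needed only at the base point; a vanishing second component of the normal there
      -- lowers the rank of `df₁` by one.
      rcases hF₁ with h | ⟨h, h'⟩
      · exact hP₀.finrank_range_le.trans h
      · have := hP₀.finrank_range_lt (by rw [hx, h])
        omega)
    (by
      rw [d₂ _ hy₀]
      rcases hF₂ with h | ⟨h, h'⟩
      · exact hP₀.swap.finrank_range_le.trans h
      · have := hP₀.swap.finrank_range_lt (by rw [hx, h])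
        omega)
  set U₁ : Opens F₁ := ⟨Metric.ball 0 r, Metric.isOpen_ball⟩
  set U₂ : Opens F₂ := ⟨Metric.ball 0 r, Metric.isOpen_ball⟩
  have hj : ∀ u₁ ∈ U₁, ∀ u₂ ∈ U₂, (u₁, u₂) ∈ Metric.ball (0 : F₁ × F₂) r := by
    intro u₁ h1 u₂ h2
    have : (u₁, u₂) ∈ Metric.ball (0 : F₁) r ×ˢ Metric.ball (0 : F₂) r := ⟨h1, h2⟩
    rwa [ball_prod_same] at this
  have z₁ : (0 : F₁) ∈ U₁ := Metric.mem_ball_self hr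
  have z₂ : (0 : F₂) ∈ U₂ := Metric.mem_ball_self hr
  have hd : ∀ w ∈ Metric.ball (0 : F₁ × F₂) r, HasFDerivAt (fun w => fc (Φ w))
      ((fderiv ℝ fc (Φ w)).comp (fderiv ℝ Φ w)) w := fun w hw =>
    (H.hasFDerivAt (hΦO w hw)).comp w
      ((hΦ.contDiffAt (Metric.isOpen_ball.mem_nhds hw)).differentiableAt (by simp)).hasFDerivAt
  have hs : ContDiffOn ℝ ∞ (fun w => fc (Φ w)) (Metric.ball 0 r) := H.smooth.comp hΦ hΦO
  have hdiffeo := isDiffeoOntoOpen_comp_chart_symm x₀ Metric.isOpen_ball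
    (contMDiff_boxIncl U₁ U₂) (isOpenEmbedding_boxIncl U₁ U₂)
    (fun p => ⟨_, hasDiff_boxIncl U₁ U₂ p, Function.bijective_id⟩)
    (fun p => hj _ p.1.2 _ p.2.2) hΦ hinj hbij fun w hw => (hΦO w hw).1
  have s₁ : ContDiffOn ℝ ∞ (fun u : F₁ => (fc (Φ (u, 0))).1) U₁ :=
    (hs.comp (contDiff_id.prodMk contDiff_const).contDiffOn fun u hu => hj u hu 0 z₂).fst
  have s₂ : ContDiffOn ℝ ∞ (fun u : F₂ => (fc (Φ (0, u))).2) U₂ :=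
    (hs.comp (contDiff_const.prodMk contDiff_id).contDiffOn fun u hu => hj 0 z₁ u hu).snd
  refine ⟨U₁, U₂, _, fun u => (fc (Φ (u, 0))).1, fun u => (fc (Φ (0, u))).2, hdiffeo,
    ⟨_, ⟨(⟨0, z₁⟩, ⟨0, z₂⟩), rfl⟩⟩, isImmersionInto_opens s₁ (fun u _ => (hf.mem _).1) ?_, ?_,
    isImmersionInto_opens s₂ (fun u _ => (hf.mem _).2) ?_, ?_, fun u => Prod.ext ?_ ?_⟩
  · intro u hu v hv
    have hw := hj u hu 0 z₂
    have hid : HasFDerivAt (fun u : F₁ => (u, (0 : F₂))) (ContinuousLinearMap.inl ℝ F₁ F₂) u :=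
      (ContinuousLinearMap.inl ℝ F₁ F₂).hasFDerivAt
    have h1 : HasFDerivAt (fun u : F₁ => (fc (Φ (u, 0))).1) _ u :=
      (HasFDerivAt.comp (f := fun u : F₁ => (u, (0 : F₂))) u (hd _ hw) hid).fst
    rw [HasFDerivAt.fderiv h1] at hv
    refine (hker _ hw (v, 0)).1 ?_
    rw [d₁ _ (hΦO _ hw)]
    exact hv
  · intro u u' h
    exact Subtype.ext ((hiff _ (hj _ u.2 0 z₂) _ (hj _ u'.2 0 z₂)).1.1 h)
  · intro u hu v hv
    have hw := hj 0 z₁ u hu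
    have hid : HasFDerivAt (fun u : F₂ => ((0 : F₁), u)) (ContinuousLinearMap.inr ℝ F₁ F₂) u :=
      (ContinuousLinearMap.inr ℝ F₁ F₂).hasFDerivAt
    have h1 : HasFDerivAt (fun u : F₂ => (fc (Φ (0, u))).2) _ u :=
      (HasFDerivAt.comp (f := fun u : F₂ => ((0 : F₁), u)) u (hd _ hw) hid).snd
    rw [HasFDerivAt.fderiv h1] at hv
    refine (hker _ hw (0, v)).2 ?_
    rw [d₂ _ (hΦO _ hw)]
    exact hv
  · intro u u' h
    exact Subtype.ext ((hiff _ (hj 0 z₁ _ u.2) _ (hj 0 z₁ _ u'.2)).2.1 h)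
  · exact (hiff _ (hj _ u.1.2 _ u.2.2) _ (hj _ u.1.2 0 z₂)).1.2 rfl
  · exact (hiff _ (hj _ u.1.2 _ u.2.2) _ (hj 0 z₁ _ u.2.2)).2.2 rfl

end Splitting


/-! ### The converse -/

section Converse

theorem IsUnitNormalOn.mono {E : Type*} [NormedAddCommGroup E] [NormedSpace ℝ E]
    {H : Type*} [TopologicalSpace H] {J : ModelWithCorners ℝ E H}
    {M : Type*} [TopologicalSpace M] [ChartedSpace H M]
    {V : Type*} [NormedAddCommGroup V] [NormedSpace ℝ V] {B : V → V → ℝ} {T : V → Set V}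
    {f N : M → V} {U U' : Set M} (h : IsUnitNormalOn J B T f N U) (hsub : U' ⊆ U) :
    IsUnitNormalOn J B T f N U' where
  smooth := h.smooth.mono hsub
  tangent x hx := h.tangent x (hsub hx)
  unit x hx := h.unit x (hsub hx)
  normal x hx := h.normal x (hsub hx)

variable {n : ℕ} {M : Type*} [TopologicalSpace M] [ChartedSpace (EuclideanSpace ℝ (Fin n)) M]
  {c₁ c₂ : ℝ} {m₁ m₂ : ℕ}

/-- The set of points near which there is a unit normal field with mean curvature `𝓗` and
nowhere vanishing components. -/
def genericSet (f : M → Ambient c₁ m₁ × Ambient c₂ m₂) (𝓗 : ℝ) : Set M :=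
  {x | ∃ U : Set M, IsOpen U ∧ x ∈ U ∧ ∃ N : M → Ambient c₁ m₁ × Ambient c₂ m₂,
    IsUnitNormalOn (𝓡 n) (prodForm c₁ c₂) (prodTangent c₁ c₂) f N U ∧
    (∀ y ∈ U, meanCurvature (𝓡 n) (prodForm c₁ c₂) f N y = 𝓗) ∧
    (∀ y ∈ U, (N y).1 ≠ 0) ∧ ∀ y ∈ U, (N y).2 ≠ 0}

variable {f : M → Ambient c₁ m₁ × Ambient c₂ m₂} {𝓗 : ℝ}

theorem isOpen_genericSet : IsOpen (genericSet (n := n) f 𝓗) := by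
  refine isOpen_iff_forall_mem_open.2 fun x hx => ?_
  obtain ⟨U, hU, hxU, h⟩ := hx
  exact ⟨U, fun y hy => ⟨U, hU, hy, h⟩, hU, hxU⟩

/-- On an open set missing the generic points, one component of the normal vanishes at each point
near which the mean curvature normal is given. There `f` is locally a product, and the component
vanishing at the chosen point tells which factor carries the hypersurface. -/
theorem dense_genericSet [IsManifold (𝓡 n) ∞ M] (hm₁ : 0 < m₁) (hm₂ : 0 < m₂)
    (hdim : m₁ + m₂ = n + 1) (hf : IsProductImmersion (𝓡 n) c₁ c₂ f)
    (hH : HasConstantMeanCurvature (𝓡 n) c₁ c₂ f 𝓗) (hsplit : NowhereSplits (𝓡 n) c₁ c₂ f) :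
    Dense (genericSet (n := n) f 𝓗) := by
  refine dense_iff_inter_open.2 fun V hV hne => ?_
  obtain ⟨x, hxV⟩ := hne
  obtain ⟨U, hU, hxU, N, hN, hmean⟩ := hH x
  have hUV : IsOpen (U ∩ V) := hU.inter hV
  have hN' := hN.mono (Set.inter_subset_left (s := U) (t := V))
  by_cases hex : ∃ y ∈ U ∩ V, (N y).1 ≠ 0 ∧ (N y).2 ≠ 0
  · obtain ⟨y, hy, h1, h2⟩ := hex
    -- By continuity both components stay nonzero near `y`, so `y` is a generic point in `V`.
    have hopen : IsOpen ((U ∩ V) ∩ N ⁻¹' {w | w.1 ≠ 0 ∧ w.2 ≠ 0}) :=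
      hN'.smooth.continuousOn.isOpen_inter_preimage hUV
        ((isOpen_ne.preimage continuous_fst).inter (isOpen_ne.preimage continuous_snd))
    exact ⟨y, hy.2, _, hopen, ⟨hy, h1, h2⟩, N, hN'.mono Set.inter_subset_left,
      fun z hz => hmean z hz.1.1, fun z hz => hz.2.1, fun z hz => hz.2.2⟩
  exfalso
  have hperp : ∀ y ∈ U ∩ V, (N y).1 = 0 ∨ (N y).2 = 0 := by
    intro y hy
    by_contra hcon
    exact hex ⟨y, hy, not_or.1 hcon⟩
  have hE : m₁ + m₂ = Module.finrank ℝ (EuclideanSpace ℝ (Fin n)) + 1 := by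
    rw [finrank_euclideanSpace_fin, hdim]
  -- If the first component of the normal vanishes at `x`, the first factor is parametrized by an
  -- open set of full dimension `m₁` and the second carries a hypersurface; otherwise the roles are
  -- exchanged.
  rcases hperp x ⟨hxU, hxV⟩ with h0 | h0
  · obtain ⟨U₁, U₂, Φ, f₁, f₂, hΦ, hne, hf₁, hi₁, hf₂, -, heq⟩ :=
      hN'.exists_product (F₁ := EuclideanSpace ℝ (Fin m₁)) (F₂ := EuclideanSpace ℝ (Fin (m₂ - 1)))
        hf hE hUV hperp ⟨hxU, hxV⟩ (by simp only [finrank_euclideanSpace_fin]; omega)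
        (Or.inl (by simp)) (Or.inr ⟨h0, by simp only [finrank_euclideanSpace_fin]; omega⟩)
    exact hsplit _ hΦ.openEmbedding.isOpen_range hne
      (Or.inr ⟨U₁, U₂, Φ, f₁, f₂, hΦ, rfl, hf₁, hi₁, hf₂, heq⟩)
  · obtain ⟨U₁, U₂, Φ, f₁, f₂, hΦ, hne, hf₁, -, hf₂, hi₂, heq⟩ :=
      hN'.exists_product (F₁ := EuclideanSpace ℝ (Fin (m₁ - 1))) (F₂ := EuclideanSpace ℝ (Fin m₂))
        hf hE hUV hperp ⟨hxU, hxV⟩ (by simp only [finrank_euclideanSpace_fin]; omega)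
        (Or.inr ⟨h0, by simp only [finrank_euclideanSpace_fin]; omega⟩) (Or.inl (by simp))
    exact hsplit _ hΦ.openEmbedding.isOpen_range hne
      (Or.inl ⟨U₁, U₂, Φ, f₁, f₂, hΦ, rfl, hf₁, hf₂, hi₂, heq⟩)

end Converse

theorem theorem4p1 (n k : ℕ) (hk : 2 ≤ k) (hkn : k + 1 ≤ n) (c₁ c₂ 𝓗 : ℝ) :
    -- direct statement
    (∀ (M₁ : Type*) [TopologicalSpace M₁] [ChartedSpace (EuclideanSpace ℝ (Fin (k - 1))) M₁]
        [IsManifold (𝓡 (k - 1)) ∞ M₁]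
        (M₂ : Type*) [TopologicalSpace M₂] [ChartedSpace (EuclideanSpace ℝ (Fin (n - k))) M₂]
        [IsManifold (𝓡 (n - k)) ∞ M₂]
        (h Nh : M₁ → Ambient c₁ k) (g Ng : M₂ → Ambient c₂ (n - k + 1)) (δ : ℝ),
        IsIsoparametric (𝓡 (k - 1)) c₁ h Nh →
        IsIsoparametric (𝓡 (n - k)) c₂ g Ng →
        0 < δ →
        ParallelImmersions (𝓡 (k - 1)) c₁ h Nh δ →
        ParallelImmersions (𝓡 (n - k)) c₂ g Ng δ →
        -- the parallel hypersurfaces have constant mean curvatures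
        (∃ Hh, ParallelMeanCurvature (𝓡 (k - 1)) c₁ h Nh δ Hh) ∧
        (∃ Hg, ParallelMeanCurvature (𝓡 (n - k)) c₂ g Ng δ Hg) ∧
        ∀ Hh Hg θ : ℝ → ℝ,
          ParallelMeanCurvature (𝓡 (k - 1)) c₁ h Nh δ Hh →
          ParallelMeanCurvature (𝓡 (n - k)) c₂ g Ng δ Hg →
          IsAngleSolution n k 𝓗 δ Hh Hg θ →
          IsProductImmersion (𝓘(ℝ, ℝ).prod ((𝓡 (k - 1)).prod (𝓡 (n - k)))) c₁ c₂
            (angleMap c₁ c₂ h Nh g Ng δ θ) ∧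
          HasConstantMeanCurvature (𝓘(ℝ, ℝ).prod ((𝓡 (k - 1)).prod (𝓡 (n - k)))) c₁ c₂
            (angleMap c₁ c₂ h Nh g Ng δ θ) 𝓗 ∧
          InClassA (𝓘(ℝ, ℝ).prod ((𝓡 (k - 1)).prod (𝓡 (n - k)))) c₁ c₂
            (angleMap c₁ c₂ h Nh g Ng δ θ) ∧
          NowhereSplits (𝓘(ℝ, ℝ).prod ((𝓡 (k - 1)).prod (𝓡 (n - k)))) c₁ c₂
            (angleMap c₁ c₂ h Nh g Ng δ θ)) ∧
    -- converse; being local, it is stated with `M₁`, `M₂` open subsets of Euclidean spaces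
    (∀ (M : Type*) [TopologicalSpace M] [ChartedSpace (EuclideanSpace ℝ (Fin n)) M]
        [IsManifold (𝓡 n) ∞ M] (f : M → Ambient c₁ k × Ambient c₂ (n - k + 1)),
        IsProductImmersion (𝓡 n) c₁ c₂ f →
        HasConstantMeanCurvature (𝓡 n) c₁ c₂ f 𝓗 →
        InClassA (𝓡 n) c₁ c₂ f →
        NowhereSplits (𝓡 n) c₁ c₂ f →
        ∃ U : Set M, IsOpen U ∧ Dense U ∧ ∀ x ∈ U,
          ∃ (M₁ : Opens (EuclideanSpace ℝ (Fin (k - 1))))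
            (M₂ : Opens (EuclideanSpace ℝ (Fin (n - k))))
            (h Nh : M₁ → Ambient c₁ k) (g Ng : M₂ → Ambient c₂ (n - k + 1))
            (δ : ℝ) (Hh Hg θ : ℝ → ℝ) (Φ : symmInterval δ × M₁ × M₂ → M),
            IsIsoparametric (𝓡 (k - 1)) c₁ h Nh ∧
            IsIsoparametric (𝓡 (n - k)) c₂ g Ng ∧
            0 < δ ∧
            ParallelImmersions (𝓡 (k - 1)) c₁ h Nh δ ∧
            ParallelImmersions (𝓡 (n - k)) c₂ g Ng δ ∧
            ParallelMeanCurvature (𝓡 (k - 1)) c₁ h Nh δ Hh ∧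
            ParallelMeanCurvature (𝓡 (n - k)) c₂ g Ng δ Hg ∧
            IsAngleSolution n k 𝓗 δ Hh Hg θ ∧
            IsDiffeoOntoOpen (𝓘(ℝ, ℝ).prod ((𝓡 (k - 1)).prod (𝓡 (n - k)))) (𝓡 n) Φ ∧
            x ∈ Set.range Φ ∧
            ∀ p, f (Φ p) = angleMap c₁ c₂ h Nh g Ng δ θ p) := by
  refine ⟨fun M₁ _ _ _ M₂ _ _ _ h Nh g Ng δ hh hg _ hpar₁ hpar₂ =>
    direct_statement n k hk hkn c₁ c₂ 𝓗 M₁ M₂ h Nh g Ng δ hh hg hpar₁ hpar₂, ?_⟩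
  intro M _ _ _ f hf hH hA hsplit
  refine ⟨genericSet (n := n) f 𝓗, isOpen_genericSet,
    dense_genericSet (by omega) (by omega) (by omega) hf hH hsplit, fun x hx => ?_⟩
  obtain ⟨U, hU, hxU, N, hN, hmean, hN₁, hN₂⟩ := hx
  have hfin := hA.exists_angle_construction (F₁ := EuclideanSpace ℝ (Fin (k - 1)))
    (F₂ := EuclideanSpace ℝ (Fin (n - k))) hf
    (by rw [finrank_euclideanSpace_fin]; omega) (by rw [finrank_euclideanSpace_fin]; omega)
    (by rw [finrank_euclideanSpace_fin]) (by rw [finrank_euclideanSpace_fin]; omega)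
    (by rw [finrank_euclideanSpace_fin]; omega) hU hN hmean hN₁ hN₂ hxU
  rwa [finrank_euclideanSpace_fin] at hfin
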